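/- Let $G$ be an $n$-vertex planar $st$-graph, i.e. an acyclic digraph (without parallel edges) with exactly one source $s$ and exactly one sink $t$ that admits a planar embedding in which $s$ and $t$ lie on the boundary of the outer face. An $st$-cutset of $G$ is a set $W$ of edges whose removal leaves exactly two connected components $C_s\ni s$ and $C_t\ni t$ such that every edge of $W$ has its tail in $C_s$ and its head in $C_t$. Let $k$ be the maximum size of an $st$-cutset of $G$, and let $S$ be a set of $n$ points in the plane, no two with the same $y$-coordinate. An upward pointset embedding (UPSE) of $G$ on $S$ is a planar straight-line drawing of $G$ that maps the vertices bijectively to the points of $S$ and in which the tail of every edge is lower than its head. There is an algorithm (a single program for a real RAM with unit-cost operations) that, given any such $G$ (as a list of edges) and $S$ (as a list of points), after a set-up phase of $O(k\,n^{4k}\log n)$ time, outputs all UPSEs of $G$ on $S$, each exactly once and written out in full as a placement of the vertices, and then halts, with $O(n)$ worst-case delay: $O(n)$ time passes between the end of the set-up phase and the first output, between any two consecutive outputs, and between the last output and the end of the computation. The algorithm uses integer words of $O(k\log n)$ bits and $O(k\,n^{4k}\log n)$ space in total (number of memory cells times word length in bits). All constants hidden in the $O$-notation are absolute. -/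

import Mathlib

/-! ### Planar st-graphs and st-cutsets -/

/-- A planar embedding of a digraph: distinct points for the vertices and, for every edge, a simple
arc between the points of its end-vertices; the interior of an arc contains no vertex and
meets no other arc. -/
structure PlaneEmbedding {V : Type} (G : Digraph V) where
  pos : V → ℝ × ℝ
  arc : ∀ u v, G.Adj u v → Path (pos u) (pos v)
  pos_injective : Function.Injective pos
  arc_injective : ∀ u v (h : G.Adj u v), Function.Injective (arc u v h)
  arc_avoids_vertex : ∀ u v (h : G.Adj u v) (x : unitInterval) (w : V),
    x ≠ 0 → x ≠ 1 → arc u v h x ≠ pos w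
  arc_avoids_arc : ∀ u v (h : G.Adj u v) u' v' (h' : G.Adj u' v') (x x' : unitInterval),
    (u, v) ≠ (u', v') → x ≠ 0 → x ≠ 1 → arc u v h x ≠ arc u' v' h' x'

namespace PlaneEmbedding

/-- The subset of the plane covered by the vertices and edges. -/
def carrier {V : Type} {G : Digraph V} (φ : PlaneEmbedding G) : Set (ℝ × ℝ) :=
  {z | (∃ v, z = φ.pos v) ∨ ∃ u v, ∃ h : G.Adj u v, z ∈ Set.range (φ.arc u v h)}

/-- The outer face: the unbounded connected component of the complement of the embedding. -/
def outerFace {V : Type} {G : Digraph V} (φ : PlaneEmbedding G) : Set (ℝ × ℝ) :=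
  {z | z ∉ φ.carrier ∧ ¬ Bornology.IsBounded (connectedComponentIn φ.carrierᶜ z)}

end PlaneEmbedding

/-- A planar `st`-graph: an acyclic digraph whose only source is `s` and whose only sink is `t`,
with a planar embedding in which `s` and `t` are on the boundary of the outer face. -/
structure IsPlanarSTGraph {V : Type} (G : Digraph V) (s t : V) : Prop where
  acyclic : ∀ v, ¬ Relation.TransGen G.Adj v v
  source : ∀ v, (∀ u, ¬ G.Adj u v) ↔ v = s
  sink : ∀ v, (∀ u, ¬ G.Adj v u) ↔ v = t
  planar : ∃ φ : PlaneEmbedding G,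
    φ.pos s ∈ frontier φ.outerFace ∧ φ.pos t ∈ frontier φ.outerFace

/-- The underlying undirected graph of `G` after the removal of the edges in `W`. -/
def remainingGraph {V : Type} (G : Digraph V) (W : Finset (V × V)) : SimpleGraph V :=
  SimpleGraph.fromRel fun u v => G.Adj u v ∧ (u, v) ∉ W

/-- `W` is an `st`-cutset: its removal leaves exactly two connected components, one containing `s`
and one containing `t`, and every edge of `W` goes from the former to the latter. -/
structure IsSTCutset {V : Type} (G : Digraph V) (s t : V) (W : Finset (V × V)) : Prop where
  edges : ∀ e ∈ W, G.Adj e.1 e.2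
  separates : ¬ (remainingGraph G W).Reachable s t
  two_components : ∀ v, (remainingGraph G W).Reachable s v ∨ (remainingGraph G W).Reachable t v
  directed : ∀ e ∈ W,
    (remainingGraph G W).Reachable s e.1 ∧ (remainingGraph G W).Reachable t e.2

/-! ### Upward pointset embeddings -/

/-- `Γ` is an upward pointset embedding of `G` on `S`: a straight-line drawing that maps the
vertices to distinct points of `S`, is upward, and is planar. -/
structure IsUPSE {V : Type} (G : Digraph V) (S : Set (ℝ × ℝ)) (Γ : V → ℝ × ℝ) : Prop where
  injective : Function.Injective Γ
  mem : ∀ v, Γ v ∈ S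
  upward : ∀ u v, G.Adj u v → (Γ u).2 < (Γ v).2
  avoids_vertex : ∀ u v, G.Adj u v → ∀ w, Γ w ∉ openSegment ℝ (Γ u) (Γ v)
  noncrossing : ∀ u v u' v', G.Adj u v → G.Adj u' v' → (u, v) ≠ (u', v') →
    Disjoint (openSegment ℝ (Γ u) (Γ v)) (segment ℝ (Γ u') (Γ v'))

/-! ### A real RAM

The memory consists of finitely many arrays (the arrays named in the program) of integer words and
finitely many arrays of reals. Reals can be combined arithmetically and compared, but cannot be
rounded to integers. Every statement and every test takes one unit of time; the expressions of a
fixed program have bounded size. -/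

namespace RealRAM

/-- Word-valued expressions; `get a i` reads entry `i` of the word array `a`. -/
inductive WExpr : Type
  | const (c : ℕ)
  | get (a : ℕ) (i : WExpr)
  | add (e f : WExpr)
  | sub (e f : WExpr)
  | mul (e f : WExpr)
  | div (e f : WExpr)
  | mod (e f : WExpr)

/-- Real-valued expressions; `get a i` reads entry `i` of the real array `a`. -/
inductive RExpr : Type
  | const (c : ℤ)
  | get (a : ℕ) (i : WExpr)
  | add (e f : RExpr)
  | sub (e f : RExpr)
  | mul (e f : RExpr)
  | div (e f : RExpr)

/-- Tests. -/
inductive Cond : Type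
  | wlt (e f : WExpr)
  | weq (e f : WExpr)
  | rlt (e f : RExpr)
  | not (c : Cond)
  | and (c d : Cond)

/-- Programs: assignments to array entries, output of a word, and structured control. -/
inductive Stmt : Type
  | skip
  | wset (a : ℕ) (i e : WExpr)
  | rset (a : ℕ) (i : WExpr) (e : RExpr)
  | write (e : WExpr)
  | seq (p q : Stmt)
  | ite (c : Cond) (p q : Stmt)
  | loop (c : Cond) (p : Stmt)

/-- The contents of the word arrays and of the real arrays, and the words output so far. -/
structure State where
  word : ℕ → ℕ → ℕ
  real : ℕ → ℕ → ℝ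
  out : List ℕ

/-- Value of a word expression (natural numbers with truncated subtraction and division). -/
def WExpr.eval (σ : State) : WExpr → ℕ
  | .const c => c
  | .get a i => σ.word a (i.eval σ)
  | .add e f => e.eval σ + f.eval σ
  | .sub e f => e.eval σ - f.eval σ
  | .mul e f => e.eval σ * f.eval σ
  | .div e f => e.eval σ / f.eval σ
  | .mod e f => e.eval σ % f.eval σ

/-- Value of a real expression (division by zero gives zero). -/
noncomputable def RExpr.eval (σ : State) : RExpr → ℝ
  | .const c => c
  | .get a i => σ.real a (i.eval σ)
  | .add e f => e.eval σ + f.eval σ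
  | .sub e f => e.eval σ - f.eval σ
  | .mul e f => e.eval σ * f.eval σ
  | .div e f => e.eval σ / f.eval σ

/-- Truth of a test. -/
def Cond.Holds (σ : State) : Cond → Prop
  | .wlt e f => e.eval σ < f.eval σ
  | .weq e f => e.eval σ = f.eval σ
  | .rlt e f => e.eval σ < f.eval σ
  | .not c => ¬ c.Holds σ
  | .and c d => c.Holds σ ∧ d.Holds σ

/-- A configuration: the statements still to be executed, in order, and the current state. -/
structure Config where
  todo : List Stmt
  state : State

open Classical in
/-- One step of the machine; a configuration with nothing left to execute has halted. -/
noncomputable def step : Config → Config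
  | ⟨[], σ⟩ => ⟨[], σ⟩
  | ⟨.skip :: K, σ⟩ => ⟨K, σ⟩
  | ⟨.wset a i e :: K, σ⟩ =>
      ⟨K, { σ with
        word := Function.update σ.word a (Function.update (σ.word a) (i.eval σ) (e.eval σ)) }⟩
  | ⟨.rset a i e :: K, σ⟩ =>
      ⟨K, { σ with
        real := Function.update σ.real a (Function.update (σ.real a) (i.eval σ) (e.eval σ)) }⟩
  | ⟨.write e :: K, σ⟩ => ⟨K, { σ with out := σ.out ++ [e.eval σ] }⟩
  | ⟨.seq p q :: K, σ⟩ => ⟨p :: q :: K, σ⟩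
  | ⟨.ite c p q :: K, σ⟩ => if c.Holds σ then ⟨p :: K, σ⟩ else ⟨q :: K, σ⟩
  | ⟨.loop c p :: K, σ⟩ => if c.Holds σ then ⟨p :: .loop c p :: K, σ⟩ else ⟨K, σ⟩

/-- The configuration after `T` steps of the program `P` started in the state `σ`. -/
noncomputable def run (P : Stmt) (σ : State) (T : ℕ) : Config :=
  step^[T] ⟨[P], σ⟩

/-- Only the first `M` entries of `A` word arrays and of `A` real arrays are in use, and every word
has at most `w` bits. -/
def State.Fits (σ : State) (A M w : ℕ) : Prop :=
  (∀ a i, A ≤ a ∨ M ≤ i → σ.word a i = 0 ∧ σ.real a i = 0) ∧ ∀ a i, σ.word a i < 2 ^ w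

/-- Started in `σ`, the program `P` outputs the members of `X` (each a block of words) one after the
other, each exactly once, and halts. The set-up phase ends at time `τ 0`, without any
output; the `j`-th member is complete at time `τ j`. The set-up phase takes at most `setup` steps.
Between the end of the set-up phase and the first member, between two consecutive members, and
between the last one and the end of the computation, at most `delay` steps pass. Throughout the
computation, words have at most `wordLength` bits and the memory in use, counted as
number of cells times word length, is at most `space`. -/
def Enumerates (P : Stmt) (σ : State) (X : Set (List ℕ))
    (setup delay space wordLength : ℝ) : Prop :=
  ∃ (L : List (List ℕ)) (τ : ℕ → ℕ) (T A M w : ℕ),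
    L.Nodup ∧ (∀ x, x ∈ L ↔ x ∈ X) ∧
    (τ 0 : ℝ) ≤ setup ∧
    (∀ j ≤ L.length, (run P σ (τ j)).state.out = (L.take j).flatten) ∧
    (∀ j < L.length, (τ (j + 1) : ℝ) ≤ τ j + delay) ∧
    (T : ℝ) ≤ τ L.length + delay ∧
    (run P σ T).todo = [] ∧ (run P σ T).state.out = L.flatten ∧
    (w : ℝ) ≤ wordLength ∧
    ((2 * A * M * w : ℕ) : ℝ) ≤ space ∧
    ∀ i, (run P σ i).state.Fits A M w

/-- The input: the number of vertices and the number of edges in word array 0, the tails and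
the heads of the edges in word arrays 1 and 2, the coordinates of the points in real arrays 0 and 1;
everything else is zero. -/
def inputState {n : ℕ} (E : List (Fin n × Fin n)) (p : Fin n → ℝ × ℝ) : State where
  word a i := match a with
    | 0 => [n, E.length].getD i 0
    | 1 => (E.map fun e => (e.1 : ℕ)).getD i 0
    | 2 => (E.map fun e => (e.2 : ℕ)).getD i 0
    | _ => 0
  real a i := if h : i < n then
      match a with
      | 0 => (p ⟨i, h⟩).1
      | 1 => (p ⟨i, h⟩).2
      | _ => 0
    else 0
  out := []

/-- The block of words that represents the drawing placing vertex `v` on the point `p (f v)`. -/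
def encode {n : ℕ} (f : Fin n → Fin n) : List ℕ :=
  List.ofFn fun v => (f v : ℕ)

end RealRAM

/-! Sort the points by height, so that they become positions `0, …, n - 1`, and sweep upwards,
placing one vertex per position. A state of the sweep records only the edges that cross the sweep
line, each with the position of its tail and the position promised to its head. The placed vertices
are closed under predecessors, so the crossing edges leave a closed set; they form an `st`-cutset or
are absent (`card_leaving_le`), hence there are at most `k`. The vertex placed last has a crossing
edge unless it is `t`, so the state determines the next position (`Inv.pos_eq`), and through the
promises also the next vertex (`Adm.unique`). What remains free is the head positions of its
outgoing edges. Of two edges with overlapping height ranges, the one that starts later meets the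
other in the current state, and their compatibility is tested there. As abscissae on a line are
affine in the height, it suffices to compare the edges at both ends of the common range
(`Compatible.disjoint`, `compatible_of_disjoint`). Thus sweeps of full length are exactly the
drawings (`Reach.drawing`, `Drawing.reach`).

The set-up phase explores the graph of reachable states and stores with every state the list of
steps into it. The enumeration walks back from the final state. Every recorded predecessor is itself
reachable from the start, so the walk never meets a dead end (`outs_ne_nil`), and a depth-first
search with one list of pending alternatives per position spends `O(n)` time per output. The order
of placement determines the whole path (`Trans.unique`), so nothing is output twice. The first and
the last state are both empty; the number of steps tells them apart.

For the time, let `B = m n² + 1`. A state has at most `k` nonzero entries and is coded by a numeral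
with at most `k` digits in base `B`. When `v` is about to be placed, the promises of its incoming
edges all equal the next position, which the tail positions determine. Such an edge therefore
contributes a factor `n` instead of `B`, and an outgoing edge contributes a factor `n` for its
choice. This leaves at most `n³ B^(k-1)` pairs of a state and a choice (`sum_trials_le`), each
costing `O(m k) = O(n k²)`. Since `2 B ≤ n⁴`, a factor `2^(k-1) ≥ k` is gained, and the total is
`O(k n^(4k))` (`setupTime_le`). -/

namespace RealRAM

/-! ### A weakest-precondition calculus with time bounds -/

/-- The state after writing `v` to entry `i` of word array `a`. -/
def State.setW (σ : State) (a i v : ℕ) : State :=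
  { σ with word := Function.update σ.word a (Function.update (σ.word a) i v) }

/-- The state after writing `v` to entry `i` of real array `a`. -/
noncomputable def State.setR (σ : State) (a i : ℕ) (v : ℝ) : State :=
  { σ with real := Function.update σ.real a (Function.update (σ.real a) i v) }

/-- The state after the output of `v`. -/
def State.emit (σ : State) (v : ℕ) : State := { σ with out := σ.out ++ [v] }

@[simp] theorem State.setW_word (σ : State) (a i v a' : ℕ) :
    (σ.setW a i v).word a' = if a' = a then Function.update (σ.word a) i v else σ.word a' := by
  simp [State.setW, Function.update_apply]

@[simp] theorem State.setW_real (σ : State) (a i v : ℕ) : (σ.setW a i v).real = σ.real := rfl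
@[simp] theorem State.setW_out (σ : State) (a i v : ℕ) : (σ.setW a i v).out = σ.out := rfl

@[simp] theorem State.setR_real (σ : State) (a i : ℕ) (v : ℝ) (a' : ℕ) :
    (σ.setR a i v).real a' = if a' = a then Function.update (σ.real a) i v else σ.real a' := by
  simp [State.setR, Function.update_apply]

@[simp] theorem State.setR_word (σ : State) (a i : ℕ) (v : ℝ) : (σ.setR a i v).word = σ.word := rfl
@[simp] theorem State.setR_out (σ : State) (a i : ℕ) (v : ℝ) : (σ.setR a i v).out = σ.out := rfl
@[simp] theorem State.emit_word (σ : State) (v : ℕ) : (σ.emit v).word = σ.word := rfl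
@[simp] theorem State.emit_real (σ : State) (v : ℕ) : (σ.emit v).real = σ.real := rfl
@[simp] theorem State.emit_out (σ : State) (v : ℕ) : (σ.emit v).out = σ.out ++ [v] := rfl

/-- The number of arrays of each sort available to programs. -/
abbrev arrays : ℕ := 40

/-- The state uses only the first `M` entries of the first `arrays` arrays, with words below `U`. -/
def State.Fit (σ : State) (M U : ℕ) : Prop :=
  (∀ a i, arrays ≤ a ∨ M ≤ i → σ.word a i = 0 ∧ σ.real a i = 0) ∧ ∀ a i, σ.word a i < U

theorem State.Fit.setW {σ : State} {M U : ℕ} (h : σ.Fit M U) {a i v : ℕ} (ha : a < arrays)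
    (hi : i < M) (hv : v < U) : (σ.setW a i v).Fit M U := by
  refine ⟨fun b j hbj => ?_, fun b j => ?_⟩
  · refine ⟨?_, (h.1 b j hbj).2⟩
    rw [State.setW_word]
    split_ifs with hb
    · rw [Function.update_of_ne (by omega)]
      exact (h.1 a j (by omega)).1
    · exact (h.1 b j hbj).1
  · rw [State.setW_word]
    split_ifs with hb
    · rw [Function.update_apply]
      split_ifs
      · exact hv
      · exact h.2 a j
    · exact h.2 b j

theorem State.Fit.setR {σ : State} {M U : ℕ} (h : σ.Fit M U) {a i : ℕ} {v : ℝ} (ha : a < arrays)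
    (hi : i < M) : (σ.setR a i v).Fit M U := by
  refine ⟨fun b j hbj => ⟨(h.1 b j hbj).1, ?_⟩, h.2⟩
  rw [State.setR_real]
  split_ifs with hb
  · rw [Function.update_of_ne (by omega)]
    exact (h.1 a j (by omega)).2
  · exact (h.1 b j hbj).2

/-- The word arrays to which a program may write. -/
def Stmt.wordTargets : Stmt → List ℕ
  | .skip => []
  | .wset a _ _ => [a]
  | .rset _ _ _ => []
  | .write _ => []
  | .seq p q => p.wordTargets ++ q.wordTargets
  | .ite _ p q => p.wordTargets ++ q.wordTargets
  | .loop _ p => p.wordTargets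

/-- The real arrays to which a program may write. -/
def Stmt.realTargets : Stmt → List ℕ
  | .skip => []
  | .wset _ _ _ => []
  | .rset a _ _ => [a]
  | .write _ => []
  | .seq p q => p.realTargets ++ q.realTargets
  | .ite _ p q => p.realTargets ++ q.realTargets
  | .loop _ p => p.realTargets

/-- The program contains no output statement. -/
def Stmt.quiet : Stmt → Bool
  | .write _ => false
  | .seq p q => p.quiet && q.quiet
  | .ite _ p q => p.quiet && q.quiet
  | .loop _ p => p.quiet
  | _ => true

/-- `σ'` differs from `σ` only where `p` may write. -/
structure Frame (p : Stmt) (σ σ' : State) : Prop where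
  word : ∀ a, a ∉ p.wordTargets → σ'.word a = σ.word a
  real : ∀ a, a ∉ p.realTargets → σ'.real a = σ.real a
  out : p.quiet = true → σ'.out = σ.out

theorem Frame.refl (p : Stmt) (σ : State) : Frame p σ σ := ⟨fun _ _ => rfl, fun _ _ => rfl, fun _ => rfl⟩

theorem Frame.trans {p : Stmt} {σ σ' σ'' : State} (h : Frame p σ σ') (h' : Frame p σ' σ'') :
    Frame p σ σ'' :=
  ⟨fun a ha => (h'.word a ha).trans (h.word a ha), fun a ha => (h'.real a ha).trans (h.real a ha),
    fun ha => (h'.out ha).trans (h.out ha)⟩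

/-- From `σ`, the program `p` terminates within `t` steps in a state satisfying `Q`, staying within
the memory bounds and writing only to its targets. -/
def WP (M U : ℕ) (p : Stmt) (t : ℕ) (Q : State → Prop) (σ : State) : Prop :=
  σ.Fit M U → ∃ σ' t', t' ≤ t ∧ σ'.Fit M U ∧ Q σ' ∧ Frame p σ σ' ∧
    ∀ K, step^[t'] ⟨p :: K, σ⟩ = ⟨K, σ'⟩ ∧ ∀ i ≤ t', (step^[i] ⟨p :: K, σ⟩).state.Fit M U

section
variable {M U : ℕ} {p q : Stmt} {t : ℕ} {Q : State → Prop} {σ : State}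

theorem WP.mono {t' : ℕ} {Q' : State → Prop} (h : WP M U p t Q σ) (ht : t ≤ t')
    (hQ : ∀ σ', Frame p σ σ' → Q σ' → Q' σ') : WP M U p t' Q' σ := by
  intro hf
  obtain ⟨σ', s, h1, h2, h3, h4, h5⟩ := h hf
  exact ⟨σ', s, h1.trans ht, h2, hQ _ h4 h3, h4, h5⟩

theorem wp_skip (ht : 1 ≤ t) (h : Q σ) : WP M U .skip t Q σ := by
  intro hf
  refine ⟨σ, 1, ht, hf, h, Frame.refl _ _, fun K => ⟨rfl, fun i hi => ?_⟩⟩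
  interval_cases i <;> exact hf

theorem wp_wset {a : ℕ} {i e : WExpr} (ht : 1 ≤ t) (ha : a < arrays) (hi : i.eval σ < M)
    (he : e.eval σ < U) (h : Q (σ.setW a (i.eval σ) (e.eval σ))) : WP M U (.wset a i e) t Q σ := by
  intro hf
  refine ⟨_, 1, ht, hf.setW ha hi he, h, ⟨fun b hb => ?_, fun _ _ => rfl, fun _ => rfl⟩,
    fun K => ⟨rfl, fun j hj => ?_⟩⟩
  · simp only [Stmt.wordTargets, List.mem_singleton] at hb
    simp [hb]
  · interval_cases j
    · exact hf
    · exact hf.setW ha hi he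

theorem wp_rset {a : ℕ} {i : WExpr} {e : RExpr} (ht : 1 ≤ t) (ha : a < arrays) (hi : i.eval σ < M)
    (h : Q (σ.setR a (i.eval σ) (e.eval σ))) : WP M U (.rset a i e) t Q σ := by
  intro hf
  refine ⟨_, 1, ht, hf.setR ha hi, h, ⟨fun _ _ => rfl, fun b hb => ?_, fun _ => rfl⟩,
    fun K => ⟨rfl, fun j hj => ?_⟩⟩
  · simp only [Stmt.realTargets, List.mem_singleton] at hb
    simp [hb]
  · interval_cases j
    · exact hf
    · exact hf.setR ha hi

theorem wp_write {e : WExpr} (ht : 1 ≤ t) (h : Q (σ.emit (e.eval σ))) :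
    WP M U (.write e) t Q σ := by
  intro hf
  have h1 : (σ.emit (e.eval σ)).Fit M U := hf
  refine ⟨_, 1, ht, h1, h, ⟨fun _ _ => rfl, fun _ _ => rfl, fun h => ?_⟩,
    fun K => ⟨rfl, fun j hj => ?_⟩⟩
  · simp [Stmt.quiet] at h
  · interval_cases j
    · exact hf
    · exact h1

/-- `WP` quantifies over the remaining statements, so a run of `p` before `q :: K` and a run of `q`
before `K` can be joined. The extra unit of time pays for unfolding the composition. -/
theorem wp_seq (t₁ : ℕ) (ht : t₁ + 1 ≤ t)
    (h : WP M U p t₁ (fun σ' => WP M U q (t - t₁ - 1) Q σ') σ) : WP M U (.seq p q) t Q σ := by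
  intro hf
  obtain ⟨σ₁, s₁, h1, h2, h3, h4, h5⟩ := h hf
  obtain ⟨σ₂, s₂, g1, g2, g3, g4, g5⟩ := h3 h2
  refine ⟨σ₂, s₂ + (s₁ + 1), by omega, g2, g3, ⟨fun a ha => ?_, fun a ha => ?_, fun ha => ?_⟩,
    fun K => ⟨?_, fun i hi => ?_⟩⟩
  · simp only [Stmt.wordTargets, List.mem_append, not_or] at ha
    rw [g4.word a ha.2, h4.word a ha.1]
  · simp only [Stmt.realTargets, List.mem_append, not_or] at ha
    rw [g4.real a ha.2, h4.real a ha.1]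
  · simp only [Stmt.quiet, Bool.and_eq_true] at ha
    rw [g4.out ha.2, h4.out ha.1]
  · rw [Function.iterate_add_apply, Function.iterate_succ_apply]
    change step^[s₂] (step^[s₁] ⟨p :: q :: K, σ⟩) = _
    rw [(h5 _).1, (g5 _).1]
  · rcases Nat.eq_zero_or_pos i with rfl | hpos
    · exact hf
    obtain ⟨i, rfl⟩ : ∃ j, i = j + 1 := ⟨i - 1, by omega⟩
    rw [Function.iterate_succ_apply]
    change (step^[i] ⟨p :: q :: K, σ⟩).state.Fit M U
    rcases le_or_gt i s₁ with hle | hgt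
    · exact (h5 _).2 i hle
    · obtain ⟨j, rfl⟩ : ∃ j, i = j + s₁ := ⟨i - s₁, by omega⟩
      rw [Function.iterate_add_apply, (h5 _).1]
      exact (g5 _).2 j (by omega)

theorem wp_ite {c : Cond} (ht : 1 ≤ t) (h₁ : c.Holds σ → WP M U p (t - 1) Q σ)
    (h₂ : ¬ c.Holds σ → WP M U q (t - 1) Q σ) : WP M U (.ite c p q) t Q σ := by
  intro hf
  by_cases hc : c.Holds σ
  · obtain ⟨σ₁, s₁, h1, h2, h3, h4, h5⟩ := h₁ hc hf
    have hs : ∀ K, step ⟨.ite c p q :: K, σ⟩ = ⟨p :: K, σ⟩ := fun K => by simp [step, hc]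
    refine ⟨σ₁, s₁ + 1, by omega, h2, h3, ⟨fun a ha => ?_, fun a ha => ?_, fun ha => ?_⟩,
      fun K => ⟨?_, fun i hi => ?_⟩⟩
    · simp only [Stmt.wordTargets, List.mem_append, not_or] at ha
      exact h4.word a ha.1
    · simp only [Stmt.realTargets, List.mem_append, not_or] at ha
      exact h4.real a ha.1
    · simp only [Stmt.quiet, Bool.and_eq_true] at ha
      exact h4.out ha.1
    · rw [Function.iterate_succ_apply, hs, (h5 _).1]
    · cases i with
      | zero => exact hf
      | succ i => rw [Function.iterate_succ_apply, hs]; exact (h5 _).2 i (by omega)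
  · obtain ⟨σ₁, s₁, h1, h2, h3, h4, h5⟩ := h₂ hc hf
    have hs : ∀ K, step ⟨.ite c p q :: K, σ⟩ = ⟨q :: K, σ⟩ := fun K => by simp [step, hc]
    refine ⟨σ₁, s₁ + 1, by omega, h2, h3, ⟨fun a ha => ?_, fun a ha => ?_, fun ha => ?_⟩,
      fun K => ⟨?_, fun i hi => ?_⟩⟩
    · simp only [Stmt.wordTargets, List.mem_append, not_or] at ha
      exact h4.word a ha.2
    · simp only [Stmt.realTargets, List.mem_append, not_or] at ha
      exact h4.real a ha.2
    · simp only [Stmt.quiet, Bool.and_eq_true] at ha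
      exact h4.out ha.2
    · rw [Function.iterate_succ_apply, hs, (h5 _).1]
    · cases i with
      | zero => exact hf
      | succ i => rw [Function.iterate_succ_apply, hs]; exact (h5 _).2 i (by omega)

theorem step_loop_true {c : Cond} (hc : c.Holds σ) (K : List Stmt) :
    step ⟨.loop c p :: K, σ⟩ = ⟨p :: .loop c p :: K, σ⟩ := by simp [step, hc]

theorem step_loop_false {c : Cond} (hc : ¬ c.Holds σ) (K : List Stmt) :
    step ⟨.loop c p :: K, σ⟩ = ⟨K, σ⟩ := by simp [step, hc]

/-- The invariant `I` of a loop carries an upper bound for the time still to be spent. -/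
theorem wp_loop {c : Cond} (I : ℕ → State → Prop) (φ : ℕ) (ht : φ + 1 ≤ t) (h0 : I φ σ)
    (hstep : ∀ φ σ', Frame p σ σ' → I φ σ' → c.Holds σ' →
      ∃ tb, WP M U p tb (fun σ'' => ∃ φ', φ' + tb + 1 ≤ φ ∧ I φ' σ'') σ')
    (hend : ∀ φ σ', Frame p σ σ' → I φ σ' → ¬ c.Holds σ' → Q σ') :
    WP M U (.loop c p) t Q σ := by
  -- Strong induction on the time budget `φ`, which every iteration lowers; this is also the proof
  -- of termination.
  have key : ∀ φ σ', Frame p σ σ' → I φ σ' → WP M U (.loop c p) (φ + 1) Q σ' := by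
    intro φ
    induction φ using Nat.strong_induction_on with
    | _ φ ih =>
      intro σ' hfr hI hf
      by_cases hc : c.Holds σ'
      · obtain ⟨tb, hb⟩ := hstep φ σ' hfr hI hc
        obtain ⟨σ₁, s₁, h1, h2, ⟨φ', hφ, hI'⟩, h4, h5⟩ := hb hf
        obtain ⟨σ₂, s₂, g1, g2, g3, g4, g5⟩ := ih φ' (by omega) σ₁ (hfr.trans h4) hI' h2
        have hs := step_loop_true (p := p) hc
        have h4' : Frame (.loop c p) σ' σ₁ := ⟨h4.word, h4.real, h4.out⟩
        refine ⟨σ₂, s₂ + (s₁ + 1), by omega, g2, g3, h4'.trans g4, fun K => ⟨?_, fun i hi => ?_⟩⟩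
        · rw [Function.iterate_add_apply, Function.iterate_succ_apply, hs, (h5 _).1, (g5 _).1]
        · cases i with
          | zero => exact hf
          | succ i =>
            rw [Function.iterate_succ_apply, hs]
            rcases le_or_gt i s₁ with hle | hgt
            · exact (h5 _).2 i hle
            · obtain ⟨j, rfl⟩ : ∃ j, i = j + s₁ := ⟨i - s₁, by omega⟩
              rw [Function.iterate_add_apply, (h5 _).1]
              exact (g5 _).2 j (by omega)
      · have hs := step_loop_false (p := p) hc
        refine ⟨σ', 1, by omega, hf, hend φ σ' hfr hI hc, Frame.refl _ _,
          fun K => ⟨hs K, fun i hi => ?_⟩⟩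
        interval_cases i
        · exact hf
        · simp only [Function.iterate_one, hs]; exact hf
  exact (key φ σ (Frame.refl _ _) h0).mono ht fun _ _ h => h

/-- The scalar variable stored in entry `0` of word array `a`. -/
abbrev WExpr.var (a : ℕ) : WExpr := .get a (.const 0)

/-- Assignment to a scalar variable. -/
abbrev Stmt.setVar (a : ℕ) (e : WExpr) : Stmt := .wset a (.const 0) e

/-- `for i < N do p` -/
abbrev Stmt.forLoop (i : ℕ) (N : WExpr) (p : Stmt) : Stmt :=
  .seq (.setVar i (.const 0))
    (.loop (.wlt (.var i) N) (.seq p (.setVar i (.add (.var i) (.const 1)))))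

/-- Per iteration, the three extra units are the loop test, the unfolding of the body and the
increment; the final three are the unfolding, the initialisation and the last test. The invariant is
demanded after the increment. The frames passed to the hypotheses carry all variables that the loop
does not write. -/
theorem wp_for {i : ℕ} {N : WExpr} (I : ℕ → State → Prop) (T : ℕ → ℕ) (cnt : ℕ)
    (ht : ∑ j ∈ Finset.range cnt, (T j + 3) + 3 ≤ t) (hi : i < arrays) (hM : 0 < M) (hU : cnt < U)
    (hip : i ∉ p.wordTargets)
    (hN : ∀ σ', Frame (.forLoop i N p) σ σ' → N.eval σ' = cnt)
    (h0 : I 0 (σ.setW i 0 0))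
    (hstep : ∀ j < cnt, ∀ σ', Frame (.forLoop i N p) σ σ' → σ'.word i 0 = j → I j σ' →
      WP M U p (T j) (fun σ'' => I (j + 1) (σ''.setW i 0 (j + 1))) σ')
    (hend : ∀ σ', Frame (.forLoop i N p) σ σ' → I cnt σ' → Q σ') :
    WP M U (.forLoop i N p) t Q σ := by
  have hfr0 : Frame (.forLoop i N p) σ (σ.setW i 0 0) := by
    refine ⟨fun a ha => ?_, fun _ _ => rfl, fun _ => rfl⟩
    simp only [Stmt.wordTargets, List.mem_append, List.mem_singleton, not_or] at ha
    simp [ha.1]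
  have hloop : ∀ σ', Frame (.seq p (.setVar i (.add (.var i) (.const 1)))) (σ.setW i 0 0) σ' →
      Frame (.forLoop i N p) σ σ' := by
    intro σ' h
    refine hfr0.trans ⟨fun a ha => h.word a ?_, fun a ha => h.real a ?_, fun ha => h.out ?_⟩
    · simp only [Stmt.wordTargets, List.mem_append, List.mem_singleton, not_or] at ha ⊢
      exact ha.2
    · simp only [Stmt.realTargets, List.mem_append, not_or] at ha ⊢
      exact ha.2
    · simp only [Stmt.quiet, Bool.and_eq_true] at ha ⊢
      exact ha.2
  refine wp_seq 1 (by omega) (wp_wset le_rfl hi hM (by simp only [WExpr.eval]; omega) ?_)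
  simp only [WExpr.eval]
  refine wp_loop (fun φ σ' => ∃ j ≤ cnt, φ = ∑ l ∈ Finset.Ico j cnt, (T l + 3) ∧
      σ'.word i 0 = j ∧ I j σ') (∑ j ∈ Finset.range cnt, (T j + 3)) (by omega)
    ⟨0, by omega, by rw [Finset.range_eq_Ico], by simp, h0⟩ ?_ ?_
  · rintro φ σ' hfr ⟨j, hj, rfl, hij, hI⟩ hc
    simp only [Cond.Holds, WExpr.eval, hN σ' (hloop σ' hfr), hij] at hc
    have hw := hstep j hc σ' (hloop σ' hfr) hij hI
    refine ⟨T j + 2, wp_seq (T j) (by omega) (hw.mono le_rfl fun σ'' hfr' hI' => ?_)⟩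
    have hij' : σ''.word i 0 = j := by rw [hfr'.word i hip, hij]
    refine wp_wset (by omega) hi hM ?_ ⟨∑ l ∈ Finset.Ico (j + 1) cnt, (T l + 3), ?_, j + 1, hc, rfl, ?_, ?_⟩
    · simp only [WExpr.eval, hij']; omega
    · rw [Finset.sum_eq_sum_Ico_succ_bot hc]; omega
    · simp [WExpr.eval, hij']
    · simpa only [WExpr.eval, hij'] using hI'
  · rintro φ σ' hfr ⟨j, hj, rfl, hij, hI⟩ hc
    simp only [Cond.Holds, WExpr.eval, hN σ' (hloop σ' hfr), hij] at hc
    obtain rfl : j = cnt := by omega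
    exact hend σ' (hloop σ' hfr) hI

/-- A program that sets up and then outputs one word block per iteration of a final loop. -/
theorem enumerates_of_loop {w A' : ℕ} {setup body : Stmt} {c : Cond} {X : Set (List ℕ)}
    {L : List (List ℕ)} {ts tb : ℕ} {S D Sp Wl : ℝ}
    (I : List (List ℕ) → State → Prop) (hL : L.Nodup) (hX : ∀ x, x ∈ L ↔ x ∈ X)
    (hfit : σ.Fit M (2 ^ w)) (hout : σ.out = [])
    (hquiet : setup.quiet = true)
    (hsetup : WP M (2 ^ w) setup ts (I L) σ)
    (hnil : ∀ σ', I [] σ' → ¬ c.Holds σ')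
    (hcons : ∀ x l σ', I (x :: l) σ' → c.Holds σ' ∧
      WP M (2 ^ w) body tb (fun σ'' => σ''.out = σ'.out ++ x ∧ I l σ'') σ')
    (hS : (ts + 1 : ℝ) ≤ S) (hD : (tb + 1 : ℝ) ≤ D) (hA : A' = arrays)
    (hSp : ((2 * A' * M * w : ℕ) : ℝ) ≤ Sp) (hW : (w : ℝ) ≤ Wl) :
    Enumerates (.seq setup (.loop c body)) σ X S D Sp Wl := by
  subst hA
  obtain ⟨σ₀, s₀, h1, h2, h3, h4, h5⟩ := hsetup hfit
  have key : ∀ (l : List (List ℕ)) (σ' : State), σ'.Fit M (2 ^ w) → I l σ' →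
      ∃ (τ : ℕ → ℕ) (T : ℕ), τ 0 = 0 ∧
        (∀ j ≤ l.length, (step^[τ j] ⟨[.loop c body], σ'⟩).state.out = σ'.out ++ (l.take j).flatten) ∧
        (∀ j < l.length, τ (j + 1) ≤ τ j + (tb + 1)) ∧ T ≤ τ l.length + 1 ∧
        (step^[T] ⟨[.loop c body], σ'⟩).todo = [] ∧
        (step^[T] ⟨[.loop c body], σ'⟩).state.out = σ'.out ++ l.flatten ∧
        ∀ i ≤ T, (step^[i] ⟨[.loop c body], σ'⟩).state.Fit M (2 ^ w) := by
    intro l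
    induction l with
    | nil =>
      intro σ' hf hI
      have hs := step_loop_false (p := body) (hnil σ' hI)
      refine ⟨fun _ => 0, 1, rfl, ?_, by simp, by simp, ?_, ?_, ?_⟩
      · intro j hj; simp
      · simp [hs]
      · simp [hs]
      · intro i hi
        interval_cases i
        · exact hf
        · simp only [Function.iterate_one, hs]; exact hf
    | cons x l ih =>
      intro σ' hf hI
      obtain ⟨hc, hb⟩ := hcons x l σ' hI
      obtain ⟨σ₁, s₁, g1, g2, ⟨g3, g3'⟩, g4, g5⟩ := hb hf
      obtain ⟨τ, T, e1, e2, e3, e4, e5, e6, e7⟩ := ih σ₁ g2 g3'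
      have hs := step_loop_true (p := body) hc
      have hrun : ∀ i, step^[i + (s₁ + 1)] ⟨[.loop c body], σ'⟩ = step^[i] ⟨[.loop c body], σ₁⟩ := by
        intro i
        rw [Function.iterate_add_apply, Function.iterate_succ_apply, hs, (g5 _).1]
      -- The first block is complete after the loop test and the `s₁` steps of the body; all later
      -- times are shifted by this amount.
      refine ⟨fun j => if j = 0 then 0 else τ (j - 1) + (s₁ + 1), T + (s₁ + 1), by simp, ?_, ?_, ?_,
        ?_, ?_, ?_⟩
      · intro j hj
        rcases Nat.eq_zero_or_pos j with rfl | hpos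
        · simp
        · obtain ⟨j, rfl⟩ : ∃ i, j = i + 1 := ⟨j - 1, by omega⟩
          simp only [Nat.add_eq_zero_iff, one_ne_zero, and_false, if_false, Nat.add_sub_cancel, hrun]
          rw [e2 j (by simpa using hj), g3]
          simp
      · intro j hj
        rcases Nat.eq_zero_or_pos j with rfl | hpos
        · simp [e1]; omega
        · obtain ⟨j, rfl⟩ : ∃ i, j = i + 1 := ⟨j - 1, by omega⟩
          have := e3 j (by simpa using hj)
          simp; omega
      · simp; omega
      · rw [hrun]; exact e5
      · rw [hrun, e6, g3]; simp
      · intro i hi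
        cases i with
        | zero => exact hf
        | succ i =>
          rw [Function.iterate_succ_apply, hs]
          rcases le_or_gt i s₁ with hle | hgt
          · exact (g5 _).2 i hle
          · obtain ⟨j, rfl⟩ : ∃ j, i = j + s₁ := ⟨i - s₁, by omega⟩
            rw [Function.iterate_add_apply, (g5 _).1]
            exact e7 j (by omega)
  obtain ⟨τ, T, e1, e2, e3, e4, e5, e6, e7⟩ := key L σ₀ h2 h3
  have ho : σ₀.out = [] := by rw [h4.out hquiet, hout]
  have hrun : ∀ i, run (.seq setup (.loop c body)) σ (i + (s₀ + 1)) =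
      step^[i] ⟨[.loop c body], σ₀⟩ := by
    intro i
    rw [run, Function.iterate_add_apply, Function.iterate_succ_apply]
    change step^[i] (step^[s₀] ⟨setup :: [.loop c body], σ⟩) = _
    rw [(h5 _).1]
  refine ⟨L, fun j => τ j + (s₀ + 1), T + (s₀ + 1), arrays, M, w, hL, hX, ?_, ?_, ?_, ?_, ?_, ?_,
    hW, hSp, ?_⟩
  · simp only [e1]
    push_cast
    have : (s₀ : ℝ) ≤ ts := by exact_mod_cast h1
    linarith
  · intro j hj
    simp only [hrun]
    rw [e2 j hj, ho, List.nil_append]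
  · intro j hj
    have := e3 j hj
    have h' : ((τ (j + 1) : ℕ) : ℝ) ≤ τ j + (tb + 1) := by exact_mod_cast this
    push_cast
    linarith
  · have h' : ((T : ℕ) : ℝ) ≤ τ L.length + 1 := by exact_mod_cast e4
    have : (0 : ℝ) ≤ tb := by positivity
    push_cast
    linarith
  · rw [hrun]; exact e5
  · rw [hrun, e6, ho, List.nil_append]
  · have hall : ∀ i ≤ T + (s₀ + 1), (run (.seq setup (.loop c body)) σ i).state.Fit M (2 ^ w) := by
      intro i hi
      cases i with
      | zero => exact hfit
      | succ i =>
        rcases le_or_gt i s₀ with hle | hgt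
        · rw [run, Function.iterate_succ_apply]
          exact (h5 [.loop c body]).2 i hle
        · obtain ⟨j, rfl⟩ : ∃ j, i = j + s₀ := ⟨i - s₀, by omega⟩
          rw [show j + s₀ + 1 = j + (s₀ + 1) by ring, hrun]
          exact e7 j (by omega)
    -- The memory bound is claimed for all times, and a halted configuration is a fixed point of
    -- `step`.
    have hhalt : ∀ i, run (.seq setup (.loop c body)) σ (i + (T + (s₀ + 1))) =
        run (.seq setup (.loop c body)) σ (T + (s₀ + 1)) := by
      intro i
      induction i with
      | zero => simp
      | succ i ih =>
        rw [show i + 1 + (T + (s₀ + 1)) = (i + (T + (s₀ + 1))) + 1 by ring, run,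
          Function.iterate_succ_apply', ← run, ih]
        generalize hcfg : run (.seq setup (.loop c body)) σ (T + (s₀ + 1)) = cfg
        have htodo : cfg.todo = [] := by rw [← hcfg, hrun]; exact e5
        obtain ⟨K, st⟩ := cfg
        simp only at htodo
        subst htodo
        rfl
    intro i
    rcases le_or_gt i (T + (s₀ + 1)) with hle | hgt
    · exact hall i hle
    · obtain ⟨j, rfl⟩ : ∃ j, i = j + (T + (s₀ + 1)) := ⟨i - (T + (s₀ + 1)), by omega⟩
      rw [hhalt]
      exact hall _ le_rfl

end
end RealRAM

/-! ### Crossings of segments between points sorted by height -/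

namespace Upward

/-- The abscissa at which the line through the points `a` and `b` has height `y`. -/
noncomputable def lineAt (X Y : ℕ → ℝ) (a b : ℕ) (y : ℝ) : ℝ :=
  X a + (y - Y a) * (X b - X a) / (Y b - Y a)

/-- The segment from `a` to `b` is left of the segment from `a'` to `b'`, up to common ends. -/
def LeftOf (X Y : ℕ → ℝ) (a b a' b' : ℕ) : Prop :=
  (lineAt X Y a b (Y (max a a')) < lineAt X Y a' b' (Y (max a a')) ∨ a = a') ∧
  (lineAt X Y a b (Y (min b b')) < lineAt X Y a' b' (Y (min b b')) ∨ b = b') ∧ ¬ (a = a' ∧ b = b')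

/-- The segments `ab` and `a'b'` do not cross. -/
def Compatible (X Y : ℕ → ℝ) (a b a' b' : ℕ) : Prop :=
  LeftOf X Y a b a' b' ∨ LeftOf X Y a' b' a b

theorem Compatible.symm {X Y : ℕ → ℝ} {a b a' b' : ℕ} (h : Compatible X Y a b a' b') :
    Compatible X Y a' b' a b := Or.symm h

theorem mem_segment_iff {X Y : ℕ → ℝ} {a b : ℕ} (h : Y a < Y b) (z : ℝ × ℝ) :
    z ∈ segment ℝ (X a, Y a) (X b, Y b) ↔ Y a ≤ z.2 ∧ z.2 ≤ Y b ∧ z.1 = lineAt X Y a b z.2 := by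
  have hd : Y b - Y a ≠ 0 := by linarith
  have hd' : 0 < Y b - Y a := by linarith
  rw [segment_eq_image']
  simp only [Set.mem_image, Set.mem_Icc, lineAt]
  constructor
  · rintro ⟨θ, ⟨h0, h1⟩, rfl⟩
    simp only [Prod.mk_sub_mk, Prod.smul_mk, smul_eq_mul, Prod.mk_add_mk]
    refine ⟨by nlinarith, by nlinarith, ?_⟩
    field_simp
    ring
  · rintro ⟨h0, h1, h2⟩
    refine ⟨(z.2 - Y a) / (Y b - Y a), ⟨div_nonneg (by linarith) hd'.le, ?_⟩, ?_⟩
    · rw [div_le_one hd']; linarith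
    · ext
      · simp only [Prod.mk_sub_mk, Prod.smul_mk, smul_eq_mul, Prod.mk_add_mk, h2]
        ring
      · simp only [Prod.mk_sub_mk, Prod.smul_mk, smul_eq_mul, Prod.mk_add_mk]
        field_simp
        ring

theorem mem_openSegment_iff {X Y : ℕ → ℝ} {a b : ℕ} (h : Y a < Y b) (z : ℝ × ℝ) :
    z ∈ openSegment ℝ (X a, Y a) (X b, Y b) ↔
      Y a < z.2 ∧ z.2 < Y b ∧ z.1 = lineAt X Y a b z.2 := by
  have hd : Y b - Y a ≠ 0 := by linarith
  have hd' : 0 < Y b - Y a := by linarith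
  rw [openSegment_eq_image']
  simp only [Set.mem_image, Set.mem_Ioo, lineAt]
  constructor
  · rintro ⟨θ, ⟨h0, h1⟩, rfl⟩
    simp only [Prod.mk_sub_mk, Prod.smul_mk, smul_eq_mul, Prod.mk_add_mk]
    refine ⟨by nlinarith, by nlinarith, ?_⟩
    field_simp
    ring
  · rintro ⟨h0, h1, h2⟩
    refine ⟨(z.2 - Y a) / (Y b - Y a), ⟨div_pos (by linarith) hd', ?_⟩, ?_⟩
    · rw [div_lt_one hd']; linarith
    · ext
      · simp only [Prod.mk_sub_mk, Prod.smul_mk, smul_eq_mul, Prod.mk_add_mk, h2]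
        ring
      · simp only [Prod.mk_sub_mk, Prod.smul_mk, smul_eq_mul, Prod.mk_add_mk]
        field_simp
        ring

theorem lineAt_left {X Y : ℕ → ℝ} {a b : ℕ} : lineAt X Y a b (Y a) = X a := by
  simp [lineAt]

theorem lineAt_right {X Y : ℕ → ℝ} {a b : ℕ} (h : Y a < Y b) : lineAt X Y a b (Y b) = X b := by
  have hd : Y b - Y a ≠ 0 := by linarith
  rw [lineAt, mul_div_right_comm, div_self hd]
  ring

/-- Abscissae on a line are affine in the height. -/
theorem lineAt_affine (X Y : ℕ → ℝ) (a b : ℕ) (y l h : ℝ) :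
    (h - l) * lineAt X Y a b y = (h - y) * lineAt X Y a b l + (y - l) * lineAt X Y a b h := by
  simp only [lineAt]
  ring

/-- The difference of the abscissae is affine in the height, has the same weak sign at both ends of
the common height range, and is not zero at both. So it vanishes at most at one end, and only where
the segments share an endpoint. -/
theorem LeftOf.disjoint {X Y : ℕ → ℝ} {n a b a' b' : ℕ}
    (hY : ∀ i j, i < j → j < n → Y i < Y j) (hab : a < b) (hb : b < n) (hab' : a' < b')
    (hb' : b' < n) (hov : max a a' < min b b') (hl : LeftOf X Y a b a' b')
    (z : ℝ × ℝ) (h1 : z ∈ segment ℝ (X a, Y a) (X b, Y b))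
    (h2 : z ∈ segment ℝ (X a', Y a') (X b', Y b')) :
    (z.2 = Y a ∧ z.2 = Y a') ∨ (z.2 = Y b ∧ z.2 = Y b') := by
  rw [mem_segment_iff (hY _ _ hab hb)] at h1
  rw [mem_segment_iff (hY _ _ hab' hb')] at h2
  obtain ⟨p1, p2, p3⟩ := h1
  obtain ⟨q1, q2, q3⟩ := h2
  obtain ⟨c1, c2, c3⟩ := hl
  have hlh : Y (max a a') < Y (min b b') := hY _ _ hov (by omega)
  have e1 := lineAt_affine X Y a b z.2 (Y (max a a')) (Y (min b b'))
  have e2 := lineAt_affine X Y a' b' z.2 (Y (max a a')) (Y (min b b'))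
  have hzl : Y (max a a') ≤ z.2 := by rcases max_choice a a' with h | h <;> rw [h] <;> assumption
  have hzh : z.2 ≤ Y (min b b') := by rcases min_choice b b' with h | h <;> rw [h] <;> assumption
  have f1 : a = a' → lineAt X Y a b (Y (max a a')) = lineAt X Y a' b' (Y (max a a')) := by
    rintro rfl; simp [lineAt_left]
  have f2 : b = b' → lineAt X Y a b (Y (min b b')) = lineAt X Y a' b' (Y (min b b')) := by
    rintro rfl; simp [lineAt_right (hY _ _ hab hb), lineAt_right (hY _ _ hab' hb)]
  rw [← p3] at e1
  rw [← q3] at e2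
  -- At the height of a common point, the two weighted nonnegative differences add up to zero, so
  -- each product vanishes.
  have g0 : (Y (min b b') - z.2) * (lineAt X Y a' b' (Y (max a a')) - lineAt X Y a b (Y (max a a')))
    + (z.2 - Y (max a a')) * (lineAt X Y a' b' (Y (min b b')) - lineAt X Y a b (Y (min b b'))) = 0 := by
    linarith
  have n1 : 0 ≤ lineAt X Y a' b' (Y (max a a')) - lineAt X Y a b (Y (max a a')) := by
    rcases c1 with h | h
    · linarith
    · rw [f1 h]; simp
  have n2 : 0 ≤ lineAt X Y a' b' (Y (min b b')) - lineAt X Y a b (Y (min b b')) := by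
    rcases c2 with h | h
    · linarith
    · rw [f2 h]; simp
  have m1 := mul_nonneg (sub_nonneg.2 hzh) n1
  have m2 := mul_nonneg (sub_nonneg.2 hzl) n2
  have z1 : (Y (min b b') - z.2) * (lineAt X Y a' b' (Y (max a a')) - lineAt X Y a b (Y (max a a')))
    = 0 := by linarith
  have z2 : (z.2 - Y (max a a')) * (lineAt X Y a' b' (Y (min b b')) - lineAt X Y a b (Y (min b b')))
    = 0 := by linarith
  rcases c1 with c1 | c1
  · have hz : z.2 = Y (min b b') := by
      rcases mul_eq_zero.1 z1 with h | h <;> linarith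
    have hbb : b = b' := by
      rcases c2 with c2 | c2
      · rcases mul_eq_zero.1 z2 with h | h <;> linarith
      · exact c2
    subst hbb
    simp only [min_self] at hz
    exact Or.inr ⟨hz, hz⟩
  · have c2' : lineAt X Y a b (Y (min b b')) < lineAt X Y a' b' (Y (min b b')) :=
      c2.resolve_right fun h => c3 ⟨c1, h⟩
    have hz : z.2 = Y (max a a') := by
      rcases mul_eq_zero.1 z2 with h | h <;> linarith
    subst c1
    simp only [max_self] at hz
    exact Or.inl ⟨hz, hz⟩

theorem Compatible.disjoint {X Y : ℕ → ℝ} {n a b a' b' : ℕ}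
    (hY : ∀ i j, i < j → j < n → Y i < Y j) (hab : a < b) (hb : b < n) (hab' : a' < b')
    (hb' : b' < n) (hov : max a a' < min b b') (h : Compatible X Y a b a' b') :
    Disjoint (openSegment ℝ (X a, Y a) (X b, Y b)) (segment ℝ (X a', Y a') (X b', Y b')) := by
  rw [Set.disjoint_left]
  intro z h1 h2
  have h3 := h1
  rw [mem_openSegment_iff (hY _ _ hab hb)] at h3
  have h4 := openSegment_subset_segment ℝ _ _ h1
  rcases h with h | h
  · rcases h.disjoint hY hab hb hab' hb' hov z h4 h2 with h | h <;> linarith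
  · rcases h.disjoint hY hab' hb' hab hb (by rwa [max_comm, min_comm]) z h2 h4 with h | h <;> linarith

theorem disjoint_of_le {X Y : ℕ → ℝ} {a b a' b' : ℕ} (h : Y a < Y b) (h' : Y a' < Y b')
    (hle : Y b ≤ Y a' ∨ Y b' ≤ Y a) :
    Disjoint (openSegment ℝ (X a, Y a) (X b, Y b)) (segment ℝ (X a', Y a') (X b', Y b')) := by
  rw [Set.disjoint_left]
  intro z h1 h2
  rw [mem_openSegment_iff h] at h1
  rw [mem_segment_iff h'] at h2
  rcases hle with hle | hle <;> linarith

/-- The difference of the abscissae has no zero inside the common height range, nor at an end where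
the endpoints differ, so it keeps one sign. Both disjointness hypotheses are needed, because the
endpoint that must avoid the other segment may belong to either edge. -/
theorem compatible_of_disjoint {X Y : ℕ → ℝ} {n a b a' b' : ℕ}
    (hY : ∀ i j, i < j → j < n → Y i < Y j) (hab : a < b) (hb : b < n) (hab' : a' < b')
    (hb' : b' < n) (hov : max a a' < min b b')
    (h1 : Disjoint (openSegment ℝ (X a, Y a) (X b, Y b)) (segment ℝ (X a', Y a') (X b', Y b')))
    (h2 : Disjoint (openSegment ℝ (X a', Y a') (X b', Y b')) (segment ℝ (X a, Y a) (X b, Y b))) :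
    Compatible X Y a b a' b' := by
  have y1 := hY _ _ hab hb
  have y2 := hY _ _ hab' hb'
  have hlh : Y (max a a') < Y (min b b') := hY _ _ hov (by omega)
  have mono : ∀ i j, i ≤ j → j < n → Y i ≤ Y j := by
    intro i j hij hj
    rcases hij.eq_or_lt with rfl | h
    · exact le_rfl
    · exact (hY i j h hj).le
  have la := mono a (max a a') (le_max_left _ _) (by omega)
  have la' := mono a' (max a a') (le_max_right _ _) (by omega)
  have lb := mono (min b b') b (min_le_left _ _) hb
  have lb' := mono (min b b') b' (min_le_right _ _) hb'
  rw [Set.disjoint_left] at h1 h2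
  have ne_of : ∀ y, Y (max a a') ≤ y → y ≤ Y (min b b') →
      ((Y a < y ∧ y < Y b) ∨ (Y a' < y ∧ y < Y b')) →
      lineAt X Y a b y ≠ lineAt X Y a' b' y := by
    intro y hl hh hor heq
    rcases hor with ⟨u, v⟩ | ⟨u, v⟩
    · exact h1 ((mem_openSegment_iff y1 (lineAt X Y a b y, y)).2 ⟨u, v, rfl⟩)
        ((mem_segment_iff y2 _).2 ⟨by simp; linarith, by simp; linarith, heq⟩)
    · exact h2 ((mem_openSegment_iff y2 (lineAt X Y a b y, y)).2 ⟨u, v, heq⟩)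
        ((mem_segment_iff y1 _).2 ⟨by simp; linarith, by simp; linarith, rfl⟩)
  have neL : a ≠ a' → lineAt X Y a b (Y (max a a')) ≠ lineAt X Y a' b' (Y (max a a')) := by
    intro hne
    refine ne_of _ le_rfl hlh.le ?_
    rcases lt_or_gt_of_ne hne with h | h
    · exact Or.inl ⟨hY _ _ (by omega) (by omega), by linarith⟩
    · exact Or.inr ⟨hY _ _ (by omega) (by omega), by linarith⟩
  have neH : b ≠ b' → lineAt X Y a b (Y (min b b')) ≠ lineAt X Y a' b' (Y (min b b')) := by
    intro hne
    refine ne_of _ hlh.le le_rfl ?_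
    rcases lt_or_gt_of_ne hne with h | h
    · exact Or.inr ⟨by linarith, hY _ _ (by omega) (by omega)⟩
    · exact Or.inl ⟨by linarith, hY _ _ (by omega) (by omega)⟩
  have neM : ∀ y, Y (max a a') < y → y < Y (min b b') → lineAt X Y a b y ≠ lineAt X Y a' b' y :=
    fun y u v => ne_of y u.le v.le (Or.inl ⟨by linarith, by linarith⟩)
  have hnot : ¬ (a = a' ∧ b = b') := by
    rintro ⟨rfl, rfl⟩
    obtain ⟨y, u, v⟩ := exists_between hlh
    exact neM y u v rfl
  generalize hl : Y (max a a') = l at *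
  generalize hh : Y (min b b') = h at *
  set d : ℝ → ℝ := fun y => lineAt X Y a b y - lineAt X Y a' b' y with hd
  have aff : ∀ y, (h - l) * d y = (h - y) * d l + (y - l) * d h := by
    intro y
    have e1 := lineAt_affine X Y a b y l h
    have e2 := lineAt_affine X Y a' b' y l h
    simp only [hd]; linarith
  -- If a positive combination of the two end values vanished, the difference would be zero at the
  -- corresponding weighted mean of the heights, which lies strictly inside the range.
  have opp : ∀ p q : ℝ, 0 < p → 0 < q → p * d l + q * d h ≠ 0 := by
    intro p q hp hq h0
    have hpq : 0 < p + q := by linarith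
    have hne : p + q ≠ 0 := hpq.ne'
    have hy := aff ((p * l + q * h) / (p + q))
    have e1 : h - (p * l + q * h) / (p + q) = p / (p + q) * (h - l) := by field_simp; ring
    have e2 : (p * l + q * h) / (p + q) - l = q / (p + q) * (h - l) := by field_simp; ring
    have i1 : 0 < p / (p + q) * (h - l) := mul_pos (by positivity) (by linarith)
    have i2 : 0 < q / (p + q) * (h - l) := mul_pos (by positivity) (by linarith)
    rw [e1, e2] at hy
    refine neM ((p * l + q * h) / (p + q)) (by linarith) (by linarith) ?_
    have : (h - l) * d ((p * l + q * h) / (p + q)) = 0 := by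
      rw [hy]
      have : p / (p + q) * (h - l) * d l + q / (p + q) * (h - l) * d h
        = (h - l) / (p + q) * (p * d l + q * d h) := by field_simp
      rw [this, h0, mul_zero]
    rcases mul_eq_zero.1 this with h' | h'
    · linarith
    · simpa [hd, sub_eq_zero] using h'
  have dl : a ≠ a' → d l ≠ 0 := fun hne => sub_ne_zero.2 (neL hne)
  have dh : b ≠ b' → d h ≠ 0 := fun hne => sub_ne_zero.2 (neH hne)
  have key : (d l < 0 ∨ a = a') ∧ (d h < 0 ∨ b = b') ∨ (0 < d l ∨ a = a') ∧ (0 < d h ∨ b = b') := by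
    by_cases ha : a = a'
    · have hb : b ≠ b' := fun hb => hnot ⟨ha, hb⟩
      rcases lt_or_gt_of_ne (dh hb) with h | h
      · exact Or.inl ⟨Or.inr ha, Or.inl h⟩
      · exact Or.inr ⟨Or.inr ha, Or.inl h⟩
    · rcases lt_or_gt_of_ne (dl ha) with h1 | h1
      · refine Or.inl ⟨Or.inl h1, ?_⟩
        by_contra hcon
        push Not at hcon
        have h2 : 0 < d h := lt_of_le_of_ne hcon.1 (dh hcon.2).symm
        exact opp (d h) (- d l) h2 (by linarith) (by ring)
      · refine Or.inr ⟨Or.inl h1, ?_⟩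
        by_contra hcon
        push Not at hcon
        have h2 : d h < 0 := lt_of_le_of_ne hcon.1 (dh hcon.2)
        exact opp (- d h) (d l) (by linarith) h1 (by ring)
  simp only [hd, sub_neg, sub_pos] at key
  rcases key with ⟨k1, k2⟩ | ⟨k1, k2⟩
  · exact Or.inl ⟨by rwa [hl], by rwa [hh], hnot⟩
  · refine Or.inr ⟨?_, ?_, fun h => hnot ⟨h.1.symm, h.2.symm⟩⟩
    · rw [max_comm, hl]; exact k1.imp_right Eq.symm
    · rw [min_comm, hh]; exact k2.imp_right Eq.symm

end Upward

/-! ### Sweeping a directed graph from bottom to top -/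

namespace Upward

/-- A digraph with vertices `0, …, n - 1` and edges `0, …, m - 1`, and a compatibility relation
between the segments joining positions. -/
structure Net where
  n : ℕ
  m : ℕ
  tl : ℕ → ℕ
  hd : ℕ → ℕ
  s : ℕ
  t : ℕ
  cmp : ℕ → ℕ → ℕ → ℕ → Prop

/-- An acyclic digraph with one source and one sink whose directed cuts have at most `k` edges. -/
structure Net.Valid (N : Net) (k : ℕ) : Prop where
  two_le : 2 ≤ N.n
  tl_lt : ∀ e < N.m, N.tl e < N.n
  hd_lt : ∀ e < N.m, N.hd e < N.n
  acyclic : ∃ h : ℕ → ℕ, ∀ e < N.m, h (N.tl e) < h (N.hd e)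
  s_lt : N.s < N.n
  s_ne_t : N.s ≠ N.t
  source : ∀ v < N.n, v ≠ N.s → ∃ e < N.m, N.hd e = v
  source' : ∀ e < N.m, N.hd e ≠ N.s
  sink : ∀ v < N.n, v ≠ N.t → ∃ e < N.m, N.tl e = v
  cut : ∀ C : Finset ℕ, (∀ e < N.m, N.hd e ∈ C → N.tl e ∈ C) →
    ((Finset.range N.m).filter fun e => N.tl e ∈ C ∧ N.hd e ∉ C).card ≤ k
  size : 2 * N.m + N.n ≤ N.n * N.n
  cmp_symm : ∀ a b a' b', N.cmp a b a' b' → N.cmp a' b' a b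

/-- The number of digits in base `n` needed for the indices below `j` that satisfy `P`, as a power
of `n`. -/
def pw (n : ℕ) (P : ℕ → Prop) [DecidablePred P] : ℕ → ℕ
  | 0 => 1
  | e + 1 => if P e then pw n P e * n else pw n P e

namespace Net
variable (N : Net)

/-- The base of the numerals that encode states. -/
def base : ℕ := N.m * N.n * N.n + 1

/-- The numeral for the entries of `val` below `j`. -/
def encTo (val : ℕ → ℕ) : ℕ → ℕ
  | 0 => 0
  | e + 1 => if val e = 0 then encTo val e else encTo val e * N.base + (e * N.n * N.n + val e)

/-- The code of a state. A state assigns to every edge that crosses the sweep line the number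
`a * n + b + 1`, where `a` and `b` are the positions of its ends, and `0` to all other edges. -/
def enc (val : ℕ → ℕ) : ℕ := N.encTo val N.m

/-- One more than the largest tail position among the entries below `j`. -/
def posTo (val : ℕ → ℕ) : ℕ → ℕ
  | 0 => 0
  | e + 1 => if val e = 0 then posTo val e else max (posTo val e) ((val e - 1) / N.n + 1)

/-- The position of the next vertex. -/
def pos (val : ℕ → ℕ) : ℕ := N.posTo val N.m

/-- The head position that the choice `x` assigns to the edge `e` with tail `v`. -/
def digit (v x e : ℕ) : ℕ := x / pw N.n (fun e => N.tl e = v) e % N.n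

/-- The state after placing `v` and choosing head positions `x` for its outgoing edges. -/
def next (val : ℕ → ℕ) (v x e : ℕ) : ℕ :=
  if e < N.m then
    if N.hd e = v then 0
    else if N.tl e = v then N.pos val * N.n + N.digit v x e + 1
    else val e
  else 0

/-- The number of choices for the head positions of the edges leaving `v`. -/
def choices (v : ℕ) : ℕ := pw N.n (fun e => N.tl e = v) N.m

/-- Compatibility of two entries of a state. -/
def entryCmp (u u' : ℕ) : Prop :=
  N.cmp ((u - 1) / N.n) ((u - 1) % N.n) ((u' - 1) / N.n) ((u' - 1) % N.n)

/-- `v` can be placed next in the state `val`. -/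
structure Adm (val : ℕ → ℕ) (v : ℕ) : Prop where
  lt : v < N.n
  zero : val = 0 → v = N.s
  ne_zero : val ≠ 0 → ∃ e < N.m, N.hd e = v
  iff : ∀ e < N.m, (N.hd e = v ↔ val e ≠ 0 ∧ (val e - 1) % N.n = N.pos val)

/-- The choice `x` is geometrically possible. -/
def Good (val : ℕ → ℕ) (v x : ℕ) : Prop :=
  ∀ e < N.m, N.tl e = v → N.pos val < N.digit v x e ∧
    ∀ g < N.m, g ≠ e → N.next val v x g ≠ 0 → N.entryCmp (N.next val v x e) (N.next val v x g)

/-- A step of the sweep. -/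
def Trans (val : ℕ → ℕ) (v : ℕ) (val' : ℕ → ℕ) : Prop :=
  N.Adm val v ∧ ∃ x < N.choices v, N.Good val v x ∧ val' = N.next val v x

/-- The state `val` is reachable by placing the vertices in the list, in this order. -/
inductive Reach : List ℕ → (ℕ → ℕ) → Prop
  | nil : Reach [] 0
  | snoc {ws val v val'} : Reach ws val → ws.length < N.n → N.Trans val v val' →
      Reach (ws ++ [v]) val'

end Net

/-! ### Choices as numbers: base-`n` digits attached to the indices that satisfy `P` -/

section pw
variable {n : ℕ} {P : ℕ → Prop} [DecidablePred P]

theorem pw_pos (hn : 0 < n) (j : ℕ) : 0 < pw n P j := by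
  induction j with
  | zero => simp [pw]
  | succ j ih => rw [pw]; split_ifs <;> positivity

theorem pw_eq (j : ℕ) : pw n P j = n ^ ((Finset.range j).filter P).card := by
  induction j with
  | zero => simp [pw]
  | succ j ih =>
    rw [pw, Finset.range_add_one, Finset.filter_insert]
    split_ifs with h
    · rw [Finset.card_insert_of_notMem (by simp), pow_succ, ih]
    · exact ih

theorem pw_dvd {e j : ℕ} (h : e < j) (he : P e) : pw n P e * n ∣ pw n P j := by
  induction j with
  | zero => omega
  | succ j ih =>
    rw [pw]
    rcases Nat.lt_succ_iff_lt_or_eq.1 h with h | rfl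
    · split_ifs
      · exact (ih h).mul_right _
      · exact ih h
    · simp [he]

theorem digit_mod {e j x : ℕ} (h : e < j) (he : P e) :
    x % pw n P j / pw n P e % n = x / pw n P e % n := by
  have h1 : ∀ y, y / pw n P e % n = y % (pw n P e * n) / pw n P e := fun y =>
    (Nat.mod_mul_right_div_self y _ _).symm
  rw [h1, h1 x, Nat.mod_mod_of_dvd _ (pw_dvd h he)]

theorem exists_digits (hn : 0 < n) (g : ℕ → ℕ) (hg : ∀ e, P e → g e < n) (j : ℕ) :
    ∃ x < pw n P j, ∀ e < j, P e → x / pw n P e % n = g e := by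
  induction j with
  | zero => exact ⟨0, by simp [pw]⟩
  | succ j ih =>
    obtain ⟨x, hx, h⟩ := ih
    by_cases hj : P j
    · refine ⟨x + pw n P j * g j, ?_, fun e he hPe => ?_⟩
      · rw [pw, if_pos hj]
        calc x + pw n P j * g j < pw n P j * 1 + pw n P j * g j := by omega
          _ = pw n P j * (g j + 1) := by ring
          _ ≤ pw n P j * n := Nat.mul_le_mul_left _ (hg j hj)
      · rcases Nat.lt_succ_iff_lt_or_eq.1 he with he | rfl
        · rw [← digit_mod he hPe, Nat.add_mul_mod_self_left, Nat.mod_eq_of_lt hx, h e he hPe]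
        · rw [Nat.add_mul_div_left _ _ (pw_pos hn _), Nat.div_eq_of_lt hx, zero_add,
            Nat.mod_eq_of_lt (hg e hPe)]
    · refine ⟨x, by rwa [pw, if_neg hj], fun e he hPe => ?_⟩
      rcases Nat.lt_succ_iff_lt_or_eq.1 he with he | rfl
      · exact h e he hPe
      · exact absurd hPe hj

/-- Stating the conclusion modulo `pw n P j` lets the induction peel off the top digit without a
bound on `x` and `y`. -/
theorem digits_inj (j : ℕ) {x y : ℕ} (h : ∀ e < j, P e → x / pw n P e % n = y / pw n P e % n) :
    x % pw n P j = y % pw n P j := by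
  induction j with
  | zero => simp [pw, Nat.mod_one]
  | succ j ih =>
    have ih' := ih fun e he => h e (by omega)
    rw [pw]
    split_ifs with hj
    · rw [Nat.mod_mul, Nat.mod_mul, ih', h j (by omega) hj]
    · exact ih'

end pw

/-! ### The invariant of a sweep -/

namespace Net
variable {N : Net} {k : ℕ}

theorem posTo_le_iff {val : ℕ → ℕ} {j c : ℕ} :
    N.posTo val j ≤ c ↔ ∀ e < j, val e ≠ 0 → (val e - 1) / N.n + 1 ≤ c := by
  induction j with
  | zero => simp [posTo]
  | succ j ih =>
    rw [posTo]
    split_ifs with h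
    · rw [ih]
      refine ⟨fun H e he hv => ?_, fun H e he hv => H e (by omega) hv⟩
      rcases Nat.lt_succ_iff_lt_or_eq.1 he with he | rfl
      · exact H e he hv
      · exact absurd h hv
    · rw [max_le_iff, ih]
      refine ⟨fun H e he hv => ?_, fun H => ⟨fun e he hv => H e (by omega) hv, H j (by omega) h⟩⟩
      rcases Nat.lt_succ_iff_lt_or_eq.1 he with he | rfl
      · exact H.1 e he hv
      · exact H.2

theorem le_pos {val : ℕ → ℕ} {e : ℕ} (he : e < N.m) (hv : val e ≠ 0) :
    (val e - 1) / N.n + 1 ≤ N.pos val := posTo_le_iff.1 le_rfl e he hv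

theorem pos_zero : N.pos 0 = 0 := Nat.le_zero.1 (posTo_le_iff.2 (by simp))

/-- What is true of a state reached by placing the vertices in `ws`. -/
structure Inv (N : Net) (ws : List ℕ) (val : ℕ → ℕ) : Prop where
  nodup : ws.Nodup
  lt : ∀ v ∈ ws, v < N.n
  order : ∀ e < N.m, N.hd e ∈ ws → N.tl e ∈ ws ∧ ws.idxOf (N.tl e) < ws.idxOf (N.hd e)
  supp : ∀ e < N.m, (val e ≠ 0 ↔ N.tl e ∈ ws ∧ N.hd e ∉ ws)
  entry : ∀ e < N.m, val e ≠ 0 →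
    ∃ b, val e = ws.idxOf (N.tl e) * N.n + b + 1 ∧ ws.length ≤ b ∧ b < N.n
  out : ∀ e, N.m ≤ e → val e = 0

theorem entry_div {n a b : ℕ} (hb : b < n) : (a * n + b + 1 - 1) / n = a := by
  rw [Nat.add_sub_cancel, mul_comm, Nat.mul_add_div (by omega), Nat.div_eq_of_lt hb, add_zero]

theorem entry_mod {n a b : ℕ} (hb : b < n) : (a * n + b + 1 - 1) % n = b := by
  rw [Nat.add_sub_cancel, mul_comm, Nat.mul_add_mod, Nat.mod_eq_of_lt hb]

namespace Inv
variable {ws : List ℕ} {val : ℕ → ℕ}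

theorem div (h : Inv N ws val) {e : ℕ} (he : e < N.m) (hv : val e ≠ 0) :
    (val e - 1) / N.n = ws.idxOf (N.tl e) := by
  obtain ⟨b, h1, -, h3⟩ := h.entry e he hv
  rw [h1, entry_div h3]

theorem eq_div_mod (h : Inv N ws val) {e : ℕ} (he : e < N.m) (hv : val e ≠ 0) :
    val e = ws.idxOf (N.tl e) * N.n + (val e - 1) % N.n + 1 := by
  obtain ⟨b, h1, -, h3⟩ := h.entry e he hv
  conv_rhs => rw [h1, entry_mod h3]
  exact h1

theorem length_le (h : Inv N ws val) : ws.length ≤ N.n := by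
  rw [← List.toFinset_card_of_nodup h.nodup, ← Finset.card_range N.n]
  exact Finset.card_le_card fun v hv => Finset.mem_range.2 (h.lt v (List.mem_toFinset.1 hv))

theorem mem_of_full (h : Inv N ws val) (hl : N.n ≤ ws.length) {v : ℕ} (hv : v < N.n) : v ∈ ws := by
  have hs : ws.toFinset = Finset.range N.n := by
    refine Finset.eq_of_subset_of_card_le
      (fun v hv => Finset.mem_range.2 (h.lt v (List.mem_toFinset.1 hv))) ?_
    rw [List.toFinset_card_of_nodup h.nodup, Finset.card_range]; exact hl
  rw [← List.mem_toFinset, hs]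
  exact Finset.mem_range.2 hv

theorem eq_zero_of_full (hN : N.Valid k) (h : Inv N ws val) (hl : N.n ≤ ws.length) : val = 0 := by
  funext e
  rcases lt_or_ge e N.m with he | he
  · by_contra hv
    exact ((h.supp e he).1 hv).2 (h.mem_of_full hl (hN.hd_lt e he))
  · exact h.out e he

end Inv

/-- Take a missing vertex of greatest height. It is not `t`, so it has an outgoing edge, whose head
is in `C` by maximality; closure then puts the tail in `C`. -/
theorem Valid.mem_of_t_mem (hN : N.Valid k) {C : ℕ → Prop}
    (hC : ∀ e < N.m, C (N.hd e) → C (N.tl e)) (ht : C N.t) : ∀ v < N.n, C v := by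
  obtain ⟨h, hh⟩ := hN.acyclic
  by_contra hcon
  push Not at hcon
  obtain ⟨v, hv, hcv⟩ := hcon
  classical
  have hfin : ((Finset.range N.n).filter fun v => ¬ C v).Nonempty := ⟨v, by simp [hv, hcv]⟩
  obtain ⟨u, hu, hmax⟩ := Finset.exists_max_image _ h hfin
  simp only [Finset.mem_filter, Finset.mem_range] at hu hmax
  have hut : u ≠ N.t := fun hut => hu.2 (hut ▸ ht)
  obtain ⟨e, he, rfl⟩ := hN.sink u hu.1 hut
  have := hmax (N.hd e) ⟨hN.hd_lt e he, fun hc => hu.2 (hC e he hc)⟩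
  have := hh e he
  omega

namespace Inv
variable {ws : List ℕ} {val : ℕ → ℕ}

/-- Active edges have placed tails, which gives one inequality. For the other, the vertex placed
last is not `t`, for otherwise all vertices would have been placed; hence it has an outgoing edge,
and this edge is active. -/
theorem pos_eq (hN : N.Valid k) (h : Inv N ws val) (hl : ws.length < N.n) :
    N.pos val = ws.length := by
  refine le_antisymm (posTo_le_iff.2 fun e he hv => ?_) ?_
  · rw [h.div he hv]
    exact List.idxOf_lt_length_iff.2 ((h.supp e he).1 hv).1
  · rcases List.eq_nil_or_concat' ws with rfl | ⟨us, u, rfl⟩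
    · simp
    have hut : u ≠ N.t := by
      rintro rfl
      have hall := hN.mem_of_t_mem (C := fun v => v ∈ us ++ [N.t])
        (fun e he hc => (h.order e he hc).1) (by simp)
      have : (Finset.range N.n).card ≤ (us ++ [N.t]).toFinset.card :=
        Finset.card_le_card fun v hv => List.mem_toFinset.2 (hall v (Finset.mem_range.1 hv))
      have := List.toFinset_card_le (us ++ [N.t])
      simp at *
      omega
    have hu : u < N.n := h.lt u (by simp)
    obtain ⟨e, he, rfl⟩ := hN.sink u hu hut
    have hnd : N.tl e ∉ us := by
      have := h.nodup
      simp [List.nodup_append] at this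
      exact fun hc => this.2 _ hc rfl
    have hidx : (us ++ [N.tl e]).idxOf (N.tl e) = us.length := by
      rw [List.idxOf_append_of_notMem hnd]; simp
    -- A placed head would stand after its tail in the list, but the tail is the last entry.
    have hv : val e ≠ 0 := by
      rw [h.supp e he]
      refine ⟨by simp, fun hc => ?_⟩
      have h1 := (h.order e he hc).2
      have h2 := List.idxOf_lt_length_iff.2 hc
      simp only [List.length_append, List.length_singleton] at h1 h2
      omega
    have := le_pos he hv
    rw [h.div he hv] at this
    rw [hidx] at this
    simpa using this

theorem eq_nil (hN : N.Valid k) (h : Inv N ws 0) (hl : ws.length < N.n) : ws = [] := by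
  rw [← List.length_eq_zero_iff, ← h.pos_eq hN hl, pos_zero]

/-- Unless nothing has been placed, the next vertex is the head of an active edge, and heads of
active edges are not placed. -/
theorem notMem (hN : N.Valid k) (h : Inv N ws val) (hl : ws.length < N.n) {v : ℕ}
    (hv : N.Adm val v) : v ∉ ws := by
  by_cases h0 : val = 0
  · subst h0; rw [h.eq_nil hN hl]; simp
  · obtain ⟨e, he, rfl⟩ := hv.ne_zero h0
    exact ((h.supp e he).1 ((hv.iff e he).1 rfl).1).2

theorem tl_ne_hd (hN : N.Valid k) {e : ℕ} (he : e < N.m) : N.tl e ≠ N.hd e := by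
  obtain ⟨h, hh⟩ := hN.acyclic
  intro heq
  have := hh e he
  rw [heq] at this
  omega

/-- The tails of the incoming edges of the next vertex have been placed. -/
theorem tl_mem (h : Inv N ws val) {v : ℕ} (hv : N.Adm val v) {e : ℕ} (he : e < N.m)
    (hev : N.hd e = v) : N.tl e ∈ ws :=
  ((h.supp e he).1 ((hv.iff e he).1 hev).1).1

/-- The outgoing edges of the next vertex are not yet present. -/
theorem hd_notMem (hN : N.Valid k) (h : Inv N ws val) (hl : ws.length < N.n) {v : ℕ}
    (hv : N.Adm val v) {e : ℕ} (he : e < N.m) (hev : N.tl e = v) : N.hd e ∉ ws :=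
  fun hc => h.notMem hN hl hv (hev ▸ (h.order e he hc).1)

theorem next_ne_zero_iff (hN : N.Valid k) (h : Inv N ws val) (hl : ws.length < N.n) {v x : ℕ}
    (hv : N.Adm val v) {e : ℕ} (he : e < N.m) :
    N.next val v x e ≠ 0 ↔ N.tl e ∈ ws ++ [v] ∧ N.hd e ∉ ws ++ [v] := by
  rw [next, if_pos he]
  split_ifs with h1 h2
  · simp [h1]
  · have := h.hd_notMem hN hl hv he h2
    simp [h2, h1, this]
  · rw [h.supp e he]; simp [h1, h2]

/-- An old promise equal to the current position belongs to an edge entering `v`, which disappears,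
and `Good` makes the new promises larger. So all promises stay at or above the new length. -/
theorem next (hN : N.Valid k) (h : Inv N ws val) (hl : ws.length < N.n) {v x : ℕ}
    (hv : N.Adm val v) (hx : N.Good val v x) : Inv N (ws ++ [v]) (N.next val v x) := by
  have hn : v ∉ ws := h.notMem hN hl hv
  have hmem : ∀ u ∈ ws, (ws ++ [v]).idxOf u = ws.idxOf u := fun u hu =>
    List.idxOf_append_of_mem hu
  have hidx : (ws ++ [v]).idxOf v = ws.length := by
    rw [List.idxOf_append_of_notMem hn]; simp
  refine ⟨?_, ?_, ?_, fun e he => h.next_ne_zero_iff hN hl hv he, ?_, ?_⟩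
  · exact List.nodup_append.2 ⟨h.nodup, by simp, by
      intro a ha b hb; simp at hb; rintro rfl; exact hn (hb ▸ ha)⟩
  · intro u hu
    rcases List.mem_append.1 hu with hu | hu
    · exact h.lt u hu
    · rw [List.mem_singleton.1 hu]; exact hv.lt
  · intro e he hd
    rcases List.mem_append.1 hd with hd | hd
    · obtain ⟨h1, h2⟩ := h.order e he hd
      exact ⟨by simp [h1], by rw [hmem _ h1, hmem _ hd]; exact h2⟩
    · have hd := List.mem_singleton.1 hd
      have h1 := h.tl_mem hv he hd
      refine ⟨by simp [h1], ?_⟩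
      rw [hmem _ h1, hd, hidx]
      exact List.idxOf_lt_length_iff.2 h1
  · intro e he hne
    have hs := (h.next_ne_zero_iff hN hl hv he).1 hne
    rw [Net.next, if_pos he] at hne ⊢
    split_ifs at hne ⊢ with h1 h2
    · exact absurd rfl hne
    · refine ⟨N.digit v x e, ?_, ?_, ?_⟩
      · rw [h2, hidx, h.pos_eq hN hl]
      · have := (hx e he h2).1
        rw [h.pos_eq hN hl] at this
        simpa using this
      · exact Nat.mod_lt _ (by have := hN.two_le; omega)
    · obtain ⟨b, e1, e2, e3⟩ := h.entry e he hne
      have ht := ((h.supp e he).1 hne).1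
      refine ⟨b, by rw [hmem _ ht, ← e1], ?_, e3⟩
      -- An edge promised to the current position is due, so its head would be `v`, a case already
      -- excluded.
      have hb : b ≠ ws.length := by
        rintro rfl
        refine h1 ((hv.iff e he).2 ⟨hne, ?_⟩)
        rw [e1, entry_mod e3, h.pos_eq hN hl]
      simp; omega
  · intro e he
    rw [Net.next, if_neg (by omega)]

theorem zero : Inv N [] 0 := by
  constructor <;> simp

end Inv

theorem Reach.inv (hN : N.Valid k) {ws : List ℕ} {val : ℕ → ℕ} (h : N.Reach ws val) :
    Inv N ws val := by
  induction h with
  | nil => exact Inv.zero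
  | snoc _ hl ht ih =>
    obtain ⟨hv, x, -, hx, rfl⟩ := ht
    exact ih.next hN hl hv hx

/-- The only way to be in a state after all vertices are placed is to be in the zero state, which is
also the start. A step from there is then a first step. -/
theorem Trans.reach (hN : N.Valid k) {val val' : ℕ → ℕ} {v : ℕ} {ws : List ℕ}
    (h : N.Reach ws val) (ht : N.Trans val v val') :
    ∃ us, us.length < N.n ∧ N.Reach us val ∧ N.Reach (us ++ [v]) val' := by
  rcases lt_or_ge ws.length N.n with hl | hl
  · exact ⟨ws, hl, h, h.snoc hl ht⟩
  · have h0 := (h.inv hN).eq_zero_of_full hN hl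
    subst h0
    have : 0 < N.n := by have := hN.two_le; omega
    exact ⟨[], this, .nil, Reach.nil.snoc this ht⟩

end Net
end Upward

/-! ### Sweeps of full length and drawings -/

namespace Upward

/-- A placement `π` of the vertices at positions that gives an upward planar drawing. -/
structure Net.Drawing (N : Net) (π : ℕ → ℕ) : Prop where
  lt : ∀ v < N.n, π v < N.n
  inj : ∀ u < N.n, ∀ v < N.n, π u = π v → u = v
  up : ∀ e < N.m, π (N.tl e) < π (N.hd e)
  cmp : ∀ e < N.m, ∀ e' < N.m, e ≠ e' →
    max (π (N.tl e)) (π (N.tl e')) < min (π (N.hd e)) (π (N.hd e')) →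
    N.cmp (π (N.tl e)) (π (N.hd e)) (π (N.tl e')) (π (N.hd e'))

namespace Net
variable {N : Net} {k : ℕ}

/-- The later tail of two overlapping edges is placed while the other edge is active, and `Good`
compares them then. In the middle of a sweep some heads are not placed yet, so the statement speaks
of any `π` that agrees with the placed vertices and keeps the promises. -/
theorem Reach.cmp (hN : N.Valid k) {ws : List ℕ} {val : ℕ → ℕ} (h : N.Reach ws val) (π : ℕ → ℕ)
    (hπ : ∀ v ∈ ws, π v = ws.idxOf v)
    (hval : ∀ e < N.m, val e ≠ 0 → (val e - 1) % N.n = π (N.hd e)) :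
    ∀ e < N.m, ∀ e' < N.m, e ≠ e' → N.tl e ∈ ws → N.tl e' ∈ ws →
      max (π (N.tl e)) (π (N.tl e')) < min (π (N.hd e)) (π (N.hd e')) →
      N.cmp (π (N.tl e)) (π (N.hd e)) (π (N.tl e')) (π (N.hd e')) := by
  induction h with
  | nil => simp
  | @snoc ws val v val' hr hl ht ih =>
    have hi := hr.inv hN
    have hi' := (hr.snoc hl ht).inv hN
    obtain ⟨hv, x, -, hx, rfl⟩ := ht
    have hn : v ∉ ws := hi.notMem hN hl hv
    have hpos := hi.pos_eq hN hl
    have hmem : ∀ u ∈ ws, (ws ++ [v]).idxOf u = ws.idxOf u := fun u hu =>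
      List.idxOf_append_of_mem hu
    have hidx : (ws ++ [v]).idxOf v = ws.length := by
      rw [List.idxOf_append_of_notMem hn]; simp
    -- The edges entering `v` were promised the position at which `v` is placed; the other entries
    -- have not changed.
    have ih' := ih (fun u hu => by rw [hπ u (by simp [hu]), hmem u hu]) (by
      intro e he hne
      by_cases h1 : N.hd e = v
      · rw [((hv.iff e he).1 h1).2, h1, hπ v (by simp), hidx, hpos]
      · have h2 : N.tl e ≠ v := fun h2 => hn (h2 ▸ ((hi.supp e he).1 hne).1)
        have h3 : N.next val v x e = val e := by rw [Net.next, if_pos he, if_neg h1, if_neg h2]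
        rw [← h3]
        exact hval e he (by rwa [h3]))
    have key : ∀ e < N.m, ∀ e' < N.m, e ≠ e' → N.tl e = v → N.tl e' ∈ ws ++ [v] →
        max (π (N.tl e)) (π (N.tl e')) < min (π (N.hd e)) (π (N.hd e')) →
        N.cmp (π (N.tl e)) (π (N.hd e)) (π (N.tl e')) (π (N.hd e')) := by
      intro e he e' he' hne hte hte' hov
      have hpv : π v = ws.length := by rw [hπ v (by simp), hidx]
      -- A head above the current position cannot be among the placed vertices, so both edges are
      -- present in the new state.
      have hnz : ∀ g < N.m, N.tl g ∈ ws ++ [v] → ws.length < π (N.hd g) →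
          N.next val v x g ≠ 0 := by
        intro g hg hgt hgl
        rw [hi.next_ne_zero_iff hN hl hv hg]
        refine ⟨hgt, fun hc => ?_⟩
        have h1 := List.idxOf_lt_length_iff.2 hc
        rw [← hπ _ hc] at h1
        simp at h1
        omega
      rw [hte, hpv] at hov
      have n1 := hnz e he (by simp [hte]) (by omega)
      have n2 := hnz e' he' hte' (by omega)
      have hc := (hx e he hte).2 e' he' hne.symm n2
      rw [entryCmp, hi'.div he n1, hi'.div he' n2, hval e he n1, hval e' he' n2,
        ← hπ _ (by simp [hte]), ← hπ _ hte'] at hc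
      exact hc
    intro e he e' he' hne ht ht' hov
    by_cases h1 : N.tl e = v
    · exact key e he e' he' hne h1 ht' hov
    by_cases h2 : N.tl e' = v
    · exact hN.cmp_symm _ _ _ _ (key e' he' e he hne.symm h2 ht (by rwa [max_comm, min_comm]))
    · exact ih' e he e' he' hne (by simpa [h1] using ht) (by simpa [h2] using ht') hov

/-- After all vertices the state is zero, so no promise is left to be checked in `Reach.cmp`. -/
theorem Reach.drawing (hN : N.Valid k) {ws : List ℕ} {val : ℕ → ℕ} (h : N.Reach ws val)
    (hl : ws.length = N.n) : N.Drawing ws.idxOf := by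
  have hi := h.inv hN
  have hall : ∀ v < N.n, v ∈ ws := fun v hv => hi.mem_of_full hl.ge hv
  refine ⟨fun v hv => ?_, fun u hu v hv huv => ?_, fun e he => ?_, fun e he e' he' hne hov => ?_⟩
  · rw [← hl]; exact List.idxOf_lt_length_iff.2 (hall v hv)
  · exact (List.idxOf_inj (hall u hu)).1 huv
  · exact (hi.order e he (hall _ (hN.hd_lt e he))).2
  · refine h.cmp hN _ (fun _ _ => rfl) ?_ e he e' he' hne (hall _ (hN.tl_lt e he))
      (hall _ (hN.tl_lt e' he')) hov
    intro g hg hv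
    rw [hi.eq_zero_of_full hN hl.ge] at hv
    exact absurd rfl hv

theorem Drawing.exists_inverse {π : ℕ → ℕ} (h : N.Drawing π) :
    ∃ ρ : ℕ → ℕ, ∀ j < N.n, ρ j < N.n ∧ π (ρ j) = j := by
  have himg : (Finset.range N.n).image π = Finset.range N.n := by
    refine Finset.eq_of_subset_of_card_le ?_ ?_
    · intro x hx
      obtain ⟨v, hv, rfl⟩ := Finset.mem_image.1 hx
      exact Finset.mem_range.2 (h.lt v (Finset.mem_range.1 hv))
    · rw [Finset.card_image_of_injOn]
      intro u hu v hv huv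
      exact h.inj u (by simpa using hu) v (by simpa using hv) huv
  have : ∀ j, ∃ v, j < N.n → v < N.n ∧ π v = j := by
    intro j
    by_cases hj : j < N.n
    · rw [← Finset.mem_range, ← himg] at hj
      obtain ⟨v, hv, hvj⟩ := Finset.mem_image.1 hj
      exact ⟨v, fun _ => ⟨Finset.mem_range.1 hv, hvj⟩⟩
    · exact ⟨0, fun h => absurd h hj⟩
  choose ρ hρ using this
  exact ⟨ρ, hρ⟩

/-- Place the vertices in the order of their positions and promise to each head its true position.
The state after `j` steps is then explicit. -/
theorem Drawing.reach (hN : N.Valid k) {π : ℕ → ℕ} (h : N.Drawing π) :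
    ∃ ws, N.Reach ws 0 ∧ ws.length = N.n ∧ ∀ v < N.n, ws.idxOf v = π v := by
  obtain ⟨ρ, hρ⟩ := h.exists_inverse
  have hn : 0 < N.n := by have := hN.two_le; omega
  have hρπ : ∀ v < N.n, ρ (π v) = v := fun v hv =>
    h.inj _ (hρ _ (h.lt v hv)).1 _ hv (hρ _ (h.lt v hv)).2
  have hnd : ∀ j ≤ N.n, ((List.range j).map ρ).Nodup := by
    intro j hj
    refine (List.nodup_map_iff_inj_on List.nodup_range).2 fun x hx y hy hxy => ?_
    rw [← (hρ x (by simp at hx; omega)).2, hxy, (hρ y (by simp at hy; omega)).2]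
  have hmem : ∀ j ≤ N.n, ∀ v < N.n, v ∈ (List.range j).map ρ ↔ π v < j := by
    intro j hj v hv
    simp only [List.mem_map, List.mem_range]
    constructor
    · rintro ⟨i, hi, rfl⟩
      rwa [(hρ i (by omega)).2]
    · exact fun hl => ⟨π v, hl, hρπ v hv⟩
  have hidx : ∀ j ≤ N.n, ∀ v < N.n, π v < j → ((List.range j).map ρ).idxOf v = π v := by
    intro j hj v hv hl
    have hlen : π v < ((List.range j).map ρ).length := by simpa using hl
    have := (hnd j hj).idxOf_getElem (π v) hlen
    simpa [hρπ v hv] using this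
  have main : ∀ j ≤ N.n, N.Reach ((List.range j).map ρ) fun e =>
      if e < N.m ∧ π (N.tl e) < j ∧ j ≤ π (N.hd e) then π (N.tl e) * N.n + π (N.hd e) + 1 else 0 := by
    intro j
    induction j with
    | zero =>
      intro _
      simp only [not_lt_zero, false_and, and_false, if_false]
      exact .nil
    | succ j ih =>
      intro hj
      have hr := ih (by omega)
      have hl : ((List.range j).map ρ).length < N.n := by simp; omega
      have hi := hr.inv hN
      have hp := hi.pos_eq hN hl
      simp only [List.length_map, List.length_range] at hp
      set val : ℕ → ℕ := fun e => if e < N.m ∧ π (N.tl e) < j ∧ j ≤ π (N.hd e) then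
        π (N.tl e) * N.n + π (N.hd e) + 1 else 0 with hval
      have hρj := hρ j (by omega)
      have hdlt : ∀ e < N.m, π (N.hd e) < N.n := fun e he => h.lt _ (hN.hd_lt e he)
      have hhd : ∀ e < N.m, (N.hd e = ρ j ↔ π (N.hd e) = j) := fun e he =>
        ⟨fun heq => by rw [heq, hρj.2], fun heq => by rw [← heq, hρπ _ (hN.hd_lt e he)]⟩
      have htl : ∀ e < N.m, (N.tl e = ρ j ↔ π (N.tl e) = j) := fun e he =>
        ⟨fun heq => by rw [heq, hρj.2], fun heq => by rw [← heq, hρπ _ (hN.tl_lt e he)]⟩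
      have hadm : N.Adm val (ρ j) := by
        refine ⟨hρj.1, fun h0 => ?_, fun h0 => ?_, fun e he => ?_⟩
        · rw [h0, pos_zero] at hp
          by_contra hs
          obtain ⟨e, he, heq⟩ := hN.source _ hρj.1 hs
          have := h.up e he
          rw [heq, hρj.2] at this
          omega
        · refine hN.source _ hρj.1 fun hs => h0 ?_
          -- The vertex at position `0` has no incoming edge, since its tail would be lower; so it
          -- is the source.
          have : j = 0 := by
            by_contra hj0
            obtain ⟨h1, h2⟩ := hρ 0 hn
            have hne : ρ 0 ≠ N.s := fun heq => hj0 (by rw [← hρj.2, hs, ← heq, h2])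
            obtain ⟨e, he, heq⟩ := hN.source _ h1 hne
            have := h.up e he
            rw [heq, h2] at this
            omega
          funext e
          simp [hval, this]
        · rw [hhd e he, hp]
          by_cases hc : π (N.tl e) < j ∧ j ≤ π (N.hd e)
          · have : val e = π (N.tl e) * N.n + π (N.hd e) + 1 := by simp [hval, he, hc]
            rw [this, entry_mod (hdlt e he)]
            simp
          · have : val e = 0 := by simp only [hval, he, true_and, if_neg hc]
            rw [this]
            have := h.up e he
            simp; omega
      -- The reduction modulo `n` only serves the indices `e ≥ m`, about which nothing is known; for
      -- edges it changes nothing.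
      obtain ⟨x, hx, hxd⟩ := exists_digits (n := N.n) (P := fun e => N.tl e = ρ j) hn
        (fun e => π (N.hd e) % N.n) (fun e _ => Nat.mod_lt _ hn) N.m
      have hnext : N.next val (ρ j) x = fun e => if e < N.m ∧ π (N.tl e) < j + 1 ∧ j + 1 ≤ π (N.hd e)
          then π (N.tl e) * N.n + π (N.hd e) + 1 else 0 := by
        funext e
        rw [next]
        by_cases he : e < N.m
        · have hup := h.up e he
          simp only [he, if_true, true_and, hhd e he, htl e he]
          split_ifs with c1 c2 c3 c4 c5
          · omega
          · rfl
          · rw [digit, hxd e he ((htl e he).2 c3), hp, c3, Nat.mod_eq_of_lt (hdlt e he)]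
          · omega
          · simp only [hval, he, true_and]; rw [if_pos (by omega)]
          · simp only [hval, he, true_and]; rw [if_neg (by omega)]
        · simp [he]
      rw [← hnext, List.range_succ, List.map_append]
      refine hr.snoc hl ⟨hadm, x, hx, ?_, rfl⟩
      intro e he hte
      refine ⟨?_, fun g hg hge hne => ?_⟩
      · have hup := h.up e he
        rw [digit, hxd e he hte, hp, Nat.mod_eq_of_lt (hdlt e he)]
        rw [(htl e he).1 hte] at hup
        exact hup
      · have e1 := congrFun hnext e
        have e2 := congrFun hnext g
        have hup := h.up e he
        have hte' := (htl e he).1 hte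
        rw [if_pos ⟨he, by omega, by omega⟩] at e1
        simp only [e2] at hne
        split_ifs at e2 hne with hc
        · rw [entryCmp, e1, e2, entry_div (hdlt e he), entry_mod (hdlt e he), entry_div (hdlt g hg),
            entry_mod (hdlt g hg)]
          exact h.cmp e he g hg hge.symm (by omega)
        · exact absurd rfl hne
  have hfin := main N.n le_rfl
  have h0 := (hfin.inv hN).eq_zero_of_full hN (by simp)
  rw [h0] at hfin
  exact ⟨_, hfin, by simp, fun v hv => hidx N.n le_rfl v hv (h.lt v hv)⟩

/-- Positions in a state reached twice agree. -/
theorem Reach.length_eq (hN : N.Valid k) {ws us : List ℕ} {val : ℕ → ℕ} (h : N.Reach ws val)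
    (h' : N.Reach us val) (hw : ws ≠ []) (hu : us ≠ []) : ws.length = us.length := by
  have i1 := h.inv hN
  have i2 := h'.inv hN
  have l1 := i1.length_le
  have l2 := i2.length_le
  rcases l1.eq_or_lt with e1 | e1
  · rcases l2.eq_or_lt with e2 | e2
    · omega
    · have h0 := i1.eq_zero_of_full hN e1.ge
      subst h0
      exact absurd (i2.eq_nil hN e2) hu
  · rcases l2.eq_or_lt with e2 | e2
    · have h0 := i2.eq_zero_of_full hN e2.ge
      subst h0
      exact absurd (i1.eq_nil hN e1) hw
    · rw [← i1.pos_eq hN e1, ← i2.pos_eq hN e2]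

/-- The state before a step is determined by the vertices placed and the state after it. -/
theorem Trans.unique (hN : N.Valid k) {ws : List ℕ} {val₁ val₂ val' : ℕ → ℕ} {v : ℕ}
    (h₁ : N.Reach ws val₁) (h₂ : N.Reach ws val₂) (hl : ws.length < N.n) (t₁ : N.Trans val₁ v val')
    (t₂ : N.Trans val₂ v val') : val₁ = val₂ := by
  have i1 := h₁.inv hN
  have i2 := h₂.inv hN
  obtain ⟨a1, x1, -, -, rfl⟩ := t₁
  obtain ⟨a2, x2, -, -, he2⟩ := t₂
  have hn := i1.notMem hN hl a1
  funext e
  rcases lt_or_ge e N.m with he | he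
  · by_cases c1 : N.hd e = v
    · have b1 := (a1.iff e he).1 c1
      have b2 := (a2.iff e he).1 c1
      rw [i1.eq_div_mod he b1.1, i2.eq_div_mod he b2.1, b1.2, b2.2, i1.pos_eq hN hl, i2.pos_eq hN hl]
    · by_cases c2 : N.tl e = v
      · have z1 : val₁ e = 0 := by
          by_contra hc
          exact hn (c2 ▸ ((i1.supp e he).1 hc).1)
        have z2 : val₂ e = 0 := by
          by_contra hc
          exact hn (c2 ▸ ((i2.supp e he).1 hc).1)
        rw [z1, z2]
      · have := congrFun he2 e
        simpa [next, he, c1, c2] using this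
  · rw [i1.out e he, i2.out e he]

/-- Different choices lead to different states. -/
theorem next_inj (hN : N.Valid k) {val : ℕ → ℕ} {v x y : ℕ} (hx : x < N.choices v)
    (hy : y < N.choices v) (h : N.next val v x = N.next val v y) : x = y := by
  have := digits_inj (n := N.n) (P := fun e => N.tl e = v) N.m (x := x) (y := y) (by
    intro e he hev
    have h1 := congrFun h e
    have h2 : N.hd e ≠ v := fun h2 => Inv.tl_ne_hd hN he (hev.trans h2.symm)
    simpa [next, he, h2, hev, digit] using h1)
  rwa [← choices, Nat.mod_eq_of_lt hx, Nat.mod_eq_of_lt hy] at this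

/-- In a nonzero state, an edge entering `u` is due, and every due edge enters `v`. -/
theorem Adm.unique {val : ℕ → ℕ} {u v : ℕ} (hu : N.Adm val u) (hv : N.Adm val v) : u = v := by
  by_cases h0 : val = 0
  · rw [hu.zero h0, hv.zero h0]
  · obtain ⟨e, he, rfl⟩ := hu.ne_zero h0
    exact (hv.iff e he).2 ((hu.iff e he).1 rfl)

/-! ### Codes -/

/-- The entries are in the range of positions, and only edges have entries. -/
structure Bounded (N : Net) (val : ℕ → ℕ) : Prop where
  le : ∀ e, val e ≤ N.n * N.n
  out : ∀ e, N.m ≤ e → val e = 0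

theorem Inv.bounded {ws : List ℕ} {val : ℕ → ℕ} (h : Inv N ws val) : N.Bounded val := by
  refine ⟨fun e => ?_, h.out⟩
  by_cases hv : val e = 0
  · rw [hv]; exact Nat.zero_le _
  have he : e < N.m := by
    by_contra he
    exact hv (h.out e (by omega))
  obtain ⟨b, h1, -, h3⟩ := h.entry e he hv
  have h4 : ws.idxOf (N.tl e) < ws.length := List.idxOf_lt_length_iff.2 ((h.supp e he).1 hv).1
  have h5 := h.length_le
  rw [h1]
  calc ws.idxOf (N.tl e) * N.n + b + 1 ≤ ws.idxOf (N.tl e) * N.n + N.n := by omega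
    _ = (ws.idxOf (N.tl e) + 1) * N.n := by ring
    _ ≤ N.n * N.n := Nat.mul_le_mul_right _ (by omega)

theorem Bounded.digit_le {val : ℕ → ℕ} (h : N.Bounded val) {e j : ℕ} (he : e < j) :
    e * N.n * N.n + val e ≤ j * N.n * N.n := by
  calc e * N.n * N.n + val e ≤ e * N.n * N.n + N.n * N.n := Nat.add_le_add_left (h.le e) _
    _ = (e + 1) * N.n * N.n := by ring
    _ ≤ j * N.n * N.n := Nat.mul_le_mul_right _ (Nat.mul_le_mul_right _ he)

theorem Bounded.digit_lt {val : ℕ → ℕ} (h : N.Bounded val) {e : ℕ} (he : e < N.m) :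
    e * N.n * N.n + val e < N.base := Nat.lt_succ_of_le (h.digit_le he)

theorem encTo_mod {val : ℕ → ℕ} (h : N.Bounded val) {j : ℕ} (hj : j < N.m) (hv : val j ≠ 0) :
    N.encTo val (j + 1) % N.base = j * N.n * N.n + val j := by
  rw [encTo, if_neg hv, mul_comm, Nat.mul_add_mod, Nat.mod_eq_of_lt (h.digit_lt hj)]

theorem encTo_div {val : ℕ → ℕ} (h : N.Bounded val) {j : ℕ} (hj : j < N.m) (hv : val j ≠ 0) :
    N.encTo val (j + 1) / N.base = N.encTo val j := by
  rw [encTo, if_neg hv, mul_comm, Nat.mul_add_div (by rw [base]; omega),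
    Nat.div_eq_of_lt (h.digit_lt hj), add_zero]

/-- A nonzero numeral ends with the last nonzero entry. -/
theorem exists_last {val : ℕ → ℕ} {j : ℕ} (h : N.encTo val j ≠ 0) :
    ∃ i < j, val i ≠ 0 ∧ N.encTo val j = N.encTo val (i + 1) ∧ ∀ e < j, i < e → val e = 0 := by
  induction j with
  | zero => simp [encTo] at h
  | succ j ih =>
    by_cases hv : val j = 0
    · have heq : N.encTo val (j + 1) = N.encTo val j := by rw [encTo, if_pos hv]
      rw [heq] at h ⊢
      obtain ⟨i, h1, h2, h3, h4⟩ := ih h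
      refine ⟨i, by omega, h2, h3, fun e he hie => ?_⟩
      rcases Nat.lt_succ_iff_lt_or_eq.1 he with he | rfl
      · exact h4 e he hie
      · exact hv
    · exact ⟨j, by omega, hv, rfl, fun e he hie => by omega⟩

theorem encTo_eq_zero {val : ℕ → ℕ} {j : ℕ} (h : N.encTo val j = 0) : ∀ e < j, val e = 0 := by
  induction j with
  | zero => simp
  | succ j ih =>
    intro e he
    rw [encTo] at h
    split_ifs at h with hv
    · rcases Nat.lt_succ_iff_lt_or_eq.1 he with he | rfl
      · exact ih h e he
      · exact hv
    · omega

/-- Digits that belong to the edge `e` lie in the interval from `e n² + 1` to `(e + 1) n²`. These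
intervals are disjoint, so the last digit reveals the last nonzero entry and its edge; zero entries
need no digit. -/
theorem encTo_inj {val val' : ℕ → ℕ} (h : N.Bounded val) (h' : N.Bounded val') {j : ℕ}
    (hj : j ≤ N.m) (heq : N.encTo val j = N.encTo val' j) : ∀ e < j, val e = val' e := by
  -- If the entry `i` is zero, the last digit belongs to a smaller edge and is at most `i n²`, which
  -- is too small to match.
  have mixed : ∀ {u u' : ℕ → ℕ}, N.Bounded u → N.Bounded u' → ∀ {i : ℕ}, i < N.m → u i = 0 →
      u' i ≠ 0 → N.encTo u (i + 1) ≠ N.encTo u' (i + 1) := by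
    intro u u' hu hu' i hi h0 hne heq
    have hr := encTo_mod hu' hi hne
    rw [← heq, encTo, if_pos h0] at hr
    have hnz : N.encTo u i ≠ 0 := fun h => by rw [h, Nat.zero_mod] at hr; omega
    obtain ⟨l, hl, hul, hle, -⟩ := exists_last hnz
    rw [hle, encTo_mod hu (by omega) hul] at hr
    have := hu.digit_le hl
    omega
  induction j with
  | zero => simp
  | succ j ih =>
    have hj' : j < N.m := hj
    intro e he
    by_cases hv : val j = 0
    · by_cases hv' : val' j = 0
      · rcases Nat.lt_succ_iff_lt_or_eq.1 he with he | rfl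
        · refine ih hj'.le ?_ e he
          rwa [encTo, encTo, if_pos hv, if_pos hv'] at heq
        · rw [hv, hv']
      · exact absurd heq (mixed h h' hj' hv hv')
    · by_cases hv' : val' j = 0
      · exact absurd heq.symm (mixed h' h hj' hv' hv)
      · rcases Nat.lt_succ_iff_lt_or_eq.1 he with he | rfl
        · refine ih hj'.le ?_ e he
          rw [← encTo_div h hj' hv, heq, encTo_div h' hj' hv']
        · have h1 := encTo_mod h hj' hv
          rw [heq, encTo_mod h' hj' hv'] at h1
          omega

theorem enc_inj {val val' : ℕ → ℕ} (h : N.Bounded val) (h' : N.Bounded val')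
    (heq : N.enc val = N.enc val') : val = val' := by
  funext e
  rcases lt_or_ge e N.m with he | he
  · exact encTo_inj h h' le_rfl heq e he
  · rw [h.out e he, h'.out e he]

theorem enc_zero : N.enc 0 = 0 := by
  have : ∀ j, N.encTo 0 j = 0 := by
    intro j
    induction j with
    | zero => rfl
    | succ j ih => rw [encTo, if_pos (by rfl), ih]
  exact this _

theorem Bounded.zero : N.Bounded 0 := ⟨fun _ => Nat.zero_le _, fun _ _ => rfl⟩

theorem encTo_lt {val : ℕ → ℕ} (h : N.Bounded val) {j : ℕ} (hj : j ≤ N.m) :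
    N.encTo val j < N.base ^ ((Finset.range j).filter fun e => val e ≠ 0).card := by
  induction j with
  | zero => simp [encTo]
  | succ j ih =>
    rw [encTo, Finset.range_add_one, Finset.filter_insert]
    have ih' := ih (by omega)
    split_ifs with hv h2
    · exact absurd hv h2
    · exact ih'
    · rw [Finset.card_insert_of_notMem (by simp), pow_succ]
      have := h.digit_lt (show j < N.m by omega)
      calc N.encTo val j * N.base + (j * N.n * N.n + val j) < N.encTo val j * N.base + N.base := by
            omega
        _ = (N.encTo val j + 1) * N.base := by ring
        _ ≤ _ := Nat.mul_le_mul_right _ ih'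

theorem encTo_mono {val : ℕ → ℕ} {i j : ℕ} (h : i ≤ j) : N.encTo val i ≤ N.encTo val j := by
  induction j, h using Nat.le_induction with
  | base => exact le_rfl
  | succ j _ ih =>
    refine ih.trans ?_
    rw [encTo]
    split_ifs
    · exact le_rfl
    · exact (Nat.le_mul_of_pos_right _ (by rw [base]; omega)).trans (Nat.le_add_right _ _)

end Net
end Upward

namespace Upward
namespace Net
variable {N : Net} {k : ℕ}

/-! ### Counting the states and the steps -/

theorem Valid.m_pos (hN : N.Valid k) : 0 < N.m := by
  obtain ⟨e, he, -⟩ := hN.sink N.s hN.s_lt hN.s_ne_t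
  omega

/-- The number of edges entering `v`. -/
def indeg (N : Net) (v : ℕ) : ℕ := ((Finset.range N.m).filter fun e => N.hd e = v).card

/-- The number of edges leaving `v`. -/
def outdeg (N : Net) (v : ℕ) : ℕ := ((Finset.range N.m).filter fun e => N.tl e = v).card

theorem choices_eq (v : ℕ) : N.choices v = N.n ^ N.outdeg v := pw_eq _

/-- The vertices from which `v` can be reached form a closed set, and by acyclicity every edge out
of `v` leaves it. -/
theorem Valid.outdeg_le (hN : N.Valid k) (v : ℕ) : N.outdeg v ≤ k := by
  classical
  obtain ⟨h, hh⟩ := hN.acyclic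
  let R : ℕ → ℕ → Prop := fun a b => ∃ e < N.m, N.tl e = a ∧ N.hd e = b
  have hR : ∀ a b, Relation.ReflTransGen R a b → h a ≤ h b := by
    intro a b hab
    induction hab with
    | refl => exact le_rfl
    | tail _ hbc ih =>
      obtain ⟨e, he, rfl, rfl⟩ := hbc
      exact ih.trans (hh e he).le
  have := hN.cut ((Finset.range N.n).filter fun u => Relation.ReflTransGen R u v) (by
    intro e he hc
    simp only [Finset.mem_filter, Finset.mem_range] at hc ⊢
    exact ⟨hN.tl_lt e he, .head ⟨e, he, rfl, rfl⟩ hc.2⟩)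
  refine (Finset.card_le_card ?_).trans this
  intro e he
  simp only [Finset.mem_filter, Finset.mem_range] at he ⊢
  refine ⟨he.1, ⟨hN.tl_lt e he.1, by rw [he.2]⟩, fun hc => ?_⟩
  have h1 := hR _ _ hc.2
  have h2 := hh e he.1
  rw [he.2] at h2
  omega

theorem Valid.m_le (hN : N.Valid k) : N.m ≤ N.n * k := by
  have := Finset.card_le_mul_card_image_of_maps_to (s := Finset.range N.m) (t := Finset.range N.n)
    (f := N.tl) (fun e he => Finset.mem_range.2 (hN.tl_lt e (Finset.mem_range.1 he))) k
    (fun v _ => hN.outdeg_le v)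
  simpa [mul_comm] using this

theorem Valid.k_pos (hN : N.Valid k) : 0 < k := by
  have := hN.m_le
  have := hN.m_pos
  rcases Nat.eq_zero_or_pos k with rfl | h
  · omega
  · exact h

theorem Valid.choices_le (hN : N.Valid k) (v : ℕ) : N.choices v ≤ N.n ^ k := by
  rw [choices_eq]
  exact Nat.pow_le_pow_right (by have := hN.two_le; omega) (hN.outdeg_le v)

/-- The active edges are exactly those leaving the set of placed vertices. -/
theorem Inv.supp_le (hN : N.Valid k) {ws : List ℕ} {val : ℕ → ℕ} (h : Inv N ws val) :
    ((Finset.range N.m).filter fun e => val e ≠ 0).card ≤ k := by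
  have := hN.cut ws.toFinset (fun e he hc => by
    rw [List.mem_toFinset] at hc ⊢
    exact (h.order e he hc).1)
  refine (Finset.card_le_card fun e he => ?_).trans this
  simp only [Finset.mem_filter, Finset.mem_range, List.mem_toFinset] at he ⊢
  exact ⟨he.1, (h.supp e he.1).1 he.2⟩

/-- No `Good` is assumed: the program also computes the code of a candidate that fails the tests,
and this number has to fit in a word. -/
theorem Inv.next_supp_le (hN : N.Valid k) {ws : List ℕ} {val : ℕ → ℕ} (h : Inv N ws val)
    (hl : ws.length < N.n) {v : ℕ} (hv : N.Adm val v) (x : ℕ) :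
    ((Finset.range N.m).filter fun e => N.next val v x e ≠ 0).card ≤ k := by
  have := hN.cut (ws ++ [v]).toFinset (fun e he hc => by
    rw [List.mem_toFinset] at hc ⊢
    rcases List.mem_append.1 hc with hc | hc
    · exact List.mem_append_left _ (h.order e he hc).1
    · exact List.mem_append_left _ (h.tl_mem hv he (List.mem_singleton.1 hc)))
  refine (Finset.card_le_card fun e he => ?_).trans this
  simp only [Finset.mem_filter, Finset.mem_range] at he
  simp only [Finset.mem_filter, Finset.mem_range, List.mem_toFinset]
  exact ⟨he.1, (h.next_ne_zero_iff hN hl hv he.1).1 he.2⟩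

theorem Inv.next_bounded (hN : N.Valid k) {ws : List ℕ} {val : ℕ → ℕ} (h : Inv N ws val)
    (hl : ws.length < N.n) (v x : ℕ) : N.Bounded (N.next val v x) := by
  refine ⟨fun e => ?_, fun e he => by rw [Net.next, if_neg (by omega)]⟩
  rw [Net.next]
  split_ifs
  · exact Nat.zero_le _
  · rw [h.pos_eq hN hl]
    have : N.digit v x e < N.n := Nat.mod_lt _ (by omega)
    calc ws.length * N.n + N.digit v x e + 1 ≤ ws.length * N.n + N.n := by omega
      _ = (ws.length + 1) * N.n := by ring
      _ ≤ N.n * N.n := Nat.mul_le_mul_right _ hl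
  · exact h.bounded.le e
  · exact Nat.zero_le _

theorem enc_lt {val : ℕ → ℕ} (h : N.Bounded val)
    (hk : ((Finset.range N.m).filter fun e => val e ≠ 0).card ≤ k) : N.enc val < N.base ^ k :=
  (encTo_lt h le_rfl).trans_le (Nat.pow_le_pow_right (by rw [base]; omega) hk)

theorem finite_states (hN : N.Valid k) : {val | ∃ ws, N.Reach ws val}.Finite := by
  refine Set.Finite.of_finite_image (f := N.enc) ((Set.finite_lt_nat (N.base ^ k)).subset ?_) ?_
  · rintro _ ⟨val, ⟨ws, h⟩, rfl⟩
    have hi := h.inv hN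
    exact enc_lt hi.bounded (hi.supp_le hN)
  · rintro val ⟨ws, h⟩ val' ⟨ws', h'⟩ heq
    exact enc_inj (h.inv hN).bounded (h'.inv hN).bounded heq

/-- The set of reachable states. -/
noncomputable def states (hN : N.Valid k) : Finset (ℕ → ℕ) := (finite_states hN).toFinset

theorem mem_states {hN : N.Valid k} {val : ℕ → ℕ} : val ∈ states hN ↔ ∃ ws, N.Reach ws val := by
  simp [states]

theorem exists_reach_lt (hN : N.Valid k) {val : ℕ → ℕ} (h : val ∈ states hN) :
    ∃ ws, ws.length < N.n ∧ N.Reach ws val := by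
  obtain ⟨ws, h⟩ := mem_states.1 h
  rcases lt_or_ge ws.length N.n with hl | hl
  · exact ⟨ws, hl, h⟩
  · have h0 := (h.inv hN).eq_zero_of_full hN hl
    subst h0
    exact ⟨[], by have := hN.two_le; simp; omega, .nil⟩

open Classical in
/-- The number of choices to be tried in a state. -/
noncomputable def trials (N : Net) (val : ℕ → ℕ) : ℕ :=
  ∑ v ∈ Finset.range N.n, if N.Adm val v then N.choices v else 0

theorem trials_of_adm {val : ℕ → ℕ} {v : ℕ} (hv : N.Adm val v) : N.trials val = N.choices v := by
  classical
  rw [trials, Finset.sum_eq_single v]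
  · rw [if_pos hv]
  · intro u _ hu
    rw [if_neg fun h => hu (h.unique hv)]
  · intro h
    exact absurd (Finset.mem_range.2 hv.lt) h

theorem Valid.sq_le_base (hN : N.Valid k) : N.n ^ 2 ≤ N.base := by
  have := hN.m_pos
  rw [base, pow_two]
  calc N.n * N.n = 1 * N.n * N.n := by ring
    _ ≤ N.m * N.n * N.n := Nat.mul_le_mul_right _ (Nat.mul_le_mul_right _ this)
    _ ≤ _ := Nat.le_succ _

-- Let `r` be the larger of the two degrees of `v`. Neither the edges entering `v` (before the step)
-- nor those leaving it (after the step) let the total exceed `k`, so at most `k - r` other edges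
-- are active. These are given by their code, below `B^(k-r)`. For the entering edges the tail
-- positions suffice, since their common head position is the next position. With the choices this
-- makes `B^(k-r) n^(2r)`, and `n² ≤ B` trades all but one factor `n²` for factors `B`.
open Classical in
theorem card_adm_mul_choices_le (hN : N.Valid k) {v : ℕ} (hvn : v < N.n) :
    ((states hN).filter fun val => N.Adm val v).card * N.choices v ≤
      N.n ^ 2 * N.base ^ (k - 1) := by
  have hn : 0 < N.n := by omega
  rcases ((states hN).filter fun val => N.Adm val v).eq_empty_or_nonempty with hem | hne
  · rw [hem]; simp
  set r := max (N.indeg v) (N.outdeg v) with hr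
  set rem : (ℕ → ℕ) → ℕ → ℕ := fun val e => if N.hd e = v then 0 else val e with hrem
  have hB : 0 < N.base := by rw [base]; omega
  have hfacts : ∀ val, val ∈ (states hN).filter (fun val => N.Adm val v) →
      ∃ ws, ws.length < N.n ∧ Inv N ws val ∧ N.Adm val v := by
    intro val hval
    rw [Finset.mem_filter] at hval
    obtain ⟨ws, hl, h⟩ := exists_reach_lt hN hval.1
    exact ⟨ws, hl, h.inv hN, hval.2⟩
  have hrb : ∀ val, N.Bounded val → N.Bounded (rem val) := by
    intro val h
    refine ⟨fun e => ?_, fun e he => ?_⟩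
    · simp only [hrem]; split_ifs
      · exact Nat.zero_le _
      · exact h.le e
    · simp only [hrem]; split_ifs
      · rfl
      · exact h.out e he
  have hin : ∀ val ws, ws.length < N.n → Inv N ws val → N.Adm val v →
      ((Finset.range N.m).filter fun e => rem val e ≠ 0).card + N.indeg v ≤ k := by
    intro val ws hl h hv
    rw [indeg, ← Finset.card_union_of_disjoint]
    · refine (Finset.card_le_card ?_).trans (h.supp_le hN)
      intro e he
      simp only [Finset.mem_union, Finset.mem_filter, Finset.mem_range, hrem] at he ⊢
      rcases he with ⟨h1, h2⟩ | ⟨h1, h2⟩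
      · split_ifs at h2 with h3
        · exact absurd rfl h2
        · exact ⟨h1, h2⟩
      · exact ⟨h1, ((hv.iff e h1).1 h2).1⟩
    · rw [Finset.disjoint_left]
      intro e he he'
      simp only [Finset.mem_filter, hrem] at he he'
      simp [he'.2] at he
  have hout : ∀ val ws, ws.length < N.n → Inv N ws val → N.Adm val v →
      ((Finset.range N.m).filter fun e => rem val e ≠ 0).card + N.outdeg v ≤ k := by
    intro val ws hl h hv
    have hzero : ∀ e < N.m, N.tl e = v → val e = 0 := by
      intro e he hev
      by_contra hc
      exact h.notMem hN hl hv (hev ▸ ((h.supp e he).1 hc).1)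
    rw [outdeg, ← Finset.card_union_of_disjoint]
    -- The set of active edges after the step does not depend on the choice, so the choice `0`
    -- serves.
    · refine (Finset.card_le_card ?_).trans (h.next_supp_le hN hl hv 0)
      intro e he
      simp only [Finset.mem_union, Finset.mem_filter, Finset.mem_range, hrem] at he ⊢
      rcases he with ⟨h1, h2⟩ | ⟨h1, h2⟩
      · split_ifs at h2 with h3
        · exact absurd rfl h2
        · have h4 : N.tl e ≠ v := fun h4 => h2 (hzero e h1 h4)
          refine ⟨h1, ?_⟩
          rw [Net.next, if_pos h1, if_neg h3, if_neg h4]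
          exact h2
      · have h3 : N.hd e ≠ v := fun h3 => Inv.tl_ne_hd hN h1 (h2.trans h3.symm)
        refine ⟨h1, ?_⟩
        rw [Net.next, if_pos h1, if_neg h3, if_pos h2]
        omega
    · rw [Finset.disjoint_left]
      intro e he he'
      simp only [Finset.mem_filter, Finset.mem_range, hrem] at he he'
      simp [hzero e he'.1 he'.2] at he
  have hrk : r ≤ k := by
    obtain ⟨val, hval⟩ := hne
    obtain ⟨ws, hl, h, hv⟩ := hfacts val hval
    have := hin val ws hl h hv
    have := hout val ws hl h hv
    omega
  have hr1 : 1 ≤ r := by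
    by_cases hvt : v = N.t
    · have hvs : v ≠ N.s := fun h => hN.s_ne_t (h ▸ hvt)
      obtain ⟨e, he, hev⟩ := hN.source v hvn hvs
      have : 0 < N.indeg v := Finset.card_pos.2 ⟨e, by simp [he, hev]⟩
      omega
    · obtain ⟨e, he, hev⟩ := hN.sink v hvn hvt
      have : 0 < N.outdeg v := Finset.card_pos.2 ⟨e, by simp [he, hev]⟩
      omega
  -- The number `y` packs the tail positions of the edges entering `v` into base-`n` digits.
  have hpd : ∀ val : ℕ → ℕ, ∃ y < pw N.n (fun e => N.hd e = v) N.m, ∀ e < N.m, N.hd e = v →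
      y / pw N.n (fun e => N.hd e = v) e % N.n = (val e - 1) / N.n % N.n := fun val =>
    exists_digits hn (fun e => (val e - 1) / N.n % N.n) (fun _ _ => Nat.mod_lt _ hn) N.m
  choose y hy hyd using hpd
  have hcard : ((states hN).filter fun val => N.Adm val v).card ≤
      N.base ^ (k - r) * N.n ^ N.indeg v := by
    have hmaps : ((states hN).filter fun val => N.Adm val v).card ≤
        (Finset.range (N.base ^ (k - r)) ×ˢ
          Finset.range (pw N.n (fun e => N.hd e = v) N.m)).card := by
      refine Finset.card_le_card_of_injOn (fun val => (N.enc (rem val), y val)) ?_ ?_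
      · intro val hval
        obtain ⟨ws, hl, h, hv⟩ := hfacts val hval
        have h1 := hin val ws hl h hv
        have h2 := hout val ws hl h hv
        simp only [Finset.coe_product, Finset.coe_range, Set.mem_prod, Set.mem_Iio]
        exact ⟨enc_lt (hrb val h.bounded) (by omega), hy val⟩
      · intro val₁ hval₁ val₂ hval₂ heq
        obtain ⟨ws₁, hl₁, h₁, hv₁⟩ := hfacts val₁ hval₁
        obtain ⟨ws₂, hl₂, h₂, hv₂⟩ := hfacts val₂ hval₂
        simp only [Prod.mk.injEq] at heq
        obtain ⟨e1, e2⟩ := heq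
        have e3 := enc_inj (hrb _ h₁.bounded) (hrb _ h₂.bounded) e1
        have hsame : ∀ e, N.hd e ≠ v → val₁ e = val₂ e := by
          intro e he
          have := congrFun e3 e
          simpa [hrem, he] using this
        have hquot : ∀ {val ws}, ws.length < N.n → Inv N ws val → ∀ e < N.m, val e ≠ 0 →
            (val e - 1) / N.n < N.n := by
          intro val ws hl h e he hne
          rw [h.div he hne]
          exact (List.idxOf_lt_length_iff.2 ((h.supp e he).1 hne).1).trans hl
        have hdiv : ∀ e < N.m, N.hd e = v → (val₁ e - 1) / N.n = (val₂ e - 1) / N.n := by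
          intro e he hev
          have d1 := hyd val₁ e he hev
          have d2 := hyd val₂ e he hev
          rw [Nat.mod_eq_of_lt (hquot hl₁ h₁ e he ((hv₁.iff e he).1 hev).1)] at d1
          rw [Nat.mod_eq_of_lt (hquot hl₂ h₂ e he ((hv₂.iff e he).1 hev).1)] at d2
          rw [← d1, ← d2, e2]
        -- The next position is computed from tail positions alone. Hence it is recovered from the
        -- pair, and with it the head positions of the due edges.
        have hposle : ∀ {u u' : ℕ → ℕ}, (∀ e, N.hd e ≠ v → u e = u' e) → N.Adm u' v →
            (∀ e < N.m, N.hd e = v → (u e - 1) / N.n = (u' e - 1) / N.n) → N.pos u ≤ N.pos u' := by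
          intro u u' hs ha hd
          refine posTo_le_iff.2 fun e he hne => ?_
          by_cases hev : N.hd e = v
          · rw [hd e he hev]
            exact le_pos he ((ha.iff e he).1 hev).1
          · rw [hs e hev] at hne ⊢
            exact le_pos he hne
        have hpos : N.pos val₁ = N.pos val₂ := le_antisymm (hposle hsame hv₂ hdiv)
          (hposle (fun e he => (hsame e he).symm) hv₁ fun e he hev => (hdiv e he hev).symm)
        funext e
        by_cases hev : N.hd e = v
        · rcases lt_or_ge e N.m with he | he
          · have q1 := (hv₁.iff e he).1 hev
            have q2 := (hv₂.iff e he).1 hev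
            have q3 := Nat.div_add_mod (val₁ e - 1) N.n
            have q4 := Nat.div_add_mod (val₂ e - 1) N.n
            rw [q1.2, hdiv e he hev, hpos] at q3
            rw [q2.2] at q4
            omega
          · rw [h₁.out e he, h₂.out e he]
        · exact hsame e hev
    rwa [Finset.card_product, Finset.card_range, Finset.card_range, pw_eq] at hmaps
  calc ((states hN).filter fun val => N.Adm val v).card * N.choices v
      ≤ N.base ^ (k - r) * N.n ^ N.indeg v * N.n ^ N.outdeg v := by
        rw [choices_eq]; exact Nat.mul_le_mul_right _ hcard
    _ ≤ N.base ^ (k - r) * N.n ^ r * N.n ^ r := by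
        gcongr
        · exact le_max_left _ _
        · exact le_max_right _ _
    _ = N.n ^ 2 * ((N.n ^ 2) ^ (r - 1) * N.base ^ (k - r)) := by
        obtain ⟨q, hq⟩ : ∃ q, r = q + 1 := ⟨r - 1, by omega⟩
        rw [hq, Nat.add_sub_cancel]; ring
    _ ≤ N.n ^ 2 * (N.base ^ (r - 1) * N.base ^ (k - r)) := by
        gcongr
        exact hN.sq_le_base
    _ = N.n ^ 2 * N.base ^ (k - 1) := by
        rw [← pow_add]; congr 2; omega

theorem sum_trials_le (hN : N.Valid k) :
    ∑ val ∈ states hN, N.trials val ≤ N.n ^ 3 * N.base ^ (k - 1) := by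
  classical
  simp only [trials]
  rw [Finset.sum_comm]
  calc ∑ v ∈ Finset.range N.n, ∑ val ∈ states hN, (if N.Adm val v then N.choices v else 0)
      ≤ ∑ v ∈ Finset.range N.n, N.n ^ 2 * N.base ^ (k - 1) := by
        refine Finset.sum_le_sum fun v hv => ?_
        rw [← Finset.sum_filter, Finset.sum_const, smul_eq_mul]
        exact card_adm_mul_choices_le hN (Finset.mem_range.1 hv)
    _ = _ := by rw [Finset.sum_const, Finset.card_range, smul_eq_mul]; ring

/-- Every state except the initial one is the result of some trial. -/
theorem card_states_le (hN : N.Valid k) :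
    (states hN).card ≤ 1 + ∑ val ∈ states hN, N.trials val := by
  classical
  have hsub : states hN ⊆ {0} ∪ (states hN).biUnion fun val => (Finset.range N.n).biUnion fun v =>
      if N.Adm val v then (Finset.range (N.choices v)).image (N.next val v) else ∅ := by
    intro val' h
    obtain ⟨ws, h⟩ := mem_states.1 h
    cases h with
    | nil => simp
    | @snoc ws val v _ hr hl ht =>
      refine Finset.mem_union_right _ (Finset.mem_biUnion.2 ⟨val, mem_states.2 ⟨ws, hr⟩, ?_⟩)
      obtain ⟨hv, x, hx, -, rfl⟩ := ht
      refine Finset.mem_biUnion.2 ⟨v, Finset.mem_range.2 hv.lt, ?_⟩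
      rw [if_pos hv]
      exact Finset.mem_image_of_mem _ (Finset.mem_range.2 hx)
  refine (Finset.card_le_card hsub).trans ((Finset.card_union_le _ _).trans ?_)
  refine Nat.add_le_add (by simp) (Finset.card_biUnion_le.trans (Finset.sum_le_sum fun val _ => ?_))
  refine Finset.card_biUnion_le.trans (Finset.sum_le_sum fun v _ => ?_)
  split_ifs
  · exact Finset.card_image_le.trans (by simp)
  · simp

/-- The factor `2` comes from an acyclic digraph having at most half of all ordered pairs as edges;
its powers later pay for a factor `k` in the running time. -/
theorem Valid.two_mul_base_le (hN : N.Valid k) : 2 * N.base ≤ N.n ^ 4 := by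
  have h1 := hN.size
  have h2 := hN.two_le
  rw [base]
  have h3 : 2 ≤ N.n * N.n * N.n := by nlinarith [Nat.mul_le_mul h2 h2]
  calc 2 * (N.m * N.n * N.n + 1) = 2 * N.m * (N.n * N.n) + 2 := by ring
    _ ≤ 2 * N.m * (N.n * N.n) + N.n * N.n * N.n := by omega
    _ = (2 * N.m + N.n) * (N.n * N.n) := by ring
    _ ≤ N.n * N.n * (N.n * N.n) := Nat.mul_le_mul_right _ h1
    _ = N.n ^ 4 := by ring

end Net
end Upward

namespace Upward
open RealRAM

/-! ### The program -/

-- Word arrays `0`, `1` and `2` hold the input. Scalars occupy entry `0` of an array of their own.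
notation "w_i" => 3
notation "w_j" => 4
notation "w_r" => 5
notation "w_id" => 6
notation "w_mark" => 7
notation "w_s" => 8
notation "w_queue" => 9
notation "w_qh" => 10
notation "w_qt" => 11
notation "w_rc" => 12
notation "w_c" => 13
notation "w_y" => 14
notation "w_val" => 15
notation "w_pos" => 16
notation "w_v" => 17
notation "w_adm" => 18
notation "w_nd" => 19
notation "w_x" => 20
notation "w_z" => 21
notation "w_nv" => 22
notation "w_e" => 23
notation "w_g" => 24
notation "w_d" => 25
notation "w_ok" => 26
notation "w_src" => 27
notation "w_vert" => 28
notation "w_next" => 29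
notation "w_head" => 30
notation "w_pend" => 31
notation "w_stack" => 32
notation "w_place" => 33
notation "w_f" => 34

namespace Prog
open WExpr Stmt

abbrev nE : WExpr := .get 0 (.const 0)
abbrev mE : WExpr := .get 0 (.const 1)
abbrev tlE (e : WExpr) : WExpr := .get 1 e
abbrev hdE (e : WExpr) : WExpr := .get 2 e
abbrev baseE : WExpr := .add (.mul (.mul mE nE) nE) (.const 1)
-- With truncated subtraction, `a + (b - a)` is the maximum and `a - (a - b)` the minimum.
abbrev maxE (a b : WExpr) : WExpr := .add a (.sub b a)
abbrev minE (a b : WExpr) : WExpr := .sub a (.sub a b)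
abbrev orC (c d : Cond) : Cond := .not (.and (.not c) (.not d))
abbrev nzC (e : WExpr) : Cond := .not (.weq e (.const 0))
/-- Tail position of an entry. -/
abbrev lowE (u : WExpr) : WExpr := .div (.sub u (.const 1)) nE
/-- Head position of an entry. -/
abbrev highE (u : WExpr) : WExpr := .mod (.sub u (.const 1)) nE

/-- The abscissa at height `y` on the line through the sorted points `a` and `b`. -/
abbrev lineE (a b j : WExpr) : RExpr :=
  .add (.get 2 a) (.div (.mul (.sub (.get 3 j) (.get 3 a)) (.sub (.get 2 b) (.get 2 a)))
    (.sub (.get 3 b) (.get 3 a)))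

abbrev leftC (a b a' b' : WExpr) : Cond :=
  .and (orC (.rlt (lineE a b (maxE a a')) (lineE a' b' (maxE a a'))) (.weq a a'))
    (.and (orC (.rlt (lineE a b (minE b b')) (lineE a' b' (minE b b'))) (.weq b b'))
      (.not (.and (.weq a a') (.weq b b'))))

/-- Compatibility of the entries `u` and `u'`. -/
abbrev cmpC (u u' : WExpr) : Cond :=
  orC (leftC (lowE u) (highE u) (lowE u') (highE u')) (leftC (lowE u') (highE u') (lowE u) (highE u))

/-- Sorts the points by height. -/
def sort : Stmt :=
  .forLoop w_i nE <|
    .seq (.setVar w_r (.const 0)) <|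
    .seq (.forLoop w_j nE
      (.ite (.rlt (.get 1 (.var w_j)) (.get 1 (.var w_i)))
        (.setVar w_r (.add (.var w_r) (.const 1))) .skip)) <|
    .seq (.wset w_id (.var w_r) (.var w_i)) <|
    .seq (.rset 2 (.var w_r) (.get 0 (.var w_i)))
      (.rset 3 (.var w_r) (.get 1 (.var w_i)))

/-- Finds the source. -/
def findSource : Stmt :=
  .seq (.forLoop w_e mE (.wset w_mark (hdE (.var w_e)) (.const 1)))
    (.forLoop w_i nE (.ite (.weq (.get w_mark (.var w_i)) (.const 0)) (.setVar w_s (.var w_i)) .skip))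

/-- Decodes the current state. -/
def decode : Stmt :=
  .seq (.forLoop w_e mE (.wset w_val (.var w_e) (.const 0))) <|
  .seq (.setVar w_y (.var w_c)) <|
    .loop (.wlt (.const 0) (.var w_y)) <|
      -- A digit is `e n² + u` with `1 ≤ u ≤ n²`; after subtracting `1`, quotient and remainder
      -- modulo `n²` separate the edge from its entry.
      .seq (.wset w_val (.div (.sub (.mod (.var w_y) baseE) (.const 1)) (.mul nE nE))
        (.add (.mod (.sub (.mod (.var w_y) baseE) (.const 1)) (.mul nE nE)) (.const 1)))
      (.setVar w_y (.div (.var w_y) baseE))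

/-- Computes the next position. -/
def findPos : Stmt :=
  .seq (.setVar w_pos (.const 0)) <|
    .forLoop w_e mE (.ite (.weq (.get w_val (.var w_e)) (.const 0)) .skip
      (.setVar w_pos (maxE (.var w_pos) (.add (lowE (.get w_val (.var w_e))) (.const 1)))))

/-- The edge `e` ends at the next position. -/
abbrev dueC : Cond :=
  .and (nzC (.get w_val (.var w_e))) (.weq (highE (.get w_val (.var w_e))) (.var w_pos))

/-- Finds the next vertex. -/
def findVertex : Stmt :=
  -- Code `0` is the initial state, where the source comes next. Otherwise the default `n` is no
  -- vertex and will be rejected.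
  .seq (.ite (.weq (.var w_c) (.const 0)) (.setVar w_v (.var w_s)) (.setVar w_v nE)) <|
    .forLoop w_e mE (.ite dueC (.setVar w_v (hdE (.var w_e))) .skip)

/-- Checks the next vertex and counts the choices for its outgoing edges. -/
def checkVertex : Stmt :=
  .seq (.ite (.wlt (.var w_v) nE) (.setVar w_adm (.const 1)) (.setVar w_adm (.const 0))) <|
  .seq (.setVar w_nd (.const 1)) <|
    .forLoop w_e mE <|
      .seq (.ite (orC (.and (.weq (hdE (.var w_e)) (.var w_v)) (.not dueC))
          (.and (.not (.weq (hdE (.var w_e)) (.var w_v))) dueC))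
        (.setVar w_adm (.const 0)) .skip)
      (.ite (.weq (tlE (.var w_e)) (.var w_v)) (.setVar w_nd (.mul (.var w_nd) nE)) .skip)

/-- Builds the next state for the choice `x`. -/
def build : Stmt :=
  .forLoop w_e mE <|
    .ite (.weq (hdE (.var w_e)) (.var w_v)) (.wset w_nv (.var w_e) (.const 0)) <|
    .ite (.weq (tlE (.var w_e)) (.var w_v))
      (.seq (.wset w_nv (.var w_e)
          (.add (.add (.mul (.var w_pos) nE) (.mod (.var w_z) nE)) (.const 1))) <|
        .seq (.ite (.wlt (.var w_pos) (.mod (.var w_z) nE)) .skip (.setVar w_ok (.const 0)))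
          (.setVar w_z (.div (.var w_z) nE)))
      (.wset w_nv (.var w_e) (.get w_val (.var w_e)))

/-- Checks the new edge `e` against all edges. -/
def checkEdge : Stmt :=
  .forLoop w_g mE <|
    .ite (.and (.not (.weq (.var w_g) (.var w_e))) (.and (nzC (.get w_nv (.var w_g)))
        (.not (cmpC (.get w_nv (.var w_e)) (.get w_nv (.var w_g))))))
      (.setVar w_ok (.const 0)) .skip

/-- Checks the new edges. -/
def checkEdges : Stmt :=
  .forLoop w_e mE (.ite (.weq (tlE (.var w_e)) (.var w_v)) checkEdge .skip)

/-- Encodes the next state. -/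
def encode : Stmt :=
  .seq (.setVar w_d (.const 0)) <|
    .forLoop w_e mE <|
      .ite (.weq (.get w_nv (.var w_e)) (.const 0)) .skip
        (.setVar w_d (.add (.mul (.var w_d) baseE)
          (.add (.mul (.mul (.var w_e) nE) nE) (.get w_nv (.var w_e)))))

/-- Computes the next state for the choice `x`. -/
def tryChoice : Stmt :=
  .seq (.setVar w_ok (.const 1)) <|
  .seq (.setVar w_z (.var w_x)) <|
  .seq build <| .seq checkEdges encode

/-- Records a step. -/
def record : Stmt :=
  .seq (.wset w_src (.var w_rc) (.var w_c)) <|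
  .seq (.wset w_vert (.var w_rc) (.var w_v)) <|
  .seq (.wset w_next (.var w_rc) (.get w_head (.var w_d))) <|
  -- A state enters the queue with its first record. The zero state is excluded because it has been
  -- in the queue from the beginning.
  .seq (.ite (.and (.weq (.get w_head (.var w_d)) (.const 0)) (nzC (.var w_d)))
    (.seq (.wset w_queue (.var w_qt) (.var w_d))
      (.setVar w_qt (.add (.var w_qt) (.const 1)))) .skip) <|
  .seq (.wset w_head (.var w_d) (.var w_rc))
    (.setVar w_rc (.add (.var w_rc) (.const 1)))

/-- Prepares the processing of the first state in the queue. -/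
def prepare : Stmt :=
  .seq (.setVar w_c (.get w_queue (.var w_qh))) <|
  .seq (.setVar w_qh (.add (.var w_qh) (.const 1))) <|
  .seq decode <| .seq findPos <| .seq findVertex checkVertex

/-- Tries all choices. -/
def tryAll : Stmt :=
  .forLoop w_x (.var w_nd) (.seq tryChoice (.ite (nzC (.var w_ok)) record .skip))

/-- Explores all reachable states. -/
def explore : Stmt :=
  .seq (.setVar w_qt (.const 1)) <|
  -- Records are numbered from `1`, so that `0` can end a linked list.
  .seq (.setVar w_rc (.const 1)) <|
    .loop (.wlt (.var w_qh) (.var w_qt)) <|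
      .seq prepare (.ite (nzC (.var w_adm)) tryAll .skip)

/-- Finds the lowest position with an untried alternative. -/
def find : Stmt :=
  .seq (.setVar w_f (.const 0)) <|
    .loop (.and (.wlt (.var w_f) nE) (.weq (.get w_pend (.var w_f)) (.const 0)))
      (.setVar w_f (.add (.var w_f) (.const 1)))

/-- Takes this alternative and descends to position `0`. -/
def descend : Stmt :=
  -- The loop decrements first, so starting one higher lets it process position `0` as well.
  .seq (.setVar w_f (.add (.var w_f) (.const 1))) <|
    .loop (.wlt (.const 0) (.var w_f)) <|
      .seq (.setVar w_f (.sub (.var w_f) (.const 1))) <|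
      .seq (.setVar w_r (.get w_pend (.var w_f))) <|
      .seq (.wset w_pend (.var w_f) (.get w_next (.var w_r))) <|
      .seq (.wset w_stack (.var w_f) (.get w_vert (.var w_r))) <|
      .ite (.wlt (.const 0) (.var w_f))
        (.wset w_pend (.sub (.var w_f) (.const 1)) (.get w_head (.get w_src (.var w_r)))) .skip

/-- Writes out the drawing. -/
def emit : Stmt :=
  .seq (.forLoop w_i nE (.wset w_place (.get w_stack (.var w_i)) (.get w_id (.var w_i))))
    (.forLoop w_i nE (.write (.get w_place (.var w_i))))

/-- The set-up phase. -/
def setup : Stmt :=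
  .seq sort <| .seq findSource <| .seq explore <|
  -- The final state is the zero state, with code `0`, and the steps into it that end a full sweep
  -- fill position `n - 1`.
  .seq (.wset w_pend (.sub nE (.const 1)) (.get w_head (.const 0))) find

/-- The body of the enumeration loop. -/
def body : Stmt := .seq descend <| .seq emit find

/-- The program. -/
def main : Stmt := .seq setup (.loop (.wlt (.var w_f) nE) body)

end Prog

/-! ### Verification of the exploration phase -/

/-- The state holds the digraph `N` and the sorted points. -/
structure Env (N : Net) (σ : State) : Prop where
  n : σ.word 0 0 = N.n
  m : σ.word 0 1 = N.m
  tl : σ.word 1 = N.tl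
  hd : σ.word 2 = N.hd
  s : σ.word w_s 0 = N.s
  cmp : N.cmp = Compatible (σ.real 2) (σ.real 3)

theorem Env.frame {N : Net} {σ σ' : State} (h : Env N σ) {p : Stmt} (hf : Frame p σ σ')
    (hw : ∀ a ∈ [0, 1, 2, w_s], a ∉ p.wordTargets) (hr : ∀ a ∈ [2, 3], a ∉ p.realTargets) :
    Env N σ' := by
  simp only [List.mem_cons, List.not_mem_nil, or_false, forall_eq_or_imp, forall_eq] at hw hr
  obtain ⟨w0, w1, w2, w3⟩ := hw
  exact ⟨by rw [hf.word _ w0, h.n], by rw [hf.word _ w0, h.m], by rw [hf.word _ w1, h.tl],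
    by rw [hf.word _ w2, h.hd], by rw [hf.word _ w3, h.s],
    by rw [hf.real _ hr.1, hf.real _ hr.2, h.cmp]⟩

/-- The memory and the word length suffice. -/
structure Lim (N : Net) (k M U : ℕ) : Prop where
  valid : N.Valid k
  codes : N.base ^ k < M
  steps : ∑ val ∈ Net.states valid, N.trials val + 2 < M
  words : M ≤ U

namespace Lim
variable {N : Net} {k M U : ℕ} (h : Lim N k M U)
include h

theorem base_le : N.base ≤ N.base ^ k := Nat.le_self_pow h.valid.k_pos.ne' _

theorem sq_lt : N.n * N.n < M := by
  have := h.valid.sq_le_base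
  have := h.base_le
  have := h.codes
  rw [pow_two] at *
  omega

theorem n_lt : N.n < M := by
  have := h.sq_lt
  have := h.valid.two_le
  nlinarith

theorem m_lt : N.m < M := by
  have h1 := h.base_le
  have h2 := h.codes
  have h3 := h.valid.two_le
  have : N.m ≤ N.m * N.n * N.n := by
    rw [mul_assoc]; exact Nat.le_mul_of_pos_right _ (by positivity)
  rw [Net.base] at h1
  simp only [Net.base] at h1 h2
  omega

theorem choices_lt (v : ℕ) : N.choices v < M := by
  refine (h.valid.choices_le v).trans_lt (lt_of_le_of_lt ?_ h.codes)
  refine Nat.pow_le_pow_left ?_ _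
  have := h.valid.sq_le_base
  have := h.valid.two_le
  nlinarith

end Lim
end Upward

/-! ### Decoding a state and finding the next vertex -/

namespace Upward
open RealRAM Prog
variable {N : Net} {k M U : ℕ} {σ : State}

theorem max_eq (a b : ℕ) : a + (b - a) = max a b := by omega
theorem min_eq (a b : ℕ) : a - (a - b) = min a b := by omega

theorem holds_or {c d : Cond} : (orC c d).Holds σ ↔ c.Holds σ ∨ d.Holds σ := by
  simp only [Cond.Holds]; tauto

theorem eval_line {X Y : ℕ → ℝ} (hX : σ.real 2 = X) (hY : σ.real 3 = Y) (a b j : WExpr) :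
    (lineE a b j).eval σ = lineAt X Y (a.eval σ) (b.eval σ) (Y (j.eval σ)) := by
  simp only [RExpr.eval, lineAt, hX, hY]

theorem holds_left {X Y : ℕ → ℝ} (hX : σ.real 2 = X) (hY : σ.real 3 = Y) (a b a' b' : WExpr) :
    (leftC a b a' b').Holds σ ↔ LeftOf X Y (a.eval σ) (b.eval σ) (a'.eval σ) (b'.eval σ) := by
  change (orC _ _).Holds σ ∧ (orC _ _).Holds σ ∧ ¬ (_ ∧ _) ↔ _
  rw [holds_or, holds_or]
  simp only [Cond.Holds, eval_line hX hY]
  simp only [WExpr.eval, max_eq, min_eq, LeftOf]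

theorem holds_cmp (hE : Env N σ) (u u' : WExpr) :
    (cmpC u u').Holds σ ↔ N.entryCmp (u.eval σ) (u'.eval σ) := by
  rw [holds_or, holds_left rfl rfl, holds_left rfl rfl, Net.entryCmp, hE.cmp]
  simp only [WExpr.eval, hE.n, Compatible]

/-- Digits are read from the last one down. The numeral left over belongs to the entries below some
`j`, and `4 * j` bounds the remaining time: each round removes one digit and lowers `j`. -/
theorem wp_decode (hL : Lim N k M U) (hE : Env N σ) {val : ℕ → ℕ} (hb : N.Bounded val)
    (hc : σ.word w_c 0 = N.enc val) (hcU : N.enc val < U) :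
    WP M U decode (8 * N.m + 8) (fun σ' => ∀ e < N.m, σ'.word w_val e = val e) σ := by
  have hmM := hL.m_lt
  have hsq := hL.sq_lt
  have hU := hL.words
  have hn := hL.valid.two_le
  refine wp_seq (4 * N.m + 3) (by omega) (wp_for (fun j σ' => ∀ e < j, σ'.word w_val e = 0)
    (fun _ => 1) N.m (by simp; omega) (by decide) (by omega) (by omega) (by decide) ?_ (by simp) ?_ ?_)
  · intro σ' hF
    simp only [WExpr.eval, (hE.frame hF (by decide) (by decide)).m]
  · intro j hj σ' hF hij hI
    refine wp_wset le_rfl (by decide) ?_ ?_ ?_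
    · simp only [WExpr.eval, hij]; omega
    · simp only [WExpr.eval]; omega
    · intro e he
      rcases Nat.lt_succ_iff_lt_or_eq.1 he with he | rfl
      · simp [WExpr.eval, hij, Function.update_apply, hI e he]
      · simp [WExpr.eval, hij]
  intro σ₁ hF₁ hz
  have hE₁ := hE.frame hF₁ (by decide) (by decide)
  have hc₁ : σ₁.word w_c 0 = N.enc val := by rw [hF₁.word w_c (by decide), hc]
  refine wp_seq 1 (by omega) (wp_wset le_rfl (by decide) ?_ ?_ ?_)
  · simp only [WExpr.eval]; omega
  · simpa only [WExpr.eval, hc₁]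
  set σ₂ := σ₁.setW w_y ((WExpr.const 0).eval σ₁) ((WExpr.var w_c).eval σ₁) with hσ₂
  have hE₂ : Env N σ₂ := by
    constructor <;> simp [hσ₂, hE₁.n, hE₁.m, hE₁.tl, hE₁.hd, hE₁.s, hE₁.cmp]
  refine wp_loop (fun φ σ' => ∃ j ≤ N.m, φ = 4 * j ∧ σ'.word w_y 0 = N.encTo val j ∧
    ∀ e < N.m, σ'.word w_val e = if e < j then 0 else val e) (4 * N.m) (by omega)
    ⟨N.m, le_rfl, rfl, ?_, ?_⟩ ?_ ?_
  · simp [hσ₂, WExpr.eval, hc₁, Net.enc]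
  · intro e he
    simp [hσ₂, hz e he, he]
  · rintro _ σ' hF ⟨j, hj, rfl, hy, hv⟩ hpos
    have hE' := hE₂.frame hF (by decide) (by decide)
    simp only [Cond.Holds, WExpr.eval, hy] at hpos
    obtain ⟨i, hij, hvi, henc, hzero⟩ :=
      Net.exists_last (N := N) (val := val) (by omega : N.encTo val j ≠ 0)
    rw [henc] at hy
    have hmod := Net.encTo_mod hb (by omega : i < N.m) hvi
    have hdiv := Net.encTo_div hb (by omega : i < N.m) hvi
    simp only [Net.base] at hmod hdiv
    have hle := hb.le i
    have hnn : 0 < N.n * N.n := by positivity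
    have hdig : i * N.n * N.n + val i - 1 = N.n * N.n * i + (val i - 1) := by
      rw [mul_assoc, mul_comm i]; omega
    have hd1 : (i * N.n * N.n + val i - 1) / (N.n * N.n) = i := by
      rw [hdig, Nat.mul_add_div hnn, Nat.div_eq_of_lt (by omega), add_zero]
    have hd2 : (i * N.n * N.n + val i - 1) % (N.n * N.n) + 1 = val i := by
      rw [hdig, Nat.mul_add_mod, Nat.mod_eq_of_lt (by omega)]; omega
    have hlt : N.encTo val i < U := by
      have := Net.encTo_mono (N := N) (val := val) (i := i) (j := N.m) (by omega)
      rw [← Net.enc] at this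
      omega
    refine ⟨3, wp_seq 1 (by omega) (wp_wset le_rfl (by decide) ?_ ?_ (wp_wset (by omega) (by decide)
      ?_ ?_ ⟨4 * i, by omega, i, by omega, rfl, ?_, ?_⟩))⟩
    · simp only [WExpr.eval, hE'.n, hE'.m, hy, hmod, hd1]; omega
    · simp only [WExpr.eval, hE'.n, hE'.m, hy, hmod, hd2]; omega
    · simp only [WExpr.eval]; omega
    · simpa [WExpr.eval, hE'.n, hE'.m, hy, hdiv] using hlt
    · simp [WExpr.eval, hE'.n, hE'.m, hy, hdiv]
    · intro e he
      have hw := hv e he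
      simp only [WExpr.eval, hE'.n, hE'.m, hy, hmod, hd1, hd2, State.setW_word,
        Nat.reduceEqDiff, if_false, if_true]
      rw [Function.update_apply, hw]
      rcases lt_trichotomy e i with h | rfl | h
      · simp [h, h.ne, (h.trans hij)]
      · simp
      · rcases lt_or_ge e j with h' | h'
        · simp [h.ne', h', hzero e h' h, Nat.not_lt.2 h.le]
        · simp [h.ne', Nat.not_lt.2 h', Nat.not_lt.2 h.le]
  · rintro _ σ' hF ⟨j, hj, rfl, hy, hv⟩ hpos e he
    simp only [Cond.Holds, WExpr.eval, hy, not_lt, Nat.le_zero] at hpos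
    rw [hv e he]
    split_ifs with h
    · exact (Net.encTo_eq_zero hpos e h).symm
    · rfl

theorem wp_findPos (hL : Lim N k M U) (hE : Env N σ) {val : ℕ → ℕ}
    (hv : ∀ e < N.m, σ.word w_val e = val e) (hpU : N.pos val < U) :
    WP M U findPos (10 * N.m + 10) (fun σ' => σ'.word w_pos 0 = N.pos val) σ := by
  have hmM := hL.m_lt
  have hU := hL.words
  refine wp_seq 1 (by omega) (wp_wset le_rfl (by decide) ?_ ?_ ?_)
  · simp only [WExpr.eval]; omega
  · simp only [WExpr.eval]; omega
  set σ₁ := σ.setW w_pos ((WExpr.const 0).eval σ) ((WExpr.const 0).eval σ) with hσ₁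
  have hE₁ : Env N σ₁ := by constructor <;> simp [hσ₁, hE.n, hE.m, hE.tl, hE.hd, hE.s, hE.cmp]
  refine wp_for (fun j σ' => σ'.word w_pos 0 = N.posTo val j) (fun _ => 2) N.m (by simp; omega)
    (by decide) (by omega) (by omega) (by decide) ?_ (by simp [hσ₁, Net.posTo, WExpr.eval]) ?_
    (fun _ _ h => h)
  · intro σ' hF
    simp only [WExpr.eval, (hE₁.frame hF (by decide) (by decide)).m]
  · intro j hj σ' hF hij hI
    have hE' := hE₁.frame hF (by decide) (by decide)
    have hvj : σ'.word w_val j = val j := by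
      rw [hF.word w_val (by decide)]; simpa [hσ₁] using hv j hj
    have hmono : N.posTo val (j + 1) ≤ N.pos val :=
      Net.posTo_le_iff.2 fun e he hne => Net.le_pos (by omega) hne
    refine wp_ite (by omega) (fun hc => wp_skip (by omega) ?_) (fun hc => wp_wset (by omega)
      (by decide) ?_ ?_ ?_)
    · simp only [Cond.Holds, WExpr.eval, hij, hvj] at hc
      simp [hI, Net.posTo, hc]
    · simp only [WExpr.eval]; omega
    all_goals simp only [Cond.Holds, WExpr.eval, hij, hvj] at hc
    · rw [Net.posTo, if_neg hc] at hmono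
      simp only [WExpr.eval, hij, hvj, hI, hE'.n, max_eq]
      omega
    · simp [WExpr.eval, hij, hvj, hI, hE'.n, max_eq, Net.posTo, hc]

/-- The edge `e` ends at the next position. -/
def Due (N : Net) (val : ℕ → ℕ) (e : ℕ) : Prop := val e ≠ 0 ∧ (val e - 1) % N.n = N.pos val

theorem holds_due (hE : Env N σ) {val : ℕ → ℕ} {e : ℕ} (he : σ.word w_e 0 = e)
    (hv : σ.word w_val e = val e) (hp : σ.word w_pos 0 = N.pos val) :
    dueC.Holds σ ↔ Due N val e := by
  simp only [Cond.Holds, WExpr.eval, he, hv, hp, hE.n, Due, ne_eq]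

/-- Any due edge may supply the candidate. That the due edges are precisely those entering it is
left to `wp_checkVertex`. -/
theorem wp_findVertex (hL : Lim N k M U) (hE : Env N σ) {val : ℕ → ℕ}
    (hv : ∀ e < N.m, σ.word w_val e = val e) (hp : σ.word w_pos 0 = N.pos val) :
    WP M U findVertex (10 * N.m + 10) (fun σ' =>
      (σ'.word w_v 0 = (if σ.word w_c 0 = 0 then N.s else N.n) ∧ ∀ e < N.m, ¬ Due N val e) ∨
      ∃ e < N.m, Due N val e ∧ σ'.word w_v 0 = N.hd e) σ := by
  have hmM := hL.m_lt
  have hnM := hL.n_lt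
  have hU := hL.words
  have hs := hL.valid.s_lt
  refine wp_seq 2 (by omega) ((?_ : WP M U _ 2 (fun σ' => Env N σ' ∧
    (∀ e < N.m, σ'.word w_val e = val e) ∧ σ'.word w_pos 0 = N.pos val ∧
    σ'.word w_v 0 = (if σ.word w_c 0 = 0 then N.s else N.n)) σ).mono le_rfl ?_)
  · refine wp_ite (by omega) (fun hc => wp_wset (by omega) (by decide) ?_ ?_ ?_)
      (fun hc => wp_wset (by omega) (by decide) ?_ ?_ ?_)
    · simp only [WExpr.eval]; omega
    · simp only [WExpr.eval, hE.s]; omega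
    · simp only [Cond.Holds, WExpr.eval] at hc
      refine ⟨?_, by simpa, by simpa, by simp [WExpr.eval, hE.s, hc]⟩
      constructor <;> simp [hE.n, hE.m, hE.tl, hE.hd, hE.s, hE.cmp]
    · simp only [WExpr.eval]; omega
    · simp only [WExpr.eval, hE.n]; omega
    · simp only [Cond.Holds, WExpr.eval] at hc
      refine ⟨?_, by simpa, by simpa, by simp [WExpr.eval, hE.n, hc]⟩
      constructor <;> simp [hE.n, hE.m, hE.tl, hE.hd, hE.s, hE.cmp]
  rintro σ₁ - ⟨hE₁, hv₁, hp₁, hv0⟩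
  refine wp_for (fun j σ' =>
    (σ'.word w_v 0 = (if σ.word w_c 0 = 0 then N.s else N.n) ∧ ∀ e < j, ¬ Due N val e) ∨
      ∃ e < j, Due N val e ∧ σ'.word w_v 0 = N.hd e) (fun _ => 2) N.m (by simp; omega)
    (by decide) (by omega) (by omega) (by decide) ?_ (Or.inl ⟨by simpa using hv0, by simp⟩) ?_
    (fun _ _ h => h)
  · intro σ' hF
    simp only [WExpr.eval, (hE₁.frame hF (by decide) (by decide)).m]
  · intro j hj σ' hF hij hI
    have hE' := hE₁.frame hF (by decide) (by decide)
    have hvj : σ'.word w_val j = val j := by rw [hF.word w_val (by decide), hv₁ j hj]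
    have hpj : σ'.word w_pos 0 = N.pos val := by rw [hF.word w_pos (by decide), hp₁]
    have hd := hL.valid.hd_lt j hj
    refine wp_ite (by omega) (fun hc => wp_wset (by omega) (by decide) ?_ ?_ ?_)
      (fun hc => wp_skip (by omega) ?_)
    · simp only [WExpr.eval]; omega
    · simp only [WExpr.eval, hij, hE'.hd]; omega
    · rw [holds_due hE' hij hvj hpj] at hc
      exact Or.inr ⟨j, by omega, hc, by simp [WExpr.eval, hij, hE'.hd]⟩
    · rw [holds_due hE' hij hvj hpj] at hc
      rcases hI with ⟨h1, h2⟩ | ⟨e, he, h1, h2⟩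
      · refine Or.inl ⟨by simpa using h1, fun e he => ?_⟩
        rcases Nat.lt_succ_iff_lt_or_eq.1 he with he | rfl
        · exact h2 e he
        · exact hc
      · exact Or.inr ⟨e, by omega, h1, by simpa using h2⟩

theorem wp_checkVertex (hL : Lim N k M U) (hE : Env N σ) {val : ℕ → ℕ} {v : ℕ}
    (hv : ∀ e < N.m, σ.word w_val e = val e) (hp : σ.word w_pos 0 = N.pos val)
    (hvv : σ.word w_v 0 = v) :
    WP M U checkVertex (10 * N.m + 10) (fun σ' => σ'.word w_nd 0 = N.choices v ∧
      (σ'.word w_adm 0 ≠ 0 ↔ v < N.n ∧ ∀ e < N.m, (N.hd e = v ↔ Due N val e))) σ := by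
  have hmM := hL.m_lt
  have h2 := hL.valid.two_le
  have hnM := hL.n_lt
  have hU := hL.words
  refine wp_seq 2 (by omega) ((?_ : WP M U _ 2 (fun σ' => Env N σ' ∧
    (∀ e < N.m, σ'.word w_val e = val e) ∧ σ'.word w_pos 0 = N.pos val ∧ σ'.word w_v 0 = v ∧
    (σ'.word w_adm 0 ≠ 0 ↔ v < N.n)) σ).mono le_rfl ?_)
  · refine wp_ite (by omega) (fun hc => wp_wset (by omega) (by decide) ?_ ?_ ?_)
      (fun hc => wp_wset (by omega) (by decide) ?_ ?_ ?_)
    · simp only [WExpr.eval]; omega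
    · simp only [WExpr.eval]; omega
    · simp only [Cond.Holds, WExpr.eval, hvv, hE.n] at hc
      refine ⟨?_, by simpa, by simpa, by simpa, by simp [WExpr.eval, hc]⟩
      constructor <;> simp [hE.n, hE.m, hE.tl, hE.hd, hE.s, hE.cmp]
    · simp only [WExpr.eval]; omega
    · simp only [WExpr.eval]; omega
    · simp only [Cond.Holds, WExpr.eval, hvv, hE.n] at hc
      refine ⟨?_, by simpa, by simpa, by simpa, by simpa [WExpr.eval] using hc⟩
      constructor <;> simp [hE.n, hE.m, hE.tl, hE.hd, hE.s, hE.cmp]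
  rintro σ₁ - ⟨hE₁, hv₁, hp₁, hvv₁, ha₁⟩
  refine wp_seq 1 (by omega) (wp_wset le_rfl (by decide) ?_ ?_ ?_)
  · simp only [WExpr.eval]; omega
  · simp only [WExpr.eval]; omega
  set σ₂ := σ₁.setW w_nd ((WExpr.const 0).eval σ₁) ((WExpr.const 1).eval σ₁) with hσ₂
  have hE₂ : Env N σ₂ := by
    constructor <;> simp [hσ₂, hE₁.n, hE₁.m, hE₁.tl, hE₁.hd, hE₁.s, hE₁.cmp]
  refine wp_for (fun j σ' => σ'.word w_nd 0 = pw N.n (fun e => N.tl e = v) j ∧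
      (σ'.word w_adm 0 ≠ 0 ↔ v < N.n ∧ ∀ e < j, (N.hd e = v ↔ Due N val e)))
    (fun _ => 5) N.m (by simp; omega)
    (by decide) (by omega) (by omega) (by decide) ?_ (by simp [hσ₂, ha₁, pw, WExpr.eval]) ?_
    (fun _ _ h => h)
  · intro σ' hF
    simp only [WExpr.eval, (hE₂.frame hF (by decide) (by decide)).m]
  · rintro j hj σ' hF hij ⟨hI1, hI2⟩
    have hE' := hE₂.frame hF (by decide) (by decide)
    have hvj : σ'.word w_val j = val j := by
      rw [hF.word w_val (by decide)]; simpa [hσ₂] using hv₁ j hj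
    have hpj : σ'.word w_pos 0 = N.pos val := by
      rw [hF.word w_pos (by decide)]; simpa [hσ₂] using hp₁
    have hvvj : σ'.word w_v 0 = v := by
      rw [hF.word w_v (by decide)]; simpa [hσ₂] using hvv₁
    have hpw : pw N.n (fun e => N.tl e = v) (j + 1) < M := by
      refine lt_of_le_of_lt ?_ (hL.choices_lt v)
      rw [Net.choices, pw_eq, pw_eq]
      exact Nat.pow_le_pow_right (by have := hL.valid.two_le; omega)
        (Finset.card_le_card (Finset.filter_subset_filter _ (Finset.range_mono hj)))
    have hcond : (orC (.and (.weq (hdE (.var w_e)) (.var w_v)) (.not dueC))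
          (.and (.not (.weq (hdE (.var w_e)) (.var w_v))) dueC)).Holds σ' ↔
        ¬ (N.hd j = v ↔ Due N val j) := by
      rw [holds_or, ← holds_due hE' hij hvj hpj]
      simp only [Cond.Holds, WExpr.eval, hij, hE'.hd, hvvj]
      tauto
    have hsplit : (∀ e < j + 1, (N.hd e = v ↔ Due N val e)) ↔
        (∀ e < j, (N.hd e = v ↔ Due N val e)) ∧ (N.hd j = v ↔ Due N val j) :=
      ⟨fun h => ⟨fun e he => h e (by omega), h j (by omega)⟩, fun h e he => by
        rcases Nat.lt_succ_iff_lt_or_eq.1 he with he | rfl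
        · exact h.1 e he
        · exact h.2⟩
    refine wp_seq 2 (by omega) ((?_ : WP M U _ 2 (fun σ'' =>
      (σ''.word w_adm 0 ≠ 0 ↔ v < N.n ∧ ∀ e < j + 1, (N.hd e = v ↔ Due N val e))) σ').mono le_rfl ?_)
    · refine wp_ite (by omega) (fun hc => wp_wset (by omega) (by decide) ?_ ?_ ?_)
        (fun hc => wp_skip (by omega) ?_)
      · simp only [WExpr.eval]; omega
      · simp only [WExpr.eval]; omega
      · rw [hcond] at hc
        rw [hsplit]
        simp [WExpr.eval, hc]
      · rw [hcond, not_not] at hc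
        rw [hI2, hsplit]
        simp only [hc, and_true]
    · intro σ'' hF' hadm
      have hij' : σ''.word w_e 0 = j := by rw [hF'.word w_e (by decide), hij]
      have hE'' := hE'.frame hF' (by decide) (by decide)
      have hvvj' : σ''.word w_v 0 = v := by rw [hF'.word w_v (by decide), hvvj]
      have hnd' : σ''.word w_nd 0 = pw N.n (fun e => N.tl e = v) j := by
        rw [hF'.word w_nd (by decide), hI1]
      rw [pw] at hpw
      refine wp_ite (by omega) (fun hc => wp_wset (by omega) (by decide) ?_ ?_ ?_)
        (fun hc => wp_skip (by omega) ?_)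
      · simp only [WExpr.eval]; omega
      all_goals simp only [Cond.Holds, WExpr.eval, hij', hvvj', hE''.tl] at hc
      · simp only [WExpr.eval, hE''.n, hnd']
        rw [if_pos hc] at hpw
        omega
      · refine ⟨by simp [WExpr.eval, hE''.n, hnd', pw, hc], by simpa using hadm⟩
      · refine ⟨by simp [hnd', pw, hc], by simpa using hadm⟩

end Upward

/-! ### Preparing a state and trying one choice -/

namespace Upward
open RealRAM Prog
variable {N : Net} {k M U : ℕ} {σ : State}

theorem Env.setW (hE : Env N σ) {a i v : ℕ} (ha : a ∉ [0, 1, 2, w_s]) : Env N (σ.setW a i v) := by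
  simp only [List.mem_cons, List.not_mem_nil, or_false, not_or] at ha
  obtain ⟨h0, h1, h2, h3⟩ := ha
  constructor <;> simp [hE.n, hE.m, hE.tl, hE.hd, hE.s, hE.cmp, Ne.symm h0, Ne.symm h1, Ne.symm h2,
    Ne.symm h3]

theorem wp_prepare (hL : Lim N k M U) (hE : Env N σ) {val : ℕ → ℕ} {ws : List ℕ}
    (hr : N.Reach ws val) (hws : ws.length < N.n)
    (hc : σ.word w_queue (σ.word w_qh 0) = N.enc val) (hq : σ.word w_qh 0 + 1 < U) :
    WP M U prepare (40 * N.m + 50) (fun σ' => σ'.word w_c 0 = N.enc val ∧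
      σ'.word w_qh 0 = σ.word w_qh 0 + 1 ∧ (∀ e < N.m, σ'.word w_val e = val e) ∧
      σ'.word w_pos 0 = N.pos val ∧
      (σ'.word w_adm 0 ≠ 0 → N.Adm val (σ'.word w_v 0) ∧
        σ'.word w_nd 0 = N.choices (σ'.word w_v 0)) ∧
      (σ'.word w_adm 0 = 0 → ∀ u, ¬ N.Adm val u)) σ := by
  have hmM := hL.m_lt
  have hnM := hL.n_lt
  have hU := hL.words
  have hi := hr.inv hL.valid
  have hb := hi.bounded
  have hcM : N.enc val < M := (Net.enc_lt hb (hi.supp_le hL.valid)).trans hL.codes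
  have hpos := hi.pos_eq hL.valid hws
  refine wp_seq 1 (by omega) (wp_wset le_rfl (by decide) (by simp only [WExpr.eval]; omega)
    (by simp only [WExpr.eval, hc]; omega) ?_)
  refine wp_seq 1 (by omega) (wp_wset le_rfl (by decide) (by simp only [WExpr.eval]; omega)
    (by simpa [WExpr.eval] using hq) ?_)
  set σ₁ := (σ.setW w_c ((WExpr.const 0).eval σ) ((WExpr.get w_queue (.var w_qh)).eval σ)) with hσ₁
  set σ₂ := σ₁.setW w_qh ((WExpr.const 0).eval σ₁)
    ((WExpr.add (.var w_qh) (.const 1)).eval σ₁) with hσ₂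
  have hE₂ : Env N σ₂ := (hE.setW (by decide)).setW (by decide)
  have hc₂ : σ₂.word w_c 0 = N.enc val := by simp [hσ₂, hσ₁, WExpr.eval, hc]
  have hq₂ : σ₂.word w_qh 0 = σ.word w_qh 0 + 1 := by simp [hσ₂, hσ₁, WExpr.eval]
  refine wp_seq (8 * N.m + 8) (by omega) ((wp_decode hL hE₂ hb hc₂ (by omega)).mono le_rfl ?_)
  intro σ₃ hF₃ hv₃
  have hE₃ := hE₂.frame hF₃ (by decide) (by decide)
  refine wp_seq (10 * N.m + 10) (by omega) ((wp_findPos hL hE₃ hv₃ (by omega)).mono le_rfl ?_)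
  intro σ₄ hF₄ hp₄
  have hE₄ := hE₃.frame hF₄ (by decide) (by decide)
  have hv₄ : ∀ e < N.m, σ₄.word w_val e = val e := by rw [hF₄.word w_val (by decide)]; exact hv₃
  have hc₄ : σ₄.word w_c 0 = N.enc val := by
    rw [hF₄.word w_c (by decide), hF₃.word w_c (by decide), hc₂]
  refine wp_seq (10 * N.m + 10) (by omega) ((wp_findVertex hL hE₄ hv₄ hp₄).mono le_rfl ?_)
  intro σ₅ hF₅ hw₅
  have hE₅ := hE₄.frame hF₅ (by decide) (by decide)
  have hv₅ : ∀ e < N.m, σ₅.word w_val e = val e := by rw [hF₅.word w_val (by decide)]; exact hv₄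
  have hp₅ : σ₅.word w_pos 0 = N.pos val := by rw [hF₅.word w_pos (by decide), hp₄]
  refine (wp_checkVertex hL hE₅ hv₅ hp₅ rfl).mono (by omega) ?_
  rintro σ₆ hF₆ ⟨hn₆, ha₆⟩
  have hv₆ : σ₆.word w_v 0 = σ₅.word w_v 0 := by rw [hF₆.word w_v (by decide)]
  -- The program recognises the initial state by its code, which is correct because codes are
  -- injective.
  have hzero : σ₄.word w_c 0 = 0 ↔ val = 0 := by
    rw [hc₄]
    constructor
    · intro h
      exact Net.enc_inj hb Net.Bounded.zero (h.trans Net.enc_zero.symm)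
    · rintro rfl
      exact Net.enc_zero
  refine ⟨?_, ?_, ?_, ?_, ?_, ?_⟩
  · rw [hF₆.word w_c (by decide), hF₅.word w_c (by decide), hc₄]
  · rw [hF₆.word w_qh (by decide), hF₅.word w_qh (by decide), hF₄.word w_qh (by decide),
      hF₃.word w_qh (by decide), hq₂]
  · rw [hF₆.word w_val (by decide)]; exact hv₅
  · rw [hF₆.word w_pos (by decide), hp₅]
  · intro hadm
    rw [ha₆] at hadm
    rw [hv₆]
    refine ⟨⟨hadm.1, fun h0 => ?_, fun h0 => ?_, hadm.2⟩, hn₆⟩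
    · rcases hw₅ with ⟨h1, -⟩ | ⟨e, he, h1, -⟩
      · rw [h1, if_pos (hzero.2 h0)]
      · exact absurd (by rw [h0]; rfl) h1.1
    · rcases hw₅ with ⟨h1, -⟩ | ⟨e, he, -, h1⟩
      · rw [if_neg (mt hzero.1 h0)] at h1; omega
      · exact ⟨e, he, h1.symm⟩
  · intro hadm u hu
    have hiff : ∀ e < N.m, (N.hd e = u ↔ Due N val e) := hu.iff
    have : σ₅.word w_v 0 = u := by
      rcases hw₅ with ⟨h1, h2⟩ | ⟨e, he, h1, h2⟩
      · by_cases h0 : val = 0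
        · rw [h1, if_pos (hzero.2 h0), hu.zero h0]
        · obtain ⟨e, he, heu⟩ := hu.ne_zero h0
          exact absurd ((hiff e he).1 heu) (h2 e he)
      · rw [h2, (hiff e he).2 h1]
    refine absurd hadm (ha₆.2 ?_)
    rw [this]
    exact ⟨hu.lt, hiff⟩

theorem forall_lt_succ {P : ℕ → Prop} {j : ℕ} : (∀ e < j + 1, P e) ↔ (∀ e < j, P e) ∧ P j :=
  ⟨fun h => ⟨fun e he => h e (by omega), h j (by omega)⟩, fun h e he => by
    rcases Nat.lt_succ_iff_lt_or_eq.1 he with he | rfl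
    · exact h.1 e he
    · exact h.2⟩

/-- The memory holds the state `val`, in which `v` can be placed next. -/
structure Ready (N : Net) (val : ℕ → ℕ) (v : ℕ) (σ : State) : Prop where
  env : Env N σ
  entry : ∀ e < N.m, σ.word w_val e = val e
  vertex : σ.word w_v 0 = v
  pos : σ.word w_pos 0 = N.pos val
  c : σ.word w_c 0 = N.enc val

theorem Ready.frame {val : ℕ → ℕ} {v : ℕ} {σ' : State} (h : Ready N val v σ) {p : Stmt}
    (hf : Frame p σ σ') (hw : ∀ a ∈ [0, 1, 2, w_s], a ∉ p.wordTargets)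
    (hr : ∀ a ∈ [2, 3], a ∉ p.realTargets) (hw' : ∀ a ∈ [w_val, w_v, w_pos, w_c], a ∉ p.wordTargets) :
    Ready N val v σ' := by
  simp only [List.mem_cons, List.not_mem_nil, or_false, forall_eq_or_imp, forall_eq] at hw'
  obtain ⟨h0, h1, h2, h3⟩ := hw'
  exact ⟨h.env.frame hf hw hr, by rw [hf.word _ h0]; exact h.entry, by rw [hf.word _ h1, h.vertex],
    by rw [hf.word _ h2, h.pos], by rw [hf.word _ h3, h.c]⟩

theorem Ready.setW {val : ℕ → ℕ} {v : ℕ} (h : Ready N val v σ) {a i u : ℕ}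
    (ha : a ∉ [0, 1, 2, w_s]) (ha' : a ∉ [w_val, w_v, w_pos, w_c]) : Ready N val v (σ.setW a i u) := by
  simp only [List.mem_cons, List.not_mem_nil, or_false, not_or] at ha'
  obtain ⟨h0, h1, h2, h3⟩ := ha'
  exact ⟨h.env.setW ha, by simpa [Ne.symm h0] using h.entry, by simpa [Ne.symm h1] using h.vertex,
    by simpa [Ne.symm h2] using h.pos, by simpa [Ne.symm h3] using h.c⟩

theorem Net.digit_def (v x e : ℕ) :
    N.digit v x e = x / pw N.n (fun e => N.tl e = v) e % N.n := rfl

/-- The scratch variable `z` holds the choice divided by the power of `n` already used up, so its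
remainder modulo `n` is the digit of the next outgoing edge. -/
theorem wp_build (hL : Lim N k M U) {val : ℕ → ℕ} {v x : ℕ} (hR : Ready N val v σ)
    (hb : N.Bounded (N.next val v x)) (hz : σ.word w_z 0 = x)
    (hok : σ.word w_ok 0 ≠ 0) :
    WP M U build (12 * N.m + 3) (fun σ' => (∀ e < N.m, σ'.word w_nv e = N.next val v x e) ∧
      (σ'.word w_ok 0 ≠ 0 ↔ ∀ e < N.m, N.tl e = v → N.pos val < N.digit v x e)) σ := by
  -- The bound on `x` comes from the memory itself, where `x` is stored as a word.
  intro hfit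
  have hxU : x < U := hz ▸ hfit.2 w_z 0
  refine (?_ : WP M U build (12 * N.m + 3) _ σ) hfit
  have hmM := hL.m_lt
  have hsq := hL.sq_lt
  have hU := hL.words
  have h2 := hL.valid.two_le
  refine wp_for (fun j σ' => (∀ e < j, σ'.word w_nv e = N.next val v x e) ∧
      σ'.word w_z 0 = x / pw N.n (fun e => N.tl e = v) j ∧
      (σ'.word w_ok 0 ≠ 0 ↔ ∀ e < j, N.tl e = v → N.pos val < N.digit v x e)) (fun _ => 9) N.m
    (by simp; omega) (by decide) (by omega) (by omega) (by decide) ?_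
    ⟨by simp, by simp [hz, pw], by simpa using hok⟩ ?_ (fun _ _ h => ⟨h.1, h.2.2⟩)
  · intro σ' hF
    simp only [WExpr.eval, (hR.env.frame hF (by decide) (by decide)).m]
  · rintro j hj σ' hF hij ⟨hI1, hI2, hI3⟩
    have hR' := hR.frame hF (by decide) (by decide) (by decide)
    have hE' := hR'.env
    have hnv : ∀ u s : ℕ, u = N.next val v x j →
        ∀ e < j + 1, Function.update (σ'.word w_nv) j u e = N.next val v x e := by
      rintro u s rfl e he
      rw [Function.update_apply]
      split_ifs with h
      · rw [h]
      · exact hI1 e (by omega)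
    have hkeep : ¬ N.hd j = v → ¬ N.tl j = v → N.next val v x j = val j := fun hc hc' => by
      rw [Net.next, if_pos hj, if_neg hc, if_neg hc']
    have hble := hb.le j
    have hpos := hR'.pos
    have hv := hR'.vertex
    refine wp_ite (by omega) (fun hc => wp_wset (by omega) (by decide) ?_ ?_ ?_) (fun hc =>
      wp_ite (by omega) (fun hc' => ?_) (fun hc' => wp_wset (by omega) (by decide) ?_ ?_ ?_))
    · simp only [WExpr.eval, hij]; omega
    · simp only [WExpr.eval]; omega
    · simp only [Cond.Holds, WExpr.eval, hij, hE'.hd, hv] at hc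
      have ht : N.tl j ≠ v := fun ht => Net.Inv.tl_ne_hd hL.valid hj (ht.trans hc.symm)
      refine ⟨?_, ?_, ?_⟩
      · simpa [WExpr.eval, hij] using hnv 0 0 (by rw [Net.next, if_pos hj, if_pos hc])
      · simp [hI2, pw, ht]
      · rw [forall_lt_succ]
        simpa [ht] using hI3
    · simp only [Cond.Holds, WExpr.eval, hij, hE'.hd, hE'.tl, hv] at hc hc'
      have hnext : N.next val v x j = N.pos val * N.n + N.digit v x j + 1 := by
        rw [Net.next, if_pos hj, if_neg hc, if_pos hc']
      refine wp_seq 1 (by omega) (wp_wset le_rfl (by decide) ?_ ?_ ?_)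
      · simp only [WExpr.eval, hij]; omega
      · simp only [WExpr.eval, hpos, hE'.n, hI2, ← Net.digit_def, ← hnext]; omega
      set σ₁ := σ'.setW w_nv ((WExpr.var w_e).eval σ')
        ((WExpr.add (.add (.mul (.var w_pos) nE) (.mod (.var w_z) nE)) (.const 1)).eval σ') with hσ₁
      have hR₁ : Ready N val v σ₁ := hR'.setW (by decide) (by decide)
      have hnv₁ : ∀ e < j + 1, σ₁.word w_nv e = N.next val v x e := by
        simpa [hσ₁, WExpr.eval, hij] using hnv _ 0 (by
            simp only [hpos, hE'.n, hI2, ← Net.digit_def, ← hnext])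
      have hz₁ : σ₁.word w_z 0 = x / pw N.n (fun e => N.tl e = v) j := by simp [hσ₁, hI2]
      have hok₁ : σ₁.word w_ok 0 ≠ 0 ↔ ∀ e < j, N.tl e = v → N.pos val < N.digit v x e := by
        simpa [hσ₁] using hI3
      refine wp_seq 2 (by omega) ((?_ : WP M U _ 2 (fun σ'' => (σ''.word w_ok 0 ≠ 0 ↔ ∀ e < j + 1,
        N.tl e = v → N.pos val < N.digit v x e)) σ₁).mono le_rfl ?_)
      · refine wp_ite (by omega) (fun hc => wp_skip (by omega) ?_) (fun hc => wp_wset (by omega)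
          (by decide) (by simp only [WExpr.eval]; omega) (by simp only [WExpr.eval]; omega) ?_)
        · simp only [Cond.Holds, WExpr.eval, hR₁.pos, hR₁.env.n, hz₁, ← Net.digit_def] at hc
          rw [hok₁, forall_lt_succ]
          simp [hc]
        · simp only [Cond.Holds, WExpr.eval, hR₁.pos, hR₁.env.n, hz₁, ← Net.digit_def] at hc
          rw [forall_lt_succ]
          simp [WExpr.eval, hc', hc]
      · intro σ₂ hF₂ hok₂
        have hR₂ := hR₁.frame hF₂ (by decide) (by decide) (by decide)
        have hz₂ : σ₂.word w_z 0 = x / pw N.n (fun e => N.tl e = v) j := by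
          rw [hF₂.word w_z (by decide), hz₁]
        refine wp_wset (by omega) (by decide) (by simp only [WExpr.eval]; omega) ?_ ⟨?_, ?_, ?_⟩
        · simp only [WExpr.eval, hz₂, hR₂.env.n]
          exact (Nat.div_le_self _ _).trans_lt ((Nat.div_le_self _ _).trans_lt hxU)
        · have : ∀ e < j + 1, σ₂.word w_nv e = N.next val v x e := by
            rw [hF₂.word w_nv (by decide)]; exact hnv₁
          simpa using this
        · simp [WExpr.eval, hz₂, hR₂.env.n, pw, hc', Nat.div_div_eq_div_mul]
        · simpa using hok₂
    · simp only [WExpr.eval, hij]; omega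
    all_goals simp only [Cond.Holds, WExpr.eval, hij, hE'.hd, hE'.tl, hv] at hc hc'
    all_goals have hnext := hkeep hc hc'
    · simp only [WExpr.eval, hij, hR'.entry j hj, ← hnext]; omega
    · refine ⟨?_, ?_, ?_⟩
      · simpa [WExpr.eval, hij, hR'.entry j hj] using hnv (val j) 0 hnext.symm
      · simp [hI2, pw, hc']
      · rw [forall_lt_succ]
        simpa [hc'] using hI3

theorem wp_checkEdge (hL : Lim N k M U) (hE : Env N σ) {nv : ℕ → ℕ} {e : ℕ} (he : e < N.m)
    (hij : σ.word w_e 0 = e) (hnv : ∀ g < N.m, σ.word w_nv g = nv g) :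
    WP M U checkEdge (6 * N.m + 3) (fun σ' => (σ'.word w_ok 0 ≠ 0 ↔ σ.word w_ok 0 ≠ 0 ∧
      ∀ g < N.m, g ≠ e → nv g ≠ 0 → N.entryCmp (nv e) (nv g))) σ := by
  have hmM := hL.m_lt
  have hU := hL.words
  refine wp_for (fun j σ' => (σ'.word w_ok 0 ≠ 0 ↔ σ.word w_ok 0 ≠ 0 ∧
      ∀ g < j, g ≠ e → nv g ≠ 0 → N.entryCmp (nv e) (nv g))) (fun _ => 3) N.m (by simp; omega)
    (by decide) (by omega) (by omega) (by decide) ?_ (by simp) ?_ (fun _ _ h => h)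
  · intro σ' hF
    simp only [WExpr.eval, (hE.frame hF (by decide) (by decide)).m]
  · intro j hj σ' hF hjj hI
    have hE' := hE.frame hF (by decide) (by decide)
    have hnv' : ∀ g < N.m, σ'.word w_nv g = nv g := by rw [hF.word w_nv (by decide)]; exact hnv
    have he' : σ'.word w_e 0 = e := by rw [hF.word w_e (by decide), hij]
    have hcond : (Cond.and (.not (.weq (.var w_g) (.var w_e))) (.and (nzC (.get w_nv (.var w_g)))
        (.not (cmpC (.get w_nv (.var w_e)) (.get w_nv (.var w_g)))))).Holds σ' ↔
        ¬ (j ≠ e → nv j ≠ 0 → N.entryCmp (nv e) (nv j)) := by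
      change (¬ _ ∧ ¬ _ ∧ ¬ (cmpC _ _).Holds σ') ↔ _
      rw [holds_cmp hE']
      simp only [Cond.Holds, WExpr.eval, hjj, he', hnv' j hj, hnv' e he]
      tauto
    refine wp_ite (by omega) (fun hc => wp_wset (by omega) (by decide)
      (by simp only [WExpr.eval]; omega) (by simp only [WExpr.eval]; omega) ?_)
      (fun hc => wp_skip (by omega) ?_)
    · rw [hcond] at hc
      rw [forall_lt_succ]
      simp only [hc, and_false, iff_false]
      simp [WExpr.eval]
    · rw [hcond, not_not] at hc
      rw [forall_lt_succ]
      simp only [State.setW_word, Nat.reduceEqDiff, if_false, hI]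
      tauto

/-- Only the edges leaving `v` trigger an inner scan, and there are at most `k` of them; this keeps
the cost at `O(k m)` instead of `O(m²)`. -/
theorem wp_checkEdges (hL : Lim N k M U) {val : ℕ → ℕ} {v : ℕ} (hR : Ready N val v σ) {nv : ℕ → ℕ}
    (hnv : ∀ g < N.m, σ.word w_nv g = nv g) :
    WP M U checkEdges (5 * N.m + k * (6 * N.m + 3) + 3) (fun σ' =>
      (σ'.word w_ok 0 ≠ 0 ↔ σ.word w_ok 0 ≠ 0 ∧ ∀ e < N.m, N.tl e = v →
        ∀ g < N.m, g ≠ e → nv g ≠ 0 → N.entryCmp (nv e) (nv g))) σ := by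
  have hmM := hL.m_lt
  have hU := hL.words
  refine wp_for (fun j σ' => (σ'.word w_ok 0 ≠ 0 ↔ σ.word w_ok 0 ≠ 0 ∧ ∀ e < j, N.tl e = v →
        ∀ g < N.m, g ≠ e → nv g ≠ 0 → N.entryCmp (nv e) (nv g)))
    (fun e => 2 + if N.tl e = v then 6 * N.m + 3 else 0) N.m ?_
    (by decide) (by omega) (by omega) (by decide) ?_ (by simp) ?_ (fun _ _ h => h)
  · have hk := hL.valid.outdeg_le v
    have : ∑ e ∈ Finset.range N.m, (if N.tl e = v then 6 * N.m + 3 else 0) =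
        N.outdeg v * (6 * N.m + 3) := by
      rw [← Finset.sum_filter, Finset.sum_const, smul_eq_mul, Net.outdeg]
    simp only [Finset.sum_add_distrib, this, Finset.sum_const, Finset.card_range, smul_eq_mul]
    have := Nat.mul_le_mul_right (6 * N.m + 3) hk
    omega
  · intro σ' hF
    simp only [WExpr.eval, (hR.env.frame hF (by decide) (by decide)).m]
  · intro j hj σ' hF hjj hI
    have hR' := hR.frame hF (by decide) (by decide) (by decide)
    have hnv' : ∀ g < N.m, σ'.word w_nv g = nv g := by rw [hF.word w_nv (by decide)]; exact hnv
    refine wp_ite (by omega) (fun hc => ?_) (fun hc => wp_skip (by omega) ?_)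
    · simp only [Cond.Holds, WExpr.eval, hjj, hR'.vertex, hR'.env.tl] at hc
      refine (wp_checkEdge hL hR'.env hj hjj hnv').mono (by simp [hc]; omega) fun σ'' _ h => ?_
      rw [forall_lt_succ]
      simp only [State.setW_word, Nat.reduceEqDiff, if_false, h, hI]
      tauto
    · simp only [Cond.Holds, WExpr.eval, hjj, hR'.vertex, hR'.env.tl] at hc
      rw [forall_lt_succ]
      simp only [State.setW_word, Nat.reduceEqDiff, if_false, hI]
      tauto

theorem wp_encode (hL : Lim N k M U) (hE : Env N σ) {nv : ℕ → ℕ}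
    (hnv : ∀ g < N.m, σ.word w_nv g = nv g) (hU' : N.enc nv < U) :
    WP M U encode (10 * N.m + 10) (fun σ' => σ'.word w_d 0 = N.enc nv) σ := by
  have hmM := hL.m_lt
  have hU := hL.words
  refine wp_seq 1 (by omega) (wp_wset le_rfl (by decide) (by simp only [WExpr.eval]; omega)
    (by simp only [WExpr.eval]; omega) ?_)
  have hE₁ : Env N (σ.setW w_d ((WExpr.const 0).eval σ) ((WExpr.const 0).eval σ)) :=
    hE.setW (by decide)
  refine wp_for (fun j σ' => σ'.word w_d 0 = N.encTo nv j) (fun _ => 2) N.m (by simp; omega)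
    (by decide) (by omega) (by omega) (by decide) ?_ (by simp [Net.encTo, WExpr.eval]) ?_
    (fun _ _ h => h)
  · intro σ' hF
    simp only [WExpr.eval, (hE₁.frame hF (by decide) (by decide)).m]
  · intro j hj σ' hF hjj hI
    have hE' := hE₁.frame hF (by decide) (by decide)
    have hnv' : σ'.word w_nv j = nv j := by
      rw [hF.word w_nv (by decide)]; simpa using hnv j hj
    have hle := Net.encTo_mono (N := N) (val := nv) (i := j + 1) (j := N.m) (by omega)
    rw [← Net.enc] at hle
    refine wp_ite (by omega) (fun hc => wp_skip (by omega) ?_) (fun hc => wp_wset (by omega)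
      (by decide) (by simp only [WExpr.eval]; omega) ?_ ?_)
    all_goals simp only [Cond.Holds, WExpr.eval, hjj, hnv'] at hc
    · simp [hI, Net.encTo, hc]
    · rw [Net.encTo, if_neg hc, Net.base] at hle
      simp only [WExpr.eval, hjj, hnv', hI, hE'.n, hE'.m]
      omega
    · simp [WExpr.eval, hjj, hnv', hI, hE'.n, hE'.m, Net.encTo, hc, Net.base]

theorem wp_tryChoice (hL : Lim N k M U) {val : ℕ → ℕ} {v x : ℕ} {ws : List ℕ}
    (hR : Ready N val v σ) (hr : N.Reach ws val) (hws : ws.length < N.n) (hv : N.Adm val v)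
    (hx : σ.word w_x 0 = x) :
    WP M U tryChoice (36 * (N.m + 1) * (k + 1)) (fun σ' =>
      σ'.word w_d 0 = N.enc (N.next val v x) ∧ (σ'.word w_ok 0 ≠ 0 ↔ N.Good val v x)) σ := by
  intro hfit
  have hxU : x < U := hx ▸ hfit.2 w_x 0
  refine (?_ : WP M U tryChoice _ _ σ) hfit
  have hmM := hL.m_lt
  have hnM := hL.n_lt
  have h2 := hL.valid.two_le
  have hU := hL.words
  have hi := hr.inv hL.valid
  have hb := hi.next_bounded hL.valid hws v x
  have hcM : N.enc (N.next val v x) < M :=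
    (Net.enc_lt hb (hi.next_supp_le hL.valid hws hv x)).trans hL.codes
  have htime : 12 * N.m + 3 + (5 * N.m + k * (6 * N.m + 3) + 3) + (10 * N.m + 10) + 10 ≤
      36 * (N.m + 1) * (k + 1) := by nlinarith
  refine wp_seq 1 (by omega) (wp_wset le_rfl (by decide) (by simp only [WExpr.eval]; omega)
    (by simp only [WExpr.eval]; omega) ?_)
  refine wp_seq 1 (by omega) (wp_wset le_rfl (by decide) (by simp only [WExpr.eval]; omega)
    (by simpa [WExpr.eval, hx] using hxU) ?_)
  set σ₁ := σ.setW w_ok ((WExpr.const 0).eval σ) ((WExpr.const 1).eval σ) with hσ₁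
  set σ₂ := σ₁.setW w_z ((WExpr.const 0).eval σ₁) ((WExpr.var w_x).eval σ₁) with hσ₂
  have hR₂ : Ready N val v σ₂ :=
    (hR.setW (by decide) (by decide)).setW (by decide) (by decide)
  refine wp_seq (12 * N.m + 3) (by omega) ((wp_build hL hR₂ hb (x := x)
    (by simp [hσ₂, hσ₁, WExpr.eval, hx]) (by simp [hσ₂, hσ₁, WExpr.eval])).mono le_rfl ?_)
  rintro σ₃ hF₃ ⟨hnv₃, hok₃⟩
  have hR₃ := hR₂.frame hF₃ (by decide) (by decide) (by decide)
  refine wp_seq (5 * N.m + k * (6 * N.m + 3) + 3) (by omega)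
    ((wp_checkEdges hL hR₃ hnv₃).mono le_rfl ?_)
  intro σ₄ hF₄ hok₄
  have hR₄ := hR₃.frame hF₄ (by decide) (by decide) (by decide)
  refine (wp_encode hL hR₄.env (nv := N.next val v x)
    (by rw [hF₄.word w_nv (by decide)]; exact hnv₃) (by omega)).mono (by omega) ?_
  intro σ₅ hF₅ hd₅
  refine ⟨hd₅, ?_⟩
  rw [hF₅.word w_ok (by decide), hok₄, hok₃]
  constructor
  · rintro ⟨h1, h2⟩ e he hev
    exact ⟨h1 e he hev, h2 e he hev⟩
  · intro h
    exact ⟨fun e he hev => (h e he hev).1, fun e he hev => (h e he hev).2⟩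

end Upward

/-! ### Predecessor lists and the exploration of all states -/

namespace Upward
open RealRAM Prog
variable {N : Net} {k M U : ℕ} {σ : State}

/-- The linked list that starts at the record `r` holds the predecessors in the list `l`; all its
records precede `b`. -/
def Chain (N : Net) (src vert nxt : ℕ → ℕ) (b : ℕ) : ℕ → List ((ℕ → ℕ) × ℕ) → Prop
  | r, [] => r = 0
  | r, q :: l => 0 < r ∧ r < b ∧ src r = N.enc q.1 ∧ vert r = q.2 ∧ Chain N src vert nxt b (nxt r) l

/-- Records are only appended, so the lists made of records below `b` survive every later change. -/
theorem Chain.congr {src vert nxt src' vert' nxt' : ℕ → ℕ} {b b' : ℕ} (hb : b ≤ b')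
    (h1 : ∀ i < b, src' i = src i) (h2 : ∀ i < b, vert' i = vert i) (h3 : ∀ i < b, nxt' i = nxt i)
    {l : List ((ℕ → ℕ) × ℕ)} {r : ℕ} (h : Chain N src vert nxt b r l) :
    Chain N src' vert' nxt' b' r l := by
  induction l generalizing r with
  | nil => exact h
  | cons q l ih =>
    obtain ⟨a1, a2, a3, a4, a5⟩ := h
    exact ⟨a1, a2.trans_le hb, by rw [h1 r a2, a3], by rw [h2 r a2, a4], by rw [h3 r a2]; exact ih a5⟩

theorem Chain.eq_zero_iff {src vert nxt : ℕ → ℕ} {b r : ℕ} {l : List ((ℕ → ℕ) × ℕ)}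
    (h : Chain N src vert nxt b r l) : r = 0 ↔ l = [] := by
  cases l with
  | nil => exact ⟨fun _ => rfl, fun _ => h⟩
  | cons q l => exact ⟨fun h0 => absurd h.1 (by omega), fun h0 => by simp at h0⟩

/-- The memory holds the predecessor lists `preds` and the queue `Q`. -/
structure Store (N : Net) (preds : (ℕ → ℕ) → List ((ℕ → ℕ) × ℕ)) (Q : List (ℕ → ℕ)) (σ : State) :
    Prop where
  rc_pos : 0 < σ.word w_rc 0
  chain : ∀ val, N.Bounded val → Chain N (σ.word w_src) (σ.word w_vert) (σ.word w_next)
    (σ.word w_rc 0) (σ.word w_head (N.enc val)) (preds val)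
  qt : σ.word w_qt 0 = Q.length
  queue : ∀ i (h : i < Q.length), σ.word w_queue i = N.enc Q[i]

theorem Store.frame {preds : (ℕ → ℕ) → List ((ℕ → ℕ) × ℕ)} {Q : List (ℕ → ℕ)} {σ' : State}
    (h : Store N preds Q σ) {p : Stmt} (hf : Frame p σ σ')
    (hw : ∀ a ∈ [w_rc, w_src, w_vert, w_next, w_head, w_qt, w_queue], a ∉ p.wordTargets) :
    Store N preds Q σ' := by
  simp only [List.mem_cons, List.not_mem_nil, or_false, forall_eq_or_imp, forall_eq] at hw
  obtain ⟨h0, h1, h2, h3, h4, h5, h6⟩ := hw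
  exact ⟨by rw [hf.word _ h0]; exact h.rc_pos, by
    rw [hf.word _ h0, hf.word _ h1, hf.word _ h2, hf.word _ h3, hf.word _ h4]; exact h.chain,
    by rw [hf.word _ h5, h.qt], by rw [hf.word _ h6]; exact h.queue⟩

theorem Store.setW {preds : (ℕ → ℕ) → List ((ℕ → ℕ) × ℕ)} {Q : List (ℕ → ℕ)}
    (h : Store N preds Q σ) {a i u : ℕ}
    (ha : a ∉ [w_rc, w_src, w_vert, w_next, w_head, w_qt, w_queue]) :
    Store N preds Q (σ.setW a i u) := by
  simp only [List.mem_cons, List.not_mem_nil, or_false, not_or] at ha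
  obtain ⟨h0, h1, h2, h3, h4, h5, h6⟩ := ha
  exact ⟨by simpa [Ne.symm h0] using h.rc_pos, by
    simpa [Ne.symm h0, Ne.symm h1, Ne.symm h2, Ne.symm h3, Ne.symm h4] using h.chain,
    by simpa [Ne.symm h5] using h.qt, by simpa [Ne.symm h6] using h.queue⟩

open Classical in
/-- The predecessor lists after recording a step from `val` to `val'`. -/
noncomputable def addPred (preds : (ℕ → ℕ) → List ((ℕ → ℕ) × ℕ)) (val : ℕ → ℕ) (v : ℕ)
    (val' : ℕ → ℕ) : (ℕ → ℕ) → List ((ℕ → ℕ) × ℕ) :=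
  Function.update preds val' ((val, v) :: preds val')

theorem addPred_self (preds : (ℕ → ℕ) → List ((ℕ → ℕ) × ℕ)) (val : ℕ → ℕ) (v : ℕ) (val' : ℕ → ℕ) :
    addPred preds val v val' val' = (val, v) :: preds val' := by
  classical
  exact Function.update_self ..

theorem addPred_of_ne (preds : (ℕ → ℕ) → List ((ℕ → ℕ) × ℕ)) (val : ℕ → ℕ) (v : ℕ) {val' c : ℕ → ℕ}
    (h : c ≠ val') : addPred preds val v val' c = preds c := by
  classical
  exact Function.update_of_ne h ..

open Classical in
/-- The queue after recording a step to `val'`. -/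
noncomputable def addQueue (preds : (ℕ → ℕ) → List ((ℕ → ℕ) × ℕ)) (Q : List (ℕ → ℕ))
    (val' : ℕ → ℕ) : List (ℕ → ℕ) :=
  if preds val' = [] ∧ val' ≠ 0 then Q ++ [val'] else Q

/-- The new record points to the old head of the list of `val'` and becomes its head. Other states
have other codes, so their lists keep their heads. -/
theorem wp_record {preds : (ℕ → ℕ) → List ((ℕ → ℕ) × ℕ)} {Q : List (ℕ → ℕ)} {val val' : ℕ → ℕ}
    {v : ℕ} (hS : Store N preds Q σ) (hc : σ.word w_c 0 = N.enc val) (hv : σ.word w_v 0 = v)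
    (hd : σ.word w_d 0 = N.enc val') (hb' : N.Bounded val') (hU : M ≤ U)
    (hrc : σ.word w_rc 0 + 1 < M) (hQ : Q.length + 1 < M) (hcM : N.enc val' < M) :
    WP M U record 20 (fun σ' => Store N (addPred preds val v val') (addQueue preds Q val') σ' ∧
      σ'.word w_rc 0 = σ.word w_rc 0 + 1) σ := by
  intro hfit
  have hcU : N.enc val < U := hc ▸ hfit.2 _ _
  have hvU : v < U := hv ▸ hfit.2 _ _
  have hhU := hfit.2 w_head (N.enc val')
  have hch := hS.chain val' hb'
  have hhead : σ.word w_head (N.enc val') = 0 ↔ preds val' = [] := hch.eq_zero_iff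
  have hzero : N.enc val' = 0 ↔ val' = 0 :=
    ⟨fun h => Net.enc_inj hb' Net.Bounded.zero (h.trans Net.enc_zero.symm),
      fun h => h ▸ Net.enc_zero⟩
  have hqt := hS.qt
  refine (?_ : WP M U record _ _ σ) hfit
  refine wp_seq 1 (by omega) (wp_wset le_rfl (by decide) (by simp [WExpr.eval]; omega)
    (by simpa [WExpr.eval, hc] using hcU) ?_)
  refine wp_seq 1 (by omega) (wp_wset le_rfl (by decide) (by simp [WExpr.eval]; omega)
    (by simpa [WExpr.eval, hv] using hvU) ?_)
  refine wp_seq 1 (by omega) (wp_wset le_rfl (by decide) (by simp [WExpr.eval]; omega)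
    (by simpa [WExpr.eval, hd] using hhU) ?_)
  simp only [WExpr.eval, State.setW_word, Nat.reduceEqDiff, if_false, hc, hv, hd]
  set r := σ.word w_rc 0 with hr
  set σ₁ := ((σ.setW w_src r (N.enc val)).setW w_vert r v).setW w_next r
    (σ.word w_head (N.enc val')) with hσ₁
  have main : ∀ (σ₂ : State) (Q' : List (ℕ → ℕ)), (∀ a, a ≠ w_queue → a ≠ w_qt → σ₂.word a = σ₁.word a) →
      σ₂.word w_qt 0 = Q'.length → (∀ i (h : i < Q'.length), σ₂.word w_queue i = N.enc Q'[i]) →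
      WP M U (.seq (.wset w_head (.var w_d) (.var w_rc))
        (.setVar w_rc (.add (.var w_rc) (.const 1)))) 5
        (fun σ' => Store N (addPred preds val v val') Q' σ' ∧ σ'.word w_rc 0 = r + 1) σ₂ := by
    intro σ₂ Q' hsame hq1 hq2
    have e_d : σ₂.word w_d 0 = N.enc val' := by
      rw [hsame w_d (by decide) (by decide)]; simp [hσ₁, hd]
    have e_rc : σ₂.word w_rc 0 = r := by
      rw [hsame w_rc (by decide) (by decide)]; simp [hσ₁, hr]
    have e_src : σ₂.word w_src = Function.update (σ.word w_src) r (N.enc val) := by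
      rw [hsame w_src (by decide) (by decide)]; simp [hσ₁]
    have e_vert : σ₂.word w_vert = Function.update (σ.word w_vert) r v := by
      rw [hsame w_vert (by decide) (by decide)]; simp [hσ₁]
    have e_next : σ₂.word w_next = Function.update (σ.word w_next) r (σ.word w_head (N.enc val')) := by
      rw [hsame w_next (by decide) (by decide)]; simp [hσ₁]
    have e_head : σ₂.word w_head = σ.word w_head := by
      rw [hsame w_head (by decide) (by decide)]; simp [hσ₁]
    refine wp_seq 1 (by omega) (wp_wset le_rfl (by decide) (by simp only [WExpr.eval, e_d]; omega)
      (by simp only [WExpr.eval, e_rc]; omega) (wp_wset (by omega) (by decide)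
        (by simp only [WExpr.eval]; omega) (by simp [WExpr.eval, e_rc]; omega) ⟨?_, ?_⟩))
    · have hold : ∀ {r' : ℕ} {l : List ((ℕ → ℕ) × ℕ)},
          Chain N (σ.word w_src) (σ.word w_vert) (σ.word w_next) r r' l →
          Chain N (Function.update (σ.word w_src) r (N.enc val)) (Function.update (σ.word w_vert) r v)
            (Function.update (σ.word w_next) r (σ.word w_head (N.enc val'))) (r + 1) r' l := by
        intro r' l h
        refine h.congr (by omega) ?_ ?_ ?_ <;>
        · intro i hi
          rw [Function.update_of_ne (by omega)]
      refine ⟨by simp [WExpr.eval, e_rc], fun u hu => ?_, by simpa using hq1, by simpa using hq2⟩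
      simp only [State.setW_word, WExpr.eval, Nat.reduceEqDiff, if_false, if_true, e_d, e_rc, e_src,
        e_vert, e_next, e_head, Function.update_self]
      by_cases huv : u = val'
      · subst huv
        simp only [Function.update_self, addPred_self]
        refine ⟨hS.rc_pos, by omega, ?_, ?_, ?_⟩
        · simp
        · simp
        · simp only [Function.update_self]
          exact hold hch
      · rw [addPred_of_ne _ _ _ huv, Function.update_of_ne fun h => huv (Net.enc_inj hu hb' h)]
        exact hold (hS.chain u hu)
    · simp [WExpr.eval, e_rc]
  have hcond : (Cond.and (.weq (.get w_head (.var w_d)) (.const 0)) (nzC (.var w_d))).Holds σ₁ ↔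
      preds val' = [] ∧ val' ≠ 0 := by
    rw [← hhead, Ne, ← hzero]
    simp [Cond.Holds, WExpr.eval, hσ₁, hd]
  refine wp_seq 5 (by omega) ((?_ : WP M U _ 5 (fun σ₂ =>
    (∀ a, a ≠ w_queue → a ≠ w_qt → σ₂.word a = σ₁.word a) ∧
      σ₂.word w_qt 0 = (addQueue preds Q val').length ∧
      ∀ i (h : i < (addQueue preds Q val').length),
        σ₂.word w_queue i = N.enc (addQueue preds Q val')[i]) σ₁).mono le_rfl
    fun σ₂ _ h => (main σ₂ _ h.1 h.2.1 h.2.2).mono (by omega) fun _ _ h => h)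
  have q1 : σ₁.word w_qt 0 = Q.length := by simp [hσ₁, hqt]
  have q2 : σ₁.word w_queue = σ.word w_queue := by simp [hσ₁]
  have q3 : σ₁.word w_d 0 = N.enc val' := by simp [hσ₁, hd]
  refine wp_ite (by omega) (fun h => ?_) (fun h => wp_skip (by omega) ?_)
  · rw [hcond] at h
    refine wp_seq 1 (by omega) (wp_wset le_rfl (by decide) (by simp only [WExpr.eval, q1]; omega)
      (by simp only [WExpr.eval, q3]; omega) (wp_wset (by omega) (by decide)
        (by simp only [WExpr.eval]; omega) (by simp [WExpr.eval, q1]; omega) ?_))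
    refine ⟨fun a h1 h2 => ?_, ?_, fun i hi => ?_⟩
    · simp [h1, h2]
    · simp [addQueue, h, WExpr.eval, q1]
    · simp only [addQueue, if_pos h, List.length_append, List.length_singleton] at hi
      simp only [addQueue, if_pos h, State.setW_word, WExpr.eval, Nat.reduceEqDiff, if_false, if_true,
        q1, q2, q3]
      rw [Function.update_apply]
      split_ifs with h1
      · simp [h1]
      · rw [List.getElem_append_left (by omega)]
        exact hS.queue i (by omega)
  · rw [hcond] at h
    refine ⟨fun a _ _ => rfl, ?_, fun i hi => ?_⟩
    · rw [addQueue, if_neg h, q1]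
    · simp only [addQueue, if_neg h, q2] at hi ⊢
      exact hS.queue i hi

/-- The predecessor lists hold exactly the steps in `T`, and the queue holds the states reached. -/
structure Explored (T : (ℕ → ℕ) → ℕ → (ℕ → ℕ) → Prop) (preds : (ℕ → ℕ) → List ((ℕ → ℕ) × ℕ))
    (Q : List (ℕ → ℕ)) : Prop where
  mem : ∀ val p v, (p, v) ∈ preds val ↔ T p v val
  nodup : ∀ val, (preds val).Nodup
  queue_nodup : Q.Nodup
  mem_queue : ∀ val, val ∈ Q ↔ val = 0 ∨ preds val ≠ []

/-- `hT` says that the step is new, which keeps the predecessor list free of repetitions. -/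
theorem Explored.add {T T' : (ℕ → ℕ) → ℕ → (ℕ → ℕ) → Prop} {preds : (ℕ → ℕ) → List ((ℕ → ℕ) × ℕ)}
    {Q : List (ℕ → ℕ)} (h : Explored T preds Q) {val val' : ℕ → ℕ} {v : ℕ} (hT : ¬ T val v val')
    (hT' : ∀ p u c, T' p u c ↔ T p u c ∨ (p = val ∧ u = v ∧ c = val')) :
    Explored T' (addPred preds val v val') (addQueue preds Q val') := by
  refine ⟨fun c p u => ?_, fun c => ?_, ?_, fun c => ?_⟩
  · rw [hT', ← h.mem]
    by_cases hc : c = val'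
    · subst hc
      simp only [addPred_self, List.mem_cons, Prod.mk.injEq]
      tauto
    · rw [addPred_of_ne _ _ _ hc]
      simp [hc]
  · by_cases hc : c = val'
    · subst hc
      simp only [addPred_self, List.nodup_cons, h.mem, hT, not_false_iff, true_and]
      exact h.nodup c
    · rw [addPred_of_ne _ _ _ hc]
      exact h.nodup c
  · rw [addQueue]
    split_ifs with hc
    · refine List.nodup_append.2 ⟨h.queue_nodup, by simp, ?_⟩
      rintro a ha b hb rfl
      rw [List.mem_singleton] at hb
      subst hb
      rcases (h.mem_queue a).1 ha with h0 | h0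
      · exact hc.2 h0
      · exact h0 hc.1
    · exact h.queue_nodup
  · rw [addQueue]
    by_cases hc : c = val'
    · subst hc
      simp only [addPred_self, ne_eq, reduceCtorEq, not_false_iff, or_true, iff_true]
      split_ifs with h0
      · simp
      · rw [h.mem_queue]; tauto
    · rw [addPred_of_ne _ _ _ hc, ← h.mem_queue]
      split_ifs with h0
      · simp [hc]
      · rfl

/-- The steps from the states in `P`. -/
def StepsFrom (N : Net) (P : List (ℕ → ℕ)) (p : ℕ → ℕ) (v : ℕ) (c : ℕ → ℕ) : Prop :=
  p ∈ P ∧ N.Trans p v c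

theorem StepsFrom.mem_states (hN : N.Valid k) {P : List (ℕ → ℕ)} (hP : ∀ p ∈ P, p ∈ Net.states hN)
    {p c : ℕ → ℕ} {v : ℕ} (h : StepsFrom N P p v c) : c ∈ Net.states hN := by
  obtain ⟨ws, hw⟩ := Net.mem_states.1 (hP p h.1)
  obtain ⟨us, -, -, hu⟩ := h.2.reach hN hw
  exact Net.mem_states.2 ⟨_, hu⟩

theorem zero_mem_states (hN : N.Valid k) : (0 : ℕ → ℕ) ∈ Net.states hN :=
  Net.mem_states.2 ⟨[], .nil⟩

/-- The queue consists of distinct reachable states, so it fits into memory. -/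
theorem Explored.length_le (hN : N.Valid k) {T : (ℕ → ℕ) → ℕ → (ℕ → ℕ) → Prop}
    {preds : (ℕ → ℕ) → List ((ℕ → ℕ) × ℕ)} {Q : List (ℕ → ℕ)} (h : Explored T preds Q)
    (hT : ∀ p v c, T p v c → c ∈ Net.states hN) :
    Q.length ≤ 1 + ∑ val ∈ Net.states hN, N.trials val := by
  classical
  refine le_trans ?_ (Net.card_states_le hN)
  rw [← List.toFinset_card_of_nodup h.queue_nodup]
  refine Finset.card_le_card fun val hval => ?_
  rcases (h.mem_queue val).1 (List.mem_toFinset.1 hval) with rfl | h0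
  · exact zero_mem_states hN
  · obtain ⟨⟨p, v⟩, hq⟩ := List.exists_mem_of_ne_nil _ h0
    exact hT p v val ((h.mem val p v).1 hq)

open Classical in
/-- The number of choices tried in the states in `P`. -/
noncomputable def trialsOf (N : Net) (P : List (ℕ → ℕ)) : ℕ := ∑ val ∈ P.toFinset, N.trials val

theorem trialsOf_append {P : List (ℕ → ℕ)} {val : ℕ → ℕ} (h : val ∉ P) :
    trialsOf N (P ++ [val]) = trialsOf N P + N.trials val := by
  classical
  have hn : val ∉ P.toFinset := by simpa using h
  rw [trialsOf, trialsOf, List.toFinset_append, List.toFinset_cons, List.toFinset_nil,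
    Finset.sum_union (by simp [hn])]
  simp

theorem trialsOf_le (hN : N.Valid k) {P : List (ℕ → ℕ)} (h : ∀ p ∈ P, p ∈ Net.states hN) :
    trialsOf N P ≤ ∑ val ∈ Net.states hN, N.trials val := by
  classical
  exact Finset.sum_le_sum_of_subset fun p hp => h p (List.mem_toFinset.1 hp)

/-- What holds between the steps of the exploration, when the states in `P` are done. -/
structure Progress (N : Net) (T : (ℕ → ℕ) → ℕ → (ℕ → ℕ) → Prop) (P : List (ℕ → ℕ)) (b : ℕ)
    (preds : (ℕ → ℕ) → List ((ℕ → ℕ) × ℕ)) (Q : List (ℕ → ℕ)) (σ : State) : Prop where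
  store : Store N preds Q σ
  explored : Explored T preds Q
  done : P <+: Q
  rc : σ.word w_rc 0 ≤ b

/-- No step is recorded twice: the queue has no repetitions, so `val` was not processed before, and
different choices lead to different states by `next_inj`. -/
theorem wp_tryAll (hL : Lim N k M U) {val : ℕ → ℕ} {v : ℕ} {ws : List ℕ} {P : List (ℕ → ℕ)}
    {preds : (ℕ → ℕ) → List ((ℕ → ℕ) × ℕ)} {Q : List (ℕ → ℕ)}
    (hR : Ready N val v σ) (hr : N.Reach ws val) (hws : ws.length < N.n) (hv : N.Adm val v)
    (hnd : σ.word w_nd 0 = N.choices v)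
    (hP : ∀ p ∈ P, p ∈ Net.states hL.valid)
    (hI : Progress N (StepsFrom N P) (P ++ [val]) (1 + trialsOf N P) preds Q σ) :
    WP M U tryAll (N.choices v * (36 * (N.m + 1) * (k + 1) + 30) + 3) (fun σ' => ∃ preds Q,
      Progress N (StepsFrom N (P ++ [val])) (P ++ [val]) (1 + trialsOf N (P ++ [val])) preds Q σ') σ := by
  have hnM := hL.n_lt
  have hU := hL.words
  have hsteps := hL.steps
  have hi := hr.inv hL.valid
  have hvP : val ∉ P := by
    intro hc
    have := (List.Sublist.nodup hI.done.sublist hI.explored.queue_nodup)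
    rw [List.nodup_append] at this
    exact this.2.2 val hc val (by simp) rfl
  have hPv : ∀ p ∈ P ++ [val], p ∈ Net.states hL.valid := by
    intro p hp
    rcases List.mem_append.1 hp with hp | hp
    · exact hP p hp
    · rw [List.mem_singleton.1 hp]; exact Net.mem_states.2 ⟨ws, hr⟩
  have htr := trialsOf_append (N := N) hvP
  have hle := trialsOf_le hL.valid hPv
  have htv := Net.trials_of_adm hv
  -- The steps that have to be on record when the choices below `x` have been tried.
  let T : ℕ → (ℕ → ℕ) → ℕ → (ℕ → ℕ) → Prop := fun x p u c => StepsFrom N P p u c ∨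
    (p = val ∧ u = v ∧ ∃ y < x, N.Good val v y ∧ c = N.next val v y)
  have hTstates : ∀ x ≤ N.choices v, ∀ p u c, T x p u c → c ∈ Net.states hL.valid := by
    rintro x hx p u c (h | ⟨rfl, rfl, y, hy, hg, rfl⟩)
    · exact h.mem_states hL.valid hP
    · exact Net.mem_states.2 ⟨_, hr.snoc hws ⟨hv, y, by omega, hg, rfl⟩⟩
  refine wp_for (fun x σ' => ∃ preds Q, Progress N (T x) (P ++ [val])
      (1 + trialsOf N P + x) preds Q σ') (fun _ => 36 * (N.m + 1) * (k + 1) + 27) (N.choices v)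
    (by simp) (by decide) (by omega) ((hL.choices_lt v).trans_le hU) (by decide) ?_
    ⟨preds, Q, hI.store.setW (by decide), ?_, hI.done, by simpa using hI.rc⟩ ?_ ?_
  · intro σ' hF
    simp only [WExpr.eval]
    rw [hF.word w_nd (by decide), hnd]
  · have : T 0 = StepsFrom N P := by
      funext p u c
      simp [T]
    rw [this]
    exact hI.explored
  · rintro x hx σ₁ hF₁ hx₁ ⟨preds, Q, hI₁⟩
    have hR₁ := hR.frame hF₁ (by decide) (by decide) (by decide)
    refine wp_seq (36 * (N.m + 1) * (k + 1)) (by omega)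
      ((wp_tryChoice hL hR₁ hr hws hv hx₁).mono le_rfl ?_)
    rintro σ₂ hF₂ ⟨hd, hok⟩
    have hR₂ := hR₁.frame hF₂ (by decide) (by decide) (by decide)
    have hS₂ := hI₁.store.frame hF₂ (by decide)
    have hrc₂ : σ₂.word w_rc 0 ≤ 1 + trialsOf N P + x := by
      rw [hF₂.word w_rc (by decide)]; exact hI₁.rc
    refine wp_ite (by omega) (fun hc => ?_) (fun hc => wp_skip (by omega) ?_)
    · have hg : N.Good val v x := hok.1 (by simpa [Cond.Holds, WExpr.eval] using hc)
      have hb' := hi.next_bounded hL.valid hws v x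
      have hlen := hI₁.explored.length_le hL.valid (hTstates x hx.le)
      refine (wp_record hS₂ hR₂.c hR₂.vertex hd hb' hU (by omega) (by omega)
        ((Net.enc_lt hb' (hi.next_supp_le hL.valid hws hv x)).trans hL.codes)).mono (by omega) ?_
      rintro σ₃ - ⟨hS₃, hrc₃⟩
      refine ⟨_, _, hS₃.setW (by decide), hI₁.explored.add (val := val) (v := v) ?_ ?_, ?_, ?_⟩
      · rintro (h | ⟨-, -, y, hy, -, heq⟩)
        · exact hvP h.1
        · have := Net.next_inj hL.valid hx (hy.trans hx) heq
          omega
      · intro p u c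
        simp only [T, Nat.lt_succ_iff_lt_or_eq]
        constructor
        · rintro (h | ⟨h1, h2, y, hy | rfl, h4, h5⟩)
          · exact Or.inl (Or.inl h)
          · exact Or.inl (Or.inr ⟨h1, h2, y, hy, h4, h5⟩)
          · exact Or.inr ⟨h1, h2, h5⟩
        · rintro ((h | ⟨h1, h2, y, hy, h4, h5⟩) | ⟨h1, h2, h3⟩)
          · exact Or.inl h
          · exact Or.inr ⟨h1, h2, y, Or.inl hy, h4, h5⟩
          · exact Or.inr ⟨h1, h2, x, Or.inr rfl, hg, h3⟩
      · refine hI₁.done.trans ?_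
        rw [addQueue]
        split_ifs
        · exact List.prefix_append _ _
        · exact List.prefix_rfl
      · simp only [State.setW_word, Nat.reduceEqDiff, if_false, hrc₃]
        omega
    · have hg : ¬ N.Good val v x := fun h => hc (by simpa [Cond.Holds, WExpr.eval] using hok.2 h)
      have hT : T (x + 1) = T x := by
        funext p u c
        simp only [T, Nat.lt_succ_iff_lt_or_eq]
        refine propext ⟨?_, ?_⟩
        · rintro (h | ⟨h1, h2, y, hy | rfl, h4, h5⟩)
          · exact Or.inl h
          · exact Or.inr ⟨h1, h2, y, hy, h4, h5⟩
          · exact absurd h4 hg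
        · rintro (h | ⟨h1, h2, y, hy, h4, h5⟩)
          · exact Or.inl h
          · exact Or.inr ⟨h1, h2, y, Or.inl hy, h4, h5⟩
      refine ⟨preds, Q, hS₂.setW (by decide), by rw [hT]; exact hI₁.explored, hI₁.done, ?_⟩
      simp only [State.setW_word, Nat.reduceEqDiff, if_false]
      omega
  · rintro σ' - ⟨preds, Q, hI'⟩
    refine ⟨preds, Q, hI'.store, ?_, hI'.done, ?_⟩
    · have hT : StepsFrom N (P ++ [val]) = T (N.choices v) := by
        funext p u c
        simp only [T, StepsFrom, List.mem_append, List.mem_singleton]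
        refine propext ⟨?_, ?_⟩
        · rintro ⟨h | rfl, ht⟩
          · exact Or.inl ⟨h, ht⟩
          · obtain rfl := ht.1.unique hv
            exact Or.inr ⟨rfl, rfl, ht.2⟩
        · rintro (⟨h1, h2⟩ | ⟨rfl, rfl, h⟩)
          · exact ⟨Or.inl h1, h2⟩
          · exact ⟨Or.inr rfl, hv, h⟩
      rw [hT]
      exact hI'.explored
    · rw [htr, htv, ← add_assoc]
      exact hI'.rc

theorem concat_getElem_prefix {α : Type*} {P Q : List α} (h : P <+: Q) (hc : P.length < Q.length) :
    P ++ [Q[P.length]] <+: Q := by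
  obtain ⟨R, rfl⟩ := h
  cases R with
  | nil => simp at hc
  | cons a R => simp

/-- The time needed per state and choice. -/
abbrev unitCost (N : Net) (k : ℕ) : ℕ := 200 * (N.m + 1) * (k + 1)

/-- The list `P` of processed states is a prefix of the queue, and the remaining budget is a sum
over the reachable states outside `P`. When the queue is exhausted, `P` contains the initial state
and is closed under steps, so it contains every reachable state. -/
theorem wp_explore (hL : Lim N k M U) (hE : Env N σ) (hhead : ∀ i, σ.word w_head i = 0)
    (hqh : σ.word w_qh 0 = 0) (hqueue : σ.word w_queue 0 = 0) :
    WP M U explore (unitCost N k * ∑ val ∈ Net.states hL.valid, (1 + N.trials val) + 10)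
      (fun σ' => ∃ preds Q, Store N preds Q σ' ∧ σ'.word w_rc 0 < M ∧
        Explored (fun p v c => p ∈ Net.states hL.valid ∧ N.Trans p v c) preds Q) σ := by
  classical
  have hnM := hL.n_lt
  have h2 := hL.valid.two_le
  have hU := hL.words
  have hsteps := hL.steps
  refine wp_seq 1 (by omega) (wp_wset le_rfl (by decide) (by simp only [WExpr.eval]; omega)
    (by simp only [WExpr.eval]; omega) ?_)
  refine wp_seq 1 (by omega) (wp_wset le_rfl (by decide) (by simp only [WExpr.eval]; omega)
    (by simp only [WExpr.eval]; omega) ?_)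
  simp only [WExpr.eval]
  have hE₁ : Env N ((σ.setW w_qt 0 1).setW w_rc 0 1) := (hE.setW (by decide)).setW (by decide)
  refine wp_loop (fun φ σ' => ∃ P preds Q, (∀ p ∈ P, p ∈ Net.states hL.valid) ∧
      σ'.word w_qh 0 = P.length ∧
      Progress N (StepsFrom N P) P (1 + trialsOf N P) preds Q σ' ∧
      φ = unitCost N k * ∑ val ∈ Net.states hL.valid \ P.toFinset, (1 + N.trials val))
    (unitCost N k * ∑ val ∈ Net.states hL.valid, (1 + N.trials val)) (by omega)
    -- The initial queue needs no write: its entry `0` is `0`, which is the code of the zero state.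
    ⟨[], fun _ => [], [0], by simp, by simp [hqh], ⟨⟨by simp, ?_, by simp, ?_⟩, ?_, by simp,
      by simp⟩, by simp⟩ ?_ ?_
  · intro val _
    simp [Chain, hhead]
  · intro i hi
    simp only [List.length_singleton, Nat.lt_one_iff] at hi
    subst hi
    simp [hqueue, Net.enc_zero]
  · refine ⟨?_, by simp, by simp, by simp⟩
    simp [StepsFrom]
  · rintro _ σ₁ hF₁ ⟨P, preds, Q, hP, hqh₁, hI, rfl⟩ hc
    have hE₁' := hE₁.frame hF₁ (by decide) (by decide)
    have hqt := hI.store.qt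
    simp only [Cond.Holds, WExpr.eval, hqh₁, hqt] at hc
    have htake := concat_getElem_prefix hI.done hc
    set val := Q[P.length] with hval
    have hvP : val ∉ P := by
      intro hc
      have := (List.Sublist.nodup htake.sublist hI.explored.queue_nodup)
      rw [List.nodup_append] at this
      exact this.2.2 val hc val (by simp) rfl
    have hstates : ∀ p v c, StepsFrom N P p v c → c ∈ Net.states hL.valid :=
      fun p v c h => h.mem_states hL.valid hP
    have hlen := hI.explored.length_le hL.valid hstates
    have hvs : val ∈ Net.states hL.valid := by
      rcases (hI.explored.mem_queue val).1 (List.getElem_mem hc) with h0 | h0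
      · rw [h0]; exact zero_mem_states hL.valid
      · obtain ⟨⟨p, v⟩, hq⟩ := List.exists_mem_of_ne_nil _ h0
        exact hstates p v val ((hI.explored.mem val p v).1 hq)
    obtain ⟨ws, hws, hr⟩ := Net.exists_reach_lt hL.valid hvs
    have hPv : ∀ p ∈ P ++ [val], p ∈ Net.states hL.valid := by
      intro p hp
      rcases List.mem_append.1 hp with hp | hp
      · exact hP p hp
      · rw [List.mem_singleton.1 hp]; exact hvs
    have htr := trialsOf_append (N := N) hvP
    have hcost : unitCost N k * ∑ u ∈ Net.states hL.valid \ P.toFinset, (1 + N.trials u) =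
        unitCost N k * ∑ u ∈ Net.states hL.valid \ (P ++ [val]).toFinset, (1 + N.trials u) +
          unitCost N k * (1 + N.trials val) := by
      rw [← mul_add]
      congr 1
      have : Net.states hL.valid \ P.toFinset =
          insert val (Net.states hL.valid \ (P ++ [val]).toFinset) := by
        ext u
        simp only [Finset.mem_sdiff, List.mem_toFinset, Finset.mem_insert, List.mem_append,
          List.mem_singleton, not_or]
        by_cases hu : u = val
        · simp [hu, hvs, hvP]
        · simp [hu]
      rw [this, Finset.sum_insert (by simp)]
      ring
    -- The missing unit pays for the loop test.
    refine ⟨unitCost N k * (1 + N.trials val) - 1, ?_⟩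
    have hunit : 40 * N.m + 50 + N.trials val * (36 * (N.m + 1) * (k + 1) + 30) + 30 ≤
        unitCost N k * (1 + N.trials val) := by
      have h1 : 36 * (N.m + 1) * (k + 1) + 30 ≤ unitCost N k := by
        have : 1 ≤ (N.m + 1) * (k + 1) := by nlinarith
        simp only [unitCost, mul_assoc]; omega
      have h2 : 40 * N.m + 80 ≤ unitCost N k := by simp only [unitCost]; nlinarith
      nlinarith [Nat.mul_le_mul_left (N.trials val) h1]
    refine wp_seq (40 * N.m + 50) (by omega) ((wp_prepare hL hE₁' hr hws ?_ ?_).mono le_rfl ?_)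
    · rw [hqh₁, hI.store.queue _ hc]
    · omega
    rintro σ₂ hF₂ ⟨g1, g2, g3, g4, g5, g6⟩
    have hE₂ := hE₁'.frame hF₂ (by decide) (by decide)
    have hI₂ : Progress N (StepsFrom N P) (P ++ [val]) (1 + trialsOf N P) preds Q σ₂ :=
      ⟨hI.store.frame hF₂ (by decide), hI.explored, htake, by
        rw [hF₂.word w_rc (by decide)]; exact hI.rc⟩
    refine wp_ite (by omega) (fun hadm => ?_) (fun hadm => wp_skip (by omega) ?_)
    · obtain ⟨hv, hnd⟩ := g5 (by simpa [Cond.Holds, WExpr.eval] using hadm)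
      have htv := Net.trials_of_adm hv
      rw [htv] at hunit ⊢
      refine (wp_tryAll hL ⟨hE₂, g3, rfl, g4, g1⟩ hr hws hv hnd hP hI₂).mono (by omega) ?_
      rintro σ₃ hF₃ ⟨preds', Q', hI₃⟩
      refine ⟨_, ?_, P ++ [val], preds', Q', hPv, ?_, hI₃, rfl⟩
      · rw [hcost, htv]; omega
      · rw [hF₃.word w_qh (by decide), g2, hqh₁]; simp
    · have hno := g6 (by simpa [Cond.Holds, WExpr.eval] using hadm)
      refine ⟨_, ?_, P ++ [val], preds, Q, hPv, ?_, ⟨hI₂.store, ?_, htake, ?_⟩, rfl⟩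
      · rw [hcost]; omega
      · rw [g2, hqh₁]; simp
      · have hT : StepsFrom N (P ++ [val]) = StepsFrom N P := by
          funext p u c
          simp only [StepsFrom, List.mem_append, List.mem_singleton]
          refine propext ⟨?_, fun h => ⟨Or.inl h.1, h.2⟩⟩
          rintro ⟨h | rfl, ht⟩
          · exact ⟨h, ht⟩
          · exact absurd ht.1 (hno u)
        rw [hT]
        exact hI.explored
      · have := hI₂.rc
        omega
  · rintro _ σ₁ hF₁ ⟨P, preds, Q, hP, hqh₁, hI, rfl⟩ hc
    have hqt := hI.store.qt
    simp only [Cond.Holds, WExpr.eval, hqh₁, hqt] at hc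
    have hPQ : P = Q := hI.done.eq_of_length_le (by omega)
    subst hPQ
    have hall : ∀ {ws val}, N.Reach ws val → val ∈ P := by
      intro ws val h
      induction h with
      | nil => exact (hI.explored.mem_queue 0).2 (Or.inl rfl)
      | @snoc ws p v val hr hl ht ih =>
        refine (hI.explored.mem_queue val).2 (Or.inr fun h0 => ?_)
        have := (hI.explored.mem val p v).2 ⟨ih, ht⟩
        rw [h0] at this
        simp at this
    refine ⟨preds, P, hI.store, ?_, ?_⟩
    · have h1 := hI.rc
      have h2 := trialsOf_le hL.valid hP
      omega
    · have hT : (fun p v c => p ∈ Net.states hL.valid ∧ N.Trans p v c) = StepsFrom N P := by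
        funext p u c
        refine propext ⟨fun h => ⟨?_, h.2⟩, fun h => ⟨hP p h.1, h.2⟩⟩
        obtain ⟨ws, hw⟩ := Net.mem_states.1 h.1
        exact hall hw
      rw [hT]
      exact hI.explored

end Upward

namespace Upward
open RealRAM Prog
variable {N : Net} {k M U : ℕ} {σ : State}

/-! ### Walking back through the predecessor lists -/

/-- The lists `ws ++ acc` where the vertices in `ws` are placed on the way to `val`, which has
level `j`. -/
def outs (preds : (ℕ → ℕ) → List ((ℕ → ℕ) × ℕ)) : ℕ → (ℕ → ℕ) → List ℕ → List (List ℕ)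
  | 0, _, acc => [acc]
  | j + 1, val, acc => (preds val).flatMap fun q => outs preds j q.1 (q.2 :: acc)

/-- All ways to reach the state `val` have `j` steps, apart from the empty one if `0 < j`. -/
structure AtLevel (N : Net) (j : ℕ) (val : ℕ → ℕ) : Prop where
  zero : j = 0 → val = 0
  length : 0 < j → ∀ ws, N.Reach ws val → ws ≠ [] → ws.length = j

theorem Net.Reach.atLevel (hN : N.Valid k) {ws : List ℕ} {val : ℕ → ℕ} (h : N.Reach ws val) :
    AtLevel N ws.length val := by
  refine ⟨fun h0 => ?_, fun h0 us hu hne => hu.length_eq hN h hne (List.length_pos_iff.1 h0)⟩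
  rw [List.length_eq_zero_iff] at h0
  subst h0
  cases hv : (([] : List ℕ)) with
  | nil =>
    have hi := h.inv hN
    funext e
    rcases lt_or_ge e N.m with he | he
    · by_contra hv
      exact absurd ((hi.supp e he).1 hv).1 (by simp)
    · exact hi.out e he
  | cons => simp at hv

/-- The zero state is visited at the start and after all `n` vertices, and at no other time; apart
from the empty sweep, its level is `n`. -/
theorem atLevel_zero (hN : N.Valid k) : AtLevel N N.n 0 := by
  refine ⟨fun _ => rfl, fun _ ws hw hne => ?_⟩
  have hi := hw.inv hN
  rcases hi.length_le.eq_or_lt with h | h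
  · exact h
  · exact absurd (hi.eq_nil hN h) hne

section
variable {preds : (ℕ → ℕ) → List ((ℕ → ℕ) × ℕ)} {Q : List (ℕ → ℕ)} (hN : N.Valid k)
  (hX : Explored (fun p v c => p ∈ Net.states hN ∧ N.Trans p v c) preds Q)
include hX

/-- The predecessor is reachable, so some sweep ends with this step; all nonempty sweeps to `val`
have the same length, which fixes the level of the predecessor. -/
theorem exists_reach_of_mem_preds {j : ℕ} {val p : ℕ → ℕ} {v : ℕ} (hl : AtLevel N (j + 1) val)
    (h : (p, v) ∈ preds val) :
    (∃ ws, ws.length = j ∧ j < N.n ∧ N.Reach ws p) ∧ N.Trans p v val := by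
  obtain ⟨hp, ht⟩ := (hX.mem val p v).1 h
  obtain ⟨ws, hr⟩ := Net.mem_states.1 hp
  obtain ⟨us, hu, hur, huv⟩ := ht.reach hN hr
  have := hl.length (by omega) _ huv (by simp)
  rw [List.length_append, List.length_singleton] at this
  exact ⟨⟨us, by omega, by omega, hur⟩, ht⟩

/-- Induction on the level: removing the last step of a sweep corresponds to choosing an entry of
the predecessor list. -/
theorem mem_outs {j : ℕ} {val : ℕ → ℕ} {acc vs : List ℕ} (hl : AtLevel N j val) :
    vs ∈ outs preds j val acc ↔ ∃ ws, ws.length = j ∧ N.Reach ws val ∧ vs = ws ++ acc := by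
  induction j generalizing val acc with
  | zero =>
    rw [hl.zero rfl, outs, List.mem_singleton]
    constructor
    · rintro rfl
      exact ⟨[], rfl, .nil, rfl⟩
    · rintro ⟨ws, h, -, rfl⟩
      rw [List.length_eq_zero_iff] at h
      simp [h]
  | succ j ih =>
    simp only [outs, List.mem_flatMap, Prod.exists]
    constructor
    · rintro ⟨p, v, hpv, hvs⟩
      obtain ⟨⟨us, hu, hj, hur⟩, ht⟩ := exists_reach_of_mem_preds hN hX hl hpv
      obtain ⟨ws, hw, hwr, rfl⟩ := (ih (hu ▸ hur.atLevel hN)).1 hvs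
      exact ⟨ws ++ [v], by simp [hw], hwr.snoc (by omega) ht, by simp⟩
    · rintro ⟨ws, hw, hwr, rfl⟩
      cases hwr with
      | nil => simp at hw
      | @snoc us p v _ hr hlt ht =>
        rw [List.length_append, List.length_singleton] at hw
        refine ⟨p, v, (hX.mem _ _ _).2 ⟨Net.mem_states.2 ⟨us, hr⟩, ht⟩, ?_⟩
        obtain rfl : us.length = j := by omega
        exact (ih (hr.atLevel hN)).2 ⟨us, rfl, hr, by simp⟩

/-- If two predecessors gave the same list, the vertices placed before the step and by the step
would agree, so by `Trans.unique` the predecessors would agree. -/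
theorem nodup_outs {j : ℕ} {val : ℕ → ℕ} {acc : List ℕ} (hl : AtLevel N j val) :
    (outs preds j val acc).Nodup := by
  induction j generalizing val acc with
  | zero => simp [outs]
  | succ j ih =>
    rw [outs, List.nodup_flatMap]
    have hlev : ∀ q ∈ preds val, AtLevel N j q.1 := by
      intro q hq
      obtain ⟨⟨us, hu, -, hur⟩, -⟩ := exists_reach_of_mem_preds hN hX hl hq
      exact hu ▸ hur.atLevel hN
    refine ⟨fun q hq => ih (hlev q hq), ?_⟩
    refine (List.pairwise_iff_forall_sublist).2 fun {q q'} hsub => ?_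
    have hq : q ∈ preds val := hsub.subset (by simp)
    have hq' : q' ∈ preds val := hsub.subset (by simp)
    have hne : q ≠ q' := by
      have := hsub.nodup (hX.nodup val)
      simpa using this
    intro vs h1 h2
    refine hne ?_
    obtain ⟨ws, hw, hr, rfl⟩ := (mem_outs hN hX (hlev q hq)).1 h1
    obtain ⟨ws', hw', hr', he⟩ := (mem_outs hN hX (hlev q' hq')).1 h2
    obtain ⟨rfl, he⟩ := List.append_inj he (by omega)
    obtain ⟨⟨us, hu, hj, hur⟩, ht⟩ := exists_reach_of_mem_preds hN hX hl hq
    obtain ⟨-, ht'⟩ := exists_reach_of_mem_preds hN hX hl hq'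
    have hv : q.2 = q'.2 := by simpa using he
    rw [← hv] at ht'
    exact Prod.ext (Net.Trans.unique hN hr hr' (by omega) ht ht') hv

/-- There are no dead ends on the way back, and this is what bounds the delay. -/
theorem outs_ne_nil {ws : List ℕ} {val : ℕ → ℕ} {acc : List ℕ} (h : N.Reach ws val) :
    outs preds ws.length val acc ≠ [] :=
  List.ne_nil_of_mem ((mem_outs hN hX (h.atLevel hN)).2 ⟨ws, rfl, h, rfl⟩)

end

/-! ### Depth-first enumeration with one list of pending alternatives per position -/

/-- The contents of `stack` at the positions from `i` on. -/
def stackFrom (n : ℕ) (stack : ℕ → ℕ) (i : ℕ) : List ℕ := (List.range' i (n - i)).map stack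

theorem stackFrom_cons {n : ℕ} {stack : ℕ → ℕ} {i : ℕ} (h : i < n) :
    stackFrom n stack i = stack i :: stackFrom n stack (i + 1) := by
  rw [stackFrom, show n - i = (n - (i + 1)) + 1 by omega, List.range'_succ, List.map_cons, stackFrom]

theorem stackFrom_congr {n : ℕ} {stack stack' : ℕ → ℕ} {i : ℕ} (h : ∀ j, i ≤ j → stack' j = stack j) :
    stackFrom n stack' i = stackFrom n stack i := by
  refine List.map_congr_left fun j hj => h j ?_
  rw [List.mem_range'_1] at hj
  exact hj.1

/-- The outputs that the pending alternatives `l` at the positions from `i` on lead to. -/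
def outsFrom (preds : (ℕ → ℕ) → List ((ℕ → ℕ) × ℕ)) (n : ℕ) (l : ℕ → List ((ℕ → ℕ) × ℕ))
    (stack : ℕ → ℕ) (i : ℕ) : List (List ℕ) :=
  (List.range' i (n - i)).flatMap fun j =>
    (l j).flatMap fun q => outs preds j q.1 (q.2 :: stackFrom n stack (j + 1))

section
variable {preds : (ℕ → ℕ) → List ((ℕ → ℕ) × ℕ)} {n : ℕ} {l l' : ℕ → List ((ℕ → ℕ) × ℕ)}
  {stack stack' : ℕ → ℕ} {i : ℕ}

theorem outsFrom_succ (h : i < n) : outsFrom preds n l stack i =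
    ((l i).flatMap fun q => outs preds i q.1 (q.2 :: stackFrom n stack (i + 1))) ++
      outsFrom preds n l stack (i + 1) := by
  rw [outsFrom, show n - i = (n - (i + 1)) + 1 by omega, List.range'_succ, List.flatMap_cons,
    outsFrom]

theorem outsFrom_congr (h1 : ∀ j, i ≤ j → l' j = l j) (h2 : ∀ j, i < j → stack' j = stack j) :
    outsFrom preds n l' stack' i = outsFrom preds n l stack i := by
  rw [outsFrom, outsFrom, List.flatMap_def, List.flatMap_def]
  congr 1
  refine List.map_congr_left fun j hj => ?_
  rw [List.mem_range'_1] at hj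
  rw [h1 j hj.1, stackFrom_congr fun a ha => h2 a (by omega)]

theorem outsFrom_of_le (h : n ≤ i) : outsFrom preds n l stack i = [] := by
  simp [outsFrom, Nat.sub_eq_zero_of_le h]

end

/-- The alternatives `l` are pending at the positions from `i` on. -/
structure Pending (N : Net) (l : ℕ → List ((ℕ → ℕ) × ℕ)) (i : ℕ) (σ : State) : Prop where
  chain : ∀ j, i ≤ j → j < N.n → Chain N (σ.word w_src) (σ.word w_vert) (σ.word w_next)
    (σ.word w_rc 0) (σ.word w_pend j) (l j)
  level : ∀ j, i ≤ j → j < N.n → ∀ q ∈ l j, ∃ ws, ws.length = j ∧ N.Reach ws q.1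

/-- A position without alternatives contributes no output, so moving past it leaves the remaining
outputs unchanged. -/
theorem wp_find {l : ℕ → List ((ℕ → ℕ) × ℕ)} {preds : (ℕ → ℕ) → List ((ℕ → ℕ) × ℕ)}
    (hM : 0 < M) (hU : N.n < U) (hn : σ.word 0 0 = N.n) (hP : Pending N l 0 σ) :
    WP M U find (3 * N.n + 5) (fun σ' => σ'.word w_f 0 ≤ N.n ∧ Pending N l (σ'.word w_f 0) σ' ∧
      (σ'.word w_f 0 < N.n → l (σ'.word w_f 0) ≠ []) ∧
      outsFrom preds N.n l (σ.word w_stack) 0 =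
        outsFrom preds N.n l (σ'.word w_stack) (σ'.word w_f 0)) σ := by
  refine wp_seq 1 (by omega) (wp_wset le_rfl (by decide) (by simpa [WExpr.eval] using hM)
    (by simp only [WExpr.eval]; omega) ?_)
  simp only [WExpr.eval]
  refine wp_loop (fun φ σ' => φ = 2 * (N.n - σ'.word w_f 0) ∧ σ'.word w_f 0 ≤ N.n ∧
      outsFrom preds N.n l (σ.word w_stack) 0 = outsFrom preds N.n l (σ.word w_stack) (σ'.word w_f 0))
    (2 * N.n) (by omega) ⟨by simp, by simp, by simp⟩ ?_ ?_
  · rintro _ σ₁ hF₁ ⟨rfl, hf, hrem⟩ hc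
    have hpend : σ₁.word w_pend = σ.word w_pend := by rw [hF₁.word w_pend (by decide)]; simp
    have hn₁ : σ₁.word 0 0 = N.n := by rw [hF₁.word 0 (by decide)]; simp [hn]
    simp only [Cond.Holds, WExpr.eval, hn₁, hpend] at hc
    refine ⟨1, wp_wset le_rfl (by decide) (by simpa [WExpr.eval] using hM)
      (by simp only [WExpr.eval]; omega) ⟨2 * (N.n - (σ₁.word w_f 0 + 1)), by omega, ?_, ?_, ?_⟩⟩
    · simp [WExpr.eval]
    · simp only [WExpr.eval, State.setW_word, if_true, Function.update_self]; omega
    · simp only [WExpr.eval, State.setW_word, if_true, Function.update_self]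
      have h0 := (hP.chain _ (Nat.zero_le _) hc.1).eq_zero_iff.1 hc.2
      rw [hrem, outsFrom_succ hc.1, h0]
      simp
  · rintro _ σ₁ hF₁ ⟨-, hf, hrem⟩ hc
    have hw : ∀ a, a ≠ w_f → σ₁.word a = σ.word a := by
      intro a ha
      rw [hF₁.word a (by simpa [Stmt.wordTargets] using ha)]
      simp [ha]
    have hn₁ : σ₁.word 0 0 = N.n := by rw [hw 0 (by decide), hn]
    simp only [Cond.Holds, WExpr.eval, hn₁, hw w_pend (by decide), not_and] at hc
    refine ⟨hf, ⟨fun j _ hj => ?_, fun j _ hj => hP.level j (Nat.zero_le _) hj⟩, fun hlt h0 => ?_, ?_⟩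
    · rw [hw w_src (by decide), hw w_vert (by decide), hw w_next (by decide), hw w_rc (by decide),
        hw w_pend (by decide)]
      exact hP.chain j (Nat.zero_le _) hj
    · exact hc hlt ((hP.chain _ (Nat.zero_le _) hlt).eq_zero_iff.2 h0)
    · rw [hw w_stack (by decide)]
      exact hrem

/-- At each position the first pending alternative is removed and its vertex put on the stack; the
predecessors of its source become the alternatives one position lower. Each position costs constant
time. -/
theorem wp_descend (hN : N.Valid k) {l : ℕ → List ((ℕ → ℕ) × ℕ)}
    {preds : (ℕ → ℕ) → List ((ℕ → ℕ) × ℕ)} {Q : List (ℕ → ℕ)}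
    (hX : Explored (fun p v c => p ∈ Net.states hN ∧ N.Trans p v c) preds Q)
    (hS : Store N preds Q σ) (hM : N.n < M) (hU : N.n + 1 < U)
    (hf : σ.word w_f 0 < N.n) (hP : Pending N l (σ.word w_f 0) σ) (hne : l (σ.word w_f 0) ≠ []) :
    WP M U descend (12 * N.n + 10) (fun σ' => ∃ l', Pending N l' 0 σ' ∧
      outsFrom preds N.n l (σ.word w_stack) (σ.word w_f 0) =
        stackFrom N.n (σ'.word w_stack) 0 :: outsFrom preds N.n l' (σ'.word w_stack) 0) σ := by
  set rem := outsFrom preds N.n l (σ.word w_stack) (σ.word w_f 0) with hrem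
  refine wp_seq 1 (by omega) (wp_wset le_rfl (by decide) (by simp only [WExpr.eval]; omega)
    (by simp only [WExpr.eval]; omega) ?_)
  simp only [WExpr.eval]
  refine wp_loop (fun φ σ' => ∃ l', φ = 12 * σ'.word w_f 0 ∧ σ'.word w_f 0 ≤ N.n ∧
      Store N preds Q σ' ∧
      -- Position `f - 1` is the next to be treated. At the end `f = 0`, and truncated subtraction
      -- makes this position `0`, as the conclusion requires.
      Pending N l' (σ'.word w_f 0 - 1) σ' ∧
      (0 < σ'.word w_f 0 → l' (σ'.word w_f 0 - 1) ≠ [] ∧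
        rem = outsFrom preds N.n l' (σ'.word w_stack) (σ'.word w_f 0 - 1)) ∧
      (σ'.word w_f 0 = 0 → rem = stackFrom N.n (σ'.word w_stack) 0 ::
        outsFrom preds N.n l' (σ'.word w_stack) 0))
    (12 * (σ.word w_f 0 + 1)) (by omega)
    ⟨l, by simp, by simpa using hf, hS.setW (by decide), ⟨?_, ?_⟩, ?_, ?_⟩ ?_ ?_
  · simpa using hP.chain
  · simpa using hP.level
  · intro _
    simpa using ⟨hne, hrem⟩
  · simp
  · rintro _ σ₁ - ⟨l', rfl, hfn, hS₁, hP₁, hpos, -⟩ hc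
    simp only [Cond.Holds, WExpr.eval] at hc
    obtain ⟨f, hf₁⟩ : ∃ f, σ₁.word w_f 0 = f + 1 := ⟨σ₁.word w_f 0 - 1, by omega⟩
    rw [hf₁] at hfn hP₁ hpos ⊢
    simp only [Nat.add_sub_cancel] at hP₁ hpos
    obtain ⟨hne₁, hrem₁⟩ := hpos (by omega)
    obtain ⟨q, L, hqL⟩ := List.exists_cons_of_ne_nil hne₁
    have hch := hP₁.chain f le_rfl (by omega)
    rw [hqL] at hch
    obtain ⟨-, -, hsrc, hvert, hnext⟩ := hch
    obtain ⟨us, hul, hur⟩ := hP₁.level f le_rfl (by omega) q (by rw [hqL]; simp)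
    refine ⟨11, fun hfit => ?_⟩
    have hfU := fun a i => hfit.2 a i
    refine (?_ : WP M U _ _ _ σ₁) hfit
    refine wp_seq 1 (by omega) (wp_wset le_rfl (by decide) (by simp only [WExpr.eval]; omega)
      (by simp only [WExpr.eval]; omega) ?_)
    refine wp_seq 1 (by omega) (wp_wset le_rfl (by decide) (by simp only [WExpr.eval]; omega)
      (by simpa [WExpr.eval] using hfU _ _) ?_)
    refine wp_seq 1 (by omega) (wp_wset le_rfl (by decide) (by simp [WExpr.eval, hf₁]; omega)
      (by simpa [WExpr.eval] using hfU _ _) ?_)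
    refine wp_seq 1 (by omega) (wp_wset le_rfl (by decide) (by simp [WExpr.eval, hf₁]; omega)
      (by simpa [WExpr.eval] using hfU _ _) ?_)
    simp only [WExpr.eval, State.setW_word, Nat.reduceEqDiff, if_false, if_true, hf₁,
      Function.update_self, Nat.add_sub_cancel, hvert]
    set r := σ₁.word w_pend f with hr
    set σ₂ := (((σ₁.setW w_f 0 f).setW w_r 0 r).setW w_pend f (σ₁.word w_next r)).setW w_stack f q.2
      with hσ₂
    have e_f : σ₂.word w_f 0 = f := by simp [hσ₂]
    have e_r : σ₂.word w_r 0 = r := by simp [hσ₂]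
    have e_src : σ₂.word w_src = σ₁.word w_src := by simp [hσ₂]
    have e_head : σ₂.word w_head = σ₁.word w_head := by simp [hσ₂]
    have e_pend : σ₂.word w_pend = Function.update (σ₁.word w_pend) f (σ₁.word w_next r) := by
      simp [hσ₂]
    have e_stack : σ₂.word w_stack = Function.update (σ₁.word w_stack) f q.2 := by
      simp [hσ₂]
    have hS₂ : Store N preds Q σ₂ := by
      refine Store.setW (Store.setW (Store.setW (Store.setW hS₁ ?_) ?_) ?_) ?_ <;> decide
    have hst : ∀ j, f + 1 ≤ j → σ₂.word w_stack j = σ₁.word w_stack j := by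
      intro j hj
      rw [e_stack, Function.update_of_ne (by omega)]
    have hsf : stackFrom N.n (σ₂.word w_stack) f = q.2 :: stackFrom N.n (σ₁.word w_stack) (f + 1) := by
      rw [stackFrom_cons (by omega), stackFrom_congr hst, e_stack, Function.update_self]
    -- The remaining outputs split into those through the alternative `q` just taken and all others.
    have hrem₂ : rem = outs preds f q.1 (stackFrom N.n (σ₂.word w_stack) f) ++
        outsFrom preds N.n (Function.update l' f L) (σ₂.word w_stack) f := by
      rw [hrem₁, outsFrom_succ (by omega), outsFrom_succ (l := Function.update l' f L) (by omega), hqL,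
        List.flatMap_cons, Function.update_self, hsf, stackFrom_congr hst, List.append_assoc]
      congr 2
      refine (outsFrom_congr (fun j hj => ?_) fun j hj => hst j (by omega)).symm
      rw [Function.update_of_ne (by omega)]
    have hP₂ : Pending N (Function.update l' f L) f σ₂ := by
      refine ⟨fun j h1 h2 => ?_, fun j h1 h2 p hp => ?_⟩
      · have e1 : σ₂.word w_vert = σ₁.word w_vert := by simp [hσ₂]
        have e2 : σ₂.word w_next = σ₁.word w_next := by simp [hσ₂]
        have e3 : σ₂.word w_rc = σ₁.word w_rc := by simp [hσ₂]
        rw [e_src, e1, e2, e3, e_pend]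
        by_cases hj : j = f
        · subst hj
          simpa using hnext
        · rw [Function.update_of_ne hj, Function.update_of_ne hj]
          exact hP₁.chain j h1 h2
      · by_cases hj : j = f
        · subst hj
          rw [Function.update_self] at hp
          exact hP₁.level j h1 h2 p (by rw [hqL]; simp [hp])
        · rw [Function.update_of_ne hj] at hp
          exact hP₁.level j h1 h2 p hp
    have hb : N.Bounded q.1 := (hur.inv hN).bounded
    refine wp_ite (by omega) (fun hc => ?_) (fun hc => ?_)
    · simp only [Cond.Holds, WExpr.eval, e_f] at hc
      -- Below position `f > 0` at least one step is still missing, and a reachable state always has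
      -- a way back.
      have hpr : preds q.1 ≠ [] := by
        intro h0
        have := outs_ne_nil hN hX (acc := []) hur
        rw [hul, show f = (f - 1) + 1 by omega, outs, h0] at this
        simp at this
      refine wp_wset (by omega) (by decide) (by simp [WExpr.eval, e_f]; omega)
        (by simpa [WExpr.eval, e_r, e_src, e_head] using hfU _ _) ?_
      simp only [WExpr.eval, e_f, e_r, e_src, hsrc]
      refine ⟨12 * f, by omega, Function.update (Function.update l' f L) (f - 1) (preds q.1),
        by simp [e_f], by simp [e_f]; omega, hS₂.setW (by decide), ⟨fun j h1 h2 => ?_,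
          fun j h1 h2 p hp => ?_⟩, fun _ => ?_, fun h => ?_⟩
      · simp only [State.setW_word, Nat.reduceEqDiff, if_false, if_true, e_f] at h1 ⊢
        by_cases hj : j = f - 1
        · subst hj
          rw [Function.update_self, Function.update_self]
          exact hS₂.chain _ hb
        · rw [Function.update_of_ne hj, Function.update_of_ne hj]
          exact hP₂.chain j (by omega) h2
      · simp only [State.setW_word, Nat.reduceEqDiff, if_false, e_f] at h1
        by_cases hj : j = f - 1
        · subst hj
          rw [Function.update_self] at hp
          have hlev := hur.atLevel hN
          rw [hul, show f = (f - 1) + 1 by omega] at hlev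
          obtain ⟨⟨ws, hw, -, hwr⟩, -⟩ := exists_reach_of_mem_preds hN hX hlev hp
          exact ⟨ws, hw, hwr⟩
        · rw [Function.update_of_ne hj] at hp
          exact hP₂.level j (by omega) h2 p hp
      · simp only [State.setW_word, Nat.reduceEqDiff, if_false, e_f, Function.update_self]
        refine ⟨hpr, ?_⟩
        have hfg : f - 1 + 1 = f := by omega
        have ho : ∀ acc, outs preds f q.1 acc =
            (preds q.1).flatMap fun p => outs preds (f - 1) p.1 (p.2 :: acc) := by
          intro acc
          conv_lhs => rw [← hfg, outs]
        rw [hrem₂, ho, outsFrom_succ (i := f - 1) (by omega), Function.update_self, hfg]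
        congr 1
        refine (outsFrom_congr (fun j hj => ?_) fun j hj => rfl).symm
        rw [Function.update_of_ne (by omega)]
      · simp only [State.setW_word, Nat.reduceEqDiff, if_false, e_f] at h
        omega
    · simp only [Cond.Holds, WExpr.eval, e_f, Nat.not_lt, Nat.le_zero] at hc
      subst hc
      refine wp_skip (by omega) ⟨0, by omega, Function.update l' 0 L, by simp [e_f], by simp [e_f],
        hS₂, by simpa [e_f] using hP₂, fun h => by omega, fun _ => ?_⟩
      rw [hrem₂, outs]
      rfl
  · rintro _ σ₁ - ⟨l', -, -, -, hP₁, -, hrem₁⟩ hc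
    simp only [Cond.Holds, WExpr.eval, Nat.not_lt, Nat.le_zero] at hc
    rw [hc] at hP₁
    exact ⟨l', hP₁, hrem₁ hc⟩

theorem wp_emit (hM : N.n < M) (hU : N.n < U) (hn : σ.word 0 0 = N.n)
    {vs : List ℕ} (hvs : vs = stackFrom N.n (σ.word w_stack) 0) (hnd : vs.Nodup)
    (hmem : ∀ v, v ∈ vs ↔ v < N.n) :
    WP M U emit (8 * N.n + 10) (fun σ' => σ'.out = σ.out ++
      (List.range N.n).map fun v => σ.word w_id (vs.idxOf v)) σ := by
  have hlen : vs.length = N.n := by rw [hvs, stackFrom]; simp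
  have hget : ∀ i (h : i < N.n), σ.word w_stack i = vs[i] := by
    intro i h
    simp [hvs, stackFrom]
  have hlt : ∀ i < N.n, σ.word w_stack i < N.n := by
    intro i h
    rw [hget i h, ← hmem]
    exact List.getElem_mem _
  have hinj : ∀ i < N.n, ∀ j < N.n, σ.word w_stack i = σ.word w_stack j → i = j := by
    intro i hi j hj h
    rw [hget i hi, hget j hj] at h
    exact (hnd.getElem_inj_iff).1 h
  refine wp_seq (4 * N.n + 3) (by omega) (wp_for
    (Q := fun σ' => Frame emit σ σ' ∧ ∀ j < N.n, σ'.word w_place (σ.word w_stack j) = σ.word w_id j)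
    (fun i σ' => ∀ j < i, σ'.word w_place (σ.word w_stack j) = σ.word w_id j) (fun _ => 1) N.n
    (by simp; omega) (by decide) (by omega) (by omega) (by decide) ?_ ?_ ?_ ?_ |>.mono le_rfl ?_)
  · intro σ' hF
    simp only [WExpr.eval]
    rw [hF.word 0 (by decide), hn]
  · simp
  · intro i hi σ' hF hi' hI hfit
    have e1 : σ'.word w_stack = σ.word w_stack := hF.word _ (by decide)
    have e2 : σ'.word w_id = σ.word w_id := hF.word _ (by decide)
    refine wp_wset le_rfl (by decide) ?_ ?_ ?_ hfit
    · simp only [WExpr.eval, hi', e1]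
      exact (hlt i hi).trans hM
    · simp only [WExpr.eval]
      exact hfit.2 _ _
    · intro j hj
      simp only [WExpr.eval, State.setW_word, Nat.reduceEqDiff, if_false, if_true, hi', e1, e2]
      by_cases hji : j = i
      · subst hji; simp
      · rw [Function.update_of_ne fun h => hji (hinj j (by omega) i hi h)]
        exact hI j (by omega)
  · intro σ' hF hI
    refine ⟨⟨fun a ha => hF.word a ?_, fun a _ => hF.real a (by simp [Stmt.realTargets]), fun h => ?_⟩, hI⟩
    · simp only [emit, Stmt.wordTargets, List.mem_append, not_or] at ha ⊢
      exact ha.1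
    · simp [emit, Stmt.quiet] at h
  rintro σ₁ hF₁ ⟨-, hI⟩
  have ho : σ₁.out = σ.out := hF₁.out rfl
  refine wp_for (fun i σ' => σ'.out = σ.out ++ (List.range i).map (σ₁.word w_place)) (fun _ => 1) N.n
    (by simp; omega) (by decide) (by omega) (by omega) (by decide) ?_ ?_ ?_ ?_
  · intro σ' hF
    simp only [WExpr.eval]
    rw [hF.word 0 (by decide), hF₁.word 0 (by decide), hn]
  · simp [ho]
  · intro i hi σ' hF hi' hI'
    refine wp_write le_rfl ?_
    simp only [State.setW_out, State.emit_out, WExpr.eval, hi', hI', List.range_succ,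
      List.map_append, List.map_cons, List.map_nil]
    rw [hF.word w_place (by decide), List.append_assoc]
  · intro σ' hF hI'
    rw [hI']
    congr 1
    refine List.map_congr_left fun v hv => ?_
    rw [List.mem_range, ← hmem] at hv
    have h1 : vs.idxOf v < N.n := by rw [← hlen]; exact List.idxOf_lt_length_iff.2 hv
    have h2 := hI _ h1
    rwa [hget _ h1, List.getElem_idxOf] at h2

/-- The invariant of the enumeration loop, with the outputs still to be made. -/
structure Enumerating (N : Net) (preds : (ℕ → ℕ) → List ((ℕ → ℕ) × ℕ)) (Q : List (ℕ → ℕ))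
    (id : ℕ → ℕ) (rem : List (List ℕ)) (σ : State) : Prop where
  n : σ.word 0 0 = N.n
  id : σ.word w_id = id
  store : Store N preds Q σ
  reach : ∀ vs ∈ rem, N.Reach vs 0 ∧ vs.length = N.n
  pending : ∃ l, σ.word w_f 0 ≤ N.n ∧ Pending N l (σ.word w_f 0) σ ∧
    (σ.word w_f 0 < N.n → l (σ.word w_f 0) ≠ []) ∧
    rem = outsFrom preds N.n l (σ.word w_stack) (σ.word w_f 0)

/-- A pending alternative would lead to a further output, so the loop test fails exactly when the
outputs are exhausted. -/
theorem Enumerating.le_of_nil (hN : N.Valid k) {preds : (ℕ → ℕ) → List ((ℕ → ℕ) × ℕ)}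
    {Q : List (ℕ → ℕ)} {id : ℕ → ℕ}
    (hX : Explored (fun p v c => p ∈ Net.states hN ∧ N.Trans p v c) preds Q)
    (h : Enumerating N preds Q id [] σ) : N.n ≤ σ.word w_f 0 := by
  obtain ⟨l, -, hP, hne, hrem⟩ := h.pending
  by_contra hlt
  rw [not_le] at hlt
  obtain ⟨q, L, hqL⟩ := List.exists_cons_of_ne_nil (hne hlt)
  obtain ⟨ws, hw, hr⟩ := hP.level _ le_rfl hlt q (by rw [hqL]; simp)
  have := outs_ne_nil hN hX (acc := q.2 :: stackFrom N.n (σ.word w_stack) (σ.word w_f 0 + 1)) hr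
  rw [hw] at this
  rw [outsFrom_succ hlt, hqL, List.flatMap_cons] at hrem
  simp [this] at hrem

theorem wp_body (hN : N.Valid k) (hM : N.n < M) (hU : N.n + 1 < U)
    {preds : (ℕ → ℕ) → List ((ℕ → ℕ) × ℕ)} {Q : List (ℕ → ℕ)} {id : ℕ → ℕ}
    (hX : Explored (fun p v c => p ∈ Net.states hN ∧ N.Trans p v c) preds Q)
    {vs : List ℕ} {rem : List (List ℕ)} (h : Enumerating N preds Q id (vs :: rem) σ) :
    σ.word w_f 0 < N.n ∧ WP M U body (23 * N.n + 30) (fun σ' =>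
      σ'.out = σ.out ++ (List.range N.n).map (fun v => id (vs.idxOf v)) ∧
        Enumerating N preds Q id rem σ') σ := by
  obtain ⟨l, hf, hP, hne, hrem⟩ := h.pending
  have hlt : σ.word w_f 0 < N.n := by
    by_contra hge
    rw [outsFrom_of_le (by omega)] at hrem
    simp at hrem
  refine ⟨hlt, wp_seq (12 * N.n + 10) (by omega)
    ((wp_descend hN hX h.store hM hU hlt hP (hne hlt)).mono le_rfl ?_)⟩
  rintro σ₁ hF₁ ⟨l₁, hP₁, hrem₁⟩
  rw [← hrem] at hrem₁
  obtain ⟨hvs, hrem₁⟩ := List.cons_eq_cons.1 hrem₁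
  obtain ⟨hr, hlen⟩ := h.reach vs (by simp)
  have hi := hr.inv hN
  have hS₁ := h.store.frame hF₁ (by decide)
  have hid₁ : σ₁.word w_id = id := by rw [hF₁.word _ (by decide), h.id]
  have hn₁ : σ₁.word 0 0 = N.n := by rw [hF₁.word 0 (by decide), h.n]
  refine wp_seq (8 * N.n + 10) (by omega) ((wp_emit hM (by omega) hn₁ hvs hi.nodup
    fun v => ⟨hi.lt v, fun hv => hi.mem_of_full hlen.ge hv⟩).mono le_rfl ?_)
  intro σ₂ hF₂ ho₂
  have hP₂ : Pending N l₁ 0 σ₂ := by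
    refine ⟨?_, hP₁.level⟩
    rw [hF₂.word w_src (by decide), hF₂.word w_vert (by decide), hF₂.word w_next (by decide),
      hF₂.word w_rc (by decide), hF₂.word w_pend (by decide)]
    exact hP₁.chain
  have hn₂ : σ₂.word 0 0 = N.n := by rw [hF₂.word 0 (by decide), hn₁]
  refine (wp_find (preds := preds) (by omega) (by omega) hn₂ hP₂).mono (by omega) ?_
  rintro σ₃ hF₃ ⟨g1, g2, g3, g4⟩
  refine ⟨?_, ⟨by rw [hF₃.word 0 (by decide), hn₂], ?_, (hS₁.frame hF₂ (by decide)).frame hF₃ (by decide),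
    fun us hus => h.reach us (by simp [hus]), l₁, g1, g2, g3, ?_⟩⟩
  · rw [hF₃.out rfl, ho₂, hF₁.out rfl, hid₁]
  · rw [hF₃.word w_id (by decide), hF₂.word w_id (by decide), hid₁]
  · rw [hrem₁, ← g4, hF₂.word w_stack (by decide)]

end Upward

/-- Execution is deterministic, so a witness in the postcondition can be fixed before the run. The
list of all outputs, built from the predecessor lists, can then be named in advance. -/
theorem RealRAM.WP.exists_post {M U t : ℕ} {p : Stmt} {σ : State} {α : Type*} {Q : α → State → Prop}
    (h : WP M U p t (fun σ' => ∃ x, Q x σ') σ) (hf : σ.Fit M U) : ∃ x, WP M U p t (Q x) σ := by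
  obtain ⟨σ', t', h1, h2, ⟨x, h3⟩, h4⟩ := h hf
  exact ⟨x, fun _ => ⟨σ', t', h1, h2, h3, h4⟩⟩

namespace Upward
open RealRAM Prog
variable {N : Net} {k M U : ℕ} {σ : State}

/-! ### Sorting -/

/-- The number of indices below `n` with a smaller value than `i`. -/
noncomputable def rank (Y : ℕ → ℝ) (n i : ℕ) : ℕ := ((Finset.range n).filter fun j => Y j < Y i).card

theorem rank_lt {Y : ℕ → ℝ} {n i : ℕ} (hi : i < n) : rank Y n i < n := by
  rw [rank]
  refine (Finset.card_lt_card ?_).trans_le (Finset.card_range n).le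
  refine Finset.filter_ssubset.2 ⟨i, Finset.mem_range.2 hi, lt_irrefl _⟩

theorem rank_lt_rank {Y : ℕ → ℝ} {n i j : ℕ} (hi : i < n) (h : Y i < Y j) :
    rank Y n i < rank Y n j := by
  refine Finset.card_lt_card (Finset.ssubset_iff_subset_ne.2 ⟨fun a ha => ?_, fun he => ?_⟩)
  · rw [Finset.mem_filter] at ha ⊢
    exact ⟨ha.1, ha.2.trans h⟩
  · have : i ∈ (Finset.range n).filter fun a => Y a < Y j := by simp [hi, h]
    rw [← he] at this
    simp at this

/-- `ρ` lists the indices below `n` by increasing value. -/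
structure Sorts (Y : ℕ → ℝ) (n : ℕ) (ρ : ℕ → ℕ) : Prop where
  lt : ∀ r < n, ρ r < n
  rank_eq : ∀ r < n, rank Y n (ρ r) = r
  eq_rank : ∀ i < n, ρ (rank Y n i) = i

theorem exists_sorts {Y : ℕ → ℝ} {n : ℕ} (hY : ∀ i < n, ∀ j < n, Y i = Y j → i = j) :
    ∃ ρ, Sorts Y n ρ := by
  have hinj : ∀ i < n, ∀ j < n, rank Y n i = rank Y n j → i = j := by
    intro i hi j hj h
    rcases lt_trichotomy (Y i) (Y j) with h' | h' | h'
    · exact absurd h (rank_lt_rank hi h').ne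
    · exact hY i hi j hj h'
    · exact absurd h (rank_lt_rank hj h').ne'
  have himg : (Finset.range n).image (rank Y n) = Finset.range n := by
    refine Finset.eq_of_subset_of_card_le ?_ ?_
    · intro x hx
      obtain ⟨v, hv, rfl⟩ := Finset.mem_image.1 hx
      exact Finset.mem_range.2 (rank_lt (Finset.mem_range.1 hv))
    · rw [Finset.card_image_of_injOn]
      intro u hu v hv huv
      exact hinj u (by simpa using hu) v (by simpa using hv) huv
  have : ∀ r, ∃ i, r < n → i < n ∧ rank Y n i = r := by
    intro r
    by_cases hr : r < n
    · rw [← Finset.mem_range, ← himg] at hr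
      obtain ⟨v, hv, hvj⟩ := Finset.mem_image.1 hr
      exact ⟨v, fun _ => ⟨Finset.mem_range.1 hv, hvj⟩⟩
    · exact ⟨0, fun h => absurd h hr⟩
  choose ρ hρ using this
  exact ⟨ρ, fun r hr => (hρ r hr).1, fun r hr => (hρ r hr).2, fun i hi =>
    hinj _ (hρ _ (rank_lt hi)).1 _ hi (hρ _ (rank_lt hi)).2⟩

theorem Sorts.strictMono {Y : ℕ → ℝ} {n : ℕ} {ρ : ℕ → ℕ} (h : Sorts Y n ρ) {i j : ℕ} (hij : i < j)
    (hj : j < n) : Y (ρ i) < Y (ρ j) := by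
  by_contra hle
  rw [not_lt] at hle
  have h1 : rank Y n (ρ j) ≤ rank Y n (ρ i) := by
    refine Finset.card_le_card fun a ha => ?_
    rw [Finset.mem_filter] at ha ⊢
    exact ⟨ha.1, ha.2.trans_le hle⟩
  rw [h.rank_eq i (by omega), h.rank_eq j hj] at h1
  omega

/-- The sorted sequence, followed by zeros. -/
def sorted {α : Type*} [Zero α] (Z : ℕ → α) (n : ℕ) (ρ : ℕ → ℕ) (r : ℕ) : α :=
  if r < n then Z (ρ r) else 0

theorem update_sorted {α : Type*} [Zero α] {Y : ℕ → ℝ} {n i : ℕ} {ρ : ℕ → ℕ} (hs : Sorts Y n ρ)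
    (hi : i < n) {Z A : ℕ → α} {c : ℕ → α} (hA : ∀ r, A r = if r < n ∧ ρ r < i then Z (ρ r) else c r)
    (r : ℕ) : Function.update A (rank Y n i) (Z i) r = if r < n ∧ ρ r < i + 1 then Z (ρ r) else c r := by
  rw [Function.update_apply, hA]
  by_cases hr : r = rank Y n i
  · subst hr
    rw [if_pos rfl, hs.eq_rank i hi, if_pos ⟨rank_lt hi, by omega⟩]
  · rw [if_neg hr]
    refine if_congr ⟨fun h => ⟨h.1, by omega⟩, fun h => ⟨h.1, ?_⟩⟩ rfl rfl
    rcases Nat.lt_succ_iff_lt_or_eq.1 h.2 with h2 | h2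
    · exact h2
    · rw [← h2, hs.rank_eq r h.1] at hr
      exact absurd rfl hr

/-- The heights are distinct, so the rank of a point, the number of lower points, is its place in
the sorted order. Quadratic time is affordable. The target arrays must start at zero because
`Compatible` is applied to whole sequences. -/
theorem wp_sort {n : ℕ} {ρ : ℕ → ℕ} (hM : n < M) (hU : n + 1 < U) (hn : σ.word 0 0 = n)
    (hs : Sorts (σ.real 1) n ρ) (hr2 : σ.real 2 = 0) (hr3 : σ.real 3 = 0) :
    WP M U sort (n * (5 * n + 20) + 3) (fun σ' => (∀ r < n, σ'.word w_id r = ρ r) ∧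
      σ'.real 2 = sorted (σ.real 0) n ρ ∧ σ'.real 3 = sorted (σ.real 1) n ρ) σ := by
  refine wp_for (fun i σ' =>
      (∀ r, σ'.word w_id r = if r < n ∧ ρ r < i then ρ r else σ.word w_id r) ∧
      (∀ r, σ'.real 2 r = if r < n ∧ ρ r < i then σ.real 0 (ρ r) else σ.real 2 r) ∧
      (∀ r, σ'.real 3 r = if r < n ∧ ρ r < i then σ.real 1 (ρ r) else σ.real 3 r))
    (fun _ => 5 * n + 15) n (by simp; ring_nf; omega) (by decide) (by omega) (by omega) (by decide)
    ?_ ?_ ?_ ?_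
  · intro σ' hF
    simp only [WExpr.eval]
    rw [hF.word 0 (by decide), hn]
  · simp
  · intro i hi σ₁ hF₁ hi₁ ⟨I1, I2, I3⟩
    have hn₁ : σ₁.word 0 0 = n := by rw [hF₁.word 0 (by decide), hn]
    have hY₁ : σ₁.real 1 = σ.real 1 := hF₁.real _ (by decide)
    have hX₁ : σ₁.real 0 = σ.real 0 := hF₁.real _ (by decide)
    refine wp_seq 1 (by omega) (wp_wset le_rfl (by decide) (by simp only [WExpr.eval]; omega)
      (by simp only [WExpr.eval]; omega) ?_)
    simp only [WExpr.eval]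
    refine wp_seq (5 * n + 3) (by omega) (wp_for
      (Q := fun σ' => σ'.word w_r 0 = rank (σ.real 1) n i ∧ σ'.word w_i 0 = i ∧
        σ'.word w_id = σ₁.word w_id ∧ σ'.real = σ₁.real)
      (fun j σ' => σ'.word w_r 0 = ((Finset.range j).filter fun a => σ.real 1 a < σ.real 1 i).card)
      (fun _ => 2) n (by simp; ring_nf; omega) (by decide) (by omega) (by omega) (by decide)
      ?_ ?_ ?_ ?_ |>.mono le_rfl ?_)
    · intro σ' hF
      simp only [WExpr.eval]
      rw [hF.word 0 (by decide)]
      simp [hn₁]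
    · simp
    · intro j hj σ₂ hF₂ hj₂ hI
      have hi₂ : σ₂.word w_i 0 = i := by rw [hF₂.word w_i (by decide)]; simp [hi₁]
      have hY₂ : σ₂.real 1 = σ.real 1 := by rw [hF₂.real 1 (by decide)]; simp [hY₁]
      have hcard : ((Finset.range j).filter fun a => σ.real 1 a < σ.real 1 i).card ≤ j := by
        simpa using Finset.card_filter_le (Finset.range j) fun a => σ.real 1 a < σ.real 1 i
      refine wp_ite (by omega) (fun hc => ?_) (fun hc => wp_skip (by omega) ?_)
      · simp only [Cond.Holds, RExpr.eval, WExpr.eval, hj₂, hi₂, hY₂] at hc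
        refine wp_wset (by omega) (by decide) (by simp only [WExpr.eval]; omega)
          (by simp only [WExpr.eval, hI]; omega) ?_
        simp only [WExpr.eval, State.setW_word, Nat.reduceEqDiff, if_false, if_true,
          Function.update_self, hI]
        rw [Finset.range_add_one, Finset.filter_insert, if_pos hc,
          Finset.card_insert_of_notMem (by simp)]
      · simp only [Cond.Holds, RExpr.eval, WExpr.eval, hj₂, hi₂, hY₂] at hc
        simp only [State.setW_word, Nat.reduceEqDiff, if_false, hI]
        rw [Finset.range_add_one, Finset.filter_insert, if_neg hc]
    · intro σ' hF hI
      refine ⟨hI, ?_, ?_, ?_⟩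
      · rw [hF.word w_i (by decide)]; simp [hi₁]
      · rw [hF.word w_id (by decide)]; simp
      · funext a; exact hF.real a (by simp [Stmt.realTargets])
    · rintro σ₂ - ⟨h1, h2, h3, h4⟩
      have hr := rank_lt (Y := σ.real 1) hi
      refine wp_seq 1 (by omega) (wp_wset le_rfl (by decide) (by simp only [WExpr.eval, h1]; omega)
        (by simp only [WExpr.eval, h2]; omega) (wp_seq 1 (by omega) (wp_rset le_rfl (by decide)
          (by simp [WExpr.eval, h1]; omega) (wp_rset (by omega) (by decide)
            (by simp [WExpr.eval, h1]; omega) ⟨?_, ?_, ?_⟩))))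
      · simp only [WExpr.eval, State.setW_word, State.setR_word, Nat.reduceEqDiff, if_false, if_true,
          h1, h2, h3]
        exact update_sorted (Z := fun r => r) hs hi I1
      · simp only [WExpr.eval, RExpr.eval, State.setW_word, State.setW_real, State.setR_word,
          State.setR_real, Nat.reduceEqDiff, OfNat.one_ne_ofNat, if_false, if_true, h1, h2, h4, hX₁]
        exact update_sorted (Z := σ.real 0) hs hi I2
      · simp only [WExpr.eval, RExpr.eval, State.setW_word, State.setW_real, State.setR_word,
          State.setR_real, Nat.reduceEqDiff, OfNat.one_ne_ofNat, if_false, if_true, h1, h2, h4, hY₁]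
        exact update_sorted (Z := σ.real 1) hs hi I3
  · rintro σ' - ⟨I1, I2, I3⟩
    refine ⟨fun r hr => ?_, ?_, ?_⟩
    · rw [I1, if_pos ⟨hr, hs.lt r hr⟩]
    · funext r
      rw [I2, sorted, hr2]
      by_cases hr : r < n
      · rw [if_pos hr, if_pos ⟨hr, hs.lt r hr⟩]
      · rw [if_neg hr, if_neg fun h => hr h.1]; rfl
    · funext r
      rw [I3, sorted, hr3]
      by_cases hr : r < n
      · rw [if_pos hr, if_pos ⟨hr, hs.lt r hr⟩]
      · rw [if_neg hr, if_neg fun h => hr h.1]; rfl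

/-! ### The set-up phase -/

theorem wp_findSource (hN : N.Valid k) (hnM : N.n < M) (hmU : N.m < U) (hU : M ≤ U)
    (hn : σ.word 0 0 = N.n) (hm : σ.word 0 1 = N.m) (hhd : σ.word 2 = N.hd)
    (hmark : ∀ i, σ.word w_mark i = 0) :
    WP M U findSource (4 * N.m + 5 * N.n + 10) (fun σ' => σ'.word w_s 0 = N.s) σ := by
  refine wp_seq (4 * N.m + 3) (by omega) (wp_for
    (Q := fun σ' => σ'.word 0 0 = N.n ∧ ∀ i, σ'.word w_mark i = 0 ↔ ¬ ∃ e < N.m, N.hd e = i)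
    (fun j σ' => ∀ i, σ'.word w_mark i = 0 ↔ ¬ ∃ e < j, N.hd e = i) (fun _ => 1) N.m
    (by simp; omega) (by decide) (by omega) (by omega) (by decide) ?_ ?_ ?_ ?_ |>.mono le_rfl ?_)
  · intro σ' hF
    simp only [WExpr.eval]
    rw [hF.word 0 (by decide), hm]
  · simp [hmark]
  · intro j hj σ₁ hF₁ hj₁ hI
    have e2 : σ₁.word 2 = N.hd := by rw [hF₁.word 2 (by decide), hhd]
    refine wp_wset le_rfl (by decide) ?_ ?_ fun i => ?_
    · simp only [WExpr.eval, hj₁, e2]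
      exact (hN.hd_lt j hj).trans hnM
    · simp only [WExpr.eval]; omega
    · simp only [WExpr.eval, State.setW_word, Nat.reduceEqDiff, if_false, if_true, hj₁, e2]
      rw [Function.update_apply]
      split_ifs with h
      · subst h
        simp only [false_iff, not_not]
        exact ⟨j, by omega, rfl⟩
      · rw [hI]
        refine not_congr ⟨fun ⟨e, he, h'⟩ => ⟨e, by omega, h'⟩, fun ⟨e, he, h'⟩ => ⟨e, ?_, h'⟩⟩
        rcases Nat.lt_succ_iff_lt_or_eq.1 he with he | rfl
        · exact he
        · exact absurd h'.symm h
  · intro σ' hF hI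
    exact ⟨by rw [hF.word 0 (by decide), hn], hI⟩
  rintro σ₁ - ⟨hn₁, hm₁⟩
  -- The source is the only vertex that is not marked as a head, so the variable is set once and
  -- never again.
  refine wp_for (fun i σ' => N.s < i → σ'.word w_s 0 = N.s) (fun _ => 2) N.n
    (by simp; omega) (by decide) (by omega) (by omega) (by decide) ?_ ?_ ?_ ?_
  · intro σ' hF
    simp only [WExpr.eval]
    rw [hF.word 0 (by decide), hn₁]
  · simp
  · intro i hi σ₂ hF₂ hi₂ hI
    have e1 : σ₂.word w_mark = σ₁.word w_mark := hF₂.word _ (by decide)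
    have hiff : σ₁.word w_mark i = 0 ↔ i = N.s := by
      rw [hm₁]
      constructor
      · intro h
        by_contra hne
        exact h (hN.source i hi hne)
      · rintro rfl ⟨e, he, h⟩
        exact hN.source' e he h
    refine wp_ite (by omega) (fun hc => ?_) (fun hc => wp_skip (by omega) ?_)
    · simp only [Cond.Holds, WExpr.eval, hi₂, e1, hiff] at hc
      refine wp_wset (by omega) (by decide) (by simp only [WExpr.eval]; omega)
        (by simp only [WExpr.eval, hi₂]; omega) fun _ => ?_
      simp [WExpr.eval, hi₂, hc]
    · simp only [Cond.Holds, WExpr.eval, hi₂, e1, hiff] at hc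
      intro hlt
      simp only [State.setW_word, Nat.reduceEqDiff, if_false]
      exact hI (by omega)
  · intro σ' _ hI
    exact hI hN.s_lt

/-- The time for the set-up phase. -/
noncomputable abbrev setupTime (hL : Lim N k M U) : ℕ :=
  N.n * (5 * N.n + 20) + 4 * N.m + 8 * N.n + 50 +
    unitCost N k * ∑ val ∈ Net.states hL.valid, (1 + N.trials val)

/-- The outputs to come are the ways back from the zero state at level `n`, with nothing placed
above. -/
theorem wp_setup (hL : Lim N k M U) {ρ : ℕ → ℕ} (hn : σ.word 0 0 = N.n) (hm : σ.word 0 1 = N.m)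
    (htl : σ.word 1 = N.tl) (hhd : σ.word 2 = N.hd) (hw : ∀ a, 3 ≤ a → σ.word a = 0)
    (hs : Sorts (σ.real 1) N.n ρ) (hr2 : σ.real 2 = 0) (hr3 : σ.real 3 = 0)
    (hcmp : N.cmp = Compatible (sorted (σ.real 0) N.n ρ) (sorted (σ.real 1) N.n ρ)) :
    WP M U setup (setupTime hL) (fun σ' => ∃ x : ((ℕ → ℕ) → List ((ℕ → ℕ) × ℕ)) × List (ℕ → ℕ) × (ℕ → ℕ),
      (∀ r < N.n, x.2.2 r = ρ r) ∧
      Explored (fun p v c => p ∈ Net.states hL.valid ∧ N.Trans p v c) x.1 x.2.1 ∧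
      Enumerating N x.1 x.2.1 x.2.2 (outs x.1 N.n 0 []) σ') σ := by
  have hN := hL.valid
  have hnM := hL.n_lt
  have hmM := hL.m_lt
  have hU := hL.words
  have h2 := hN.two_le
  have hsq := hL.sq_lt
  have hnM' : N.n + 1 < M := by nlinarith
  obtain ⟨tt, htt⟩ : ∃ tt, setupTime hL = tt := ⟨_, rfl⟩
  have htt' := htt
  rw [setupTime] at htt'
  rw [htt]
  refine wp_seq (N.n * (5 * N.n + 20) + 3) (by omega)
    ((wp_sort hnM (by omega) hn hs hr2 hr3).mono le_rfl ?_)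
  rintro σ₁ hF₁ ⟨hid₁, hx₁, hy₁⟩
  have hn₁ : σ₁.word 0 0 = N.n := by rw [hF₁.word 0 (by decide), hn]
  have hm₁ : σ₁.word 0 1 = N.m := by rw [hF₁.word 0 (by decide), hm]
  have htl₁ : σ₁.word 1 = N.tl := by rw [hF₁.word 1 (by decide), htl]
  have hhd₁ : σ₁.word 2 = N.hd := by rw [hF₁.word 2 (by decide), hhd]
  refine wp_seq (4 * N.m + 5 * N.n + 10) (by omega) ((wp_findSource hN hnM (by omega) hU hn₁ hm₁ hhd₁
    fun i => by rw [hF₁.word w_mark (by decide), hw _ (by norm_num)]; rfl).mono le_rfl ?_)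
  intro σ₂ hF₂ hs₂
  have hE₂ : Env N σ₂ := by
    refine ⟨?_, ?_, ?_, ?_, hs₂, ?_⟩
    · rw [hF₂.word 0 (by decide), hn₁]
    · rw [hF₂.word 0 (by decide), hm₁]
    · rw [hF₂.word 1 (by decide), htl₁]
    · rw [hF₂.word 2 (by decide), hhd₁]
    · rw [hF₂.real 2 (by decide), hF₂.real 3 (by decide), hx₁, hy₁, hcmp]
  have hz : ∀ a, a ∉ sort.wordTargets → a ∉ findSource.wordTargets → 3 ≤ a → σ₂.word a = 0 := by
    intro a h1 h2 h3
    rw [hF₂.word a h2, hF₁.word a h1, hw a h3]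
  refine wp_seq _ ?_ ((wp_explore hL hE₂
    (fun i => by rw [hz w_head (by decide) (by decide) (by norm_num)]; rfl)
    (by rw [hz w_qh (by decide) (by decide) (by norm_num)]; rfl)
    (by rw [hz w_queue (by decide) (by decide) (by norm_num)]; rfl)).mono le_rfl ?_)
  · omega
  rintro σ₃ hF₃ ⟨preds, Q, hS₃, hrc₃, hX⟩
  have hn₃ : σ₃.word 0 0 = N.n := by rw [hF₃.word 0 (by decide), hE₂.n]
  refine wp_seq 1 (by omega) fun hfit => (?_ : WP M U _ _ _ σ₃) hfit
  have hhd0 := hfit.2 w_head 0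
  refine wp_wset le_rfl (by decide) (by simp only [WExpr.eval]; omega)
    (by simpa [WExpr.eval] using hhd0) ?_
  simp only [WExpr.eval, hn₃]
  set σ₄ := σ₃.setW w_pend (N.n - 1) (σ₃.word w_head 0) with hσ₄
  have hS₄ : Store N preds Q σ₄ := hS₃.setW (by decide)
  have hn₄ : σ₄.word 0 0 = N.n := by simp [hσ₄, hn₃]
  -- At first only the top position has alternatives, the steps into the final state.
  have hP₄ : Pending N (fun j => if j = N.n - 1 then preds 0 else []) 0 σ₄ := by
    refine ⟨fun j _ hj => ?_, fun j _ hj q hq => ?_⟩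
    · split_ifs with h
      · have := hS₃.chain 0 Net.Bounded.zero
        rw [Net.enc_zero] at this
        simpa [hσ₄, h] using this
      · have : σ₃.word w_pend = 0 := by
          rw [hF₃.word _ (by decide), hz w_pend (by decide) (by decide) (by norm_num)]
        simp [Chain, hσ₄, this, h]
    · split_ifs at hq with h
      · have hlev := atLevel_zero hN
        rw [show N.n = j + 1 by omega] at hlev
        obtain ⟨⟨ws, hw, -, hwr⟩, -⟩ := exists_reach_of_mem_preds hN hX hlev hq
        exact ⟨ws, hw, hwr⟩
      · simp at hq
  refine (wp_find (preds := preds) (by omega) (by omega) hn₄ hP₄).mono ?_ ?_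
  · omega
  rintro σ₅ hF₅ ⟨g1, g2, g3, g4⟩
  refine ⟨⟨preds, Q, σ₅.word w_id⟩, fun r hr => ?_, hX, ⟨?_, rfl, ?_, fun vs hvs => ?_,
    _, g1, g2, g3, ?_⟩⟩
  · change σ₅.word w_id r = ρ r
    rw [hF₅.word w_id (by decide), show σ₄.word w_id = σ₃.word w_id by simp [hσ₄],
      hF₃.word w_id (by decide), hF₂.word w_id (by decide), hid₁ r hr]
  · rw [hF₅.word 0 (by decide), hn₄]
  · exact hS₄.frame hF₅ (by decide)
  · obtain ⟨ws, hw, hr, rfl⟩ := (mem_outs hN hX (atLevel_zero hN)).1 hvs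
    rw [List.append_nil]
    exact ⟨hr, hw⟩
  · have hst : σ₅.word w_stack = σ₄.word w_stack := hF₅.word w_stack (by decide)
    rw [hst] at g4 ⊢
    refine Eq.trans ?_ g4
    obtain ⟨j, hj⟩ : ∃ j, N.n = j + 1 := ⟨N.n - 1, by omega⟩
    rw [outsFrom, Nat.sub_zero, hj, List.range'_concat, List.flatMap_append]
    have : (List.range' 0 j).flatMap (fun i => (if i = j + 1 - 1 then preds 0 else []).flatMap fun q =>
        outs preds i q.1 (q.2 :: stackFrom (j + 1) (σ₄.word w_stack) (i + 1))) = [] := by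
      rw [List.flatMap_eq_nil_iff]
      intro i hi
      rw [List.mem_range'_1] at hi
      rw [if_neg (by omega)]
      rfl
    rw [this]
    simp [outs, stackFrom]

end Upward

namespace Upward
open RealRAM

/-! ### From digraphs to nets -/

section
variable {n k : ℕ} {G : Digraph (Fin n)} {s t : Fin n} {E : List (Fin n × Fin n)}

/-- The net of a digraph given by a list of edges. -/
def netOf (E : List (Fin n × Fin n)) (s t : Fin n) (cmp : ℕ → ℕ → ℕ → ℕ → Prop) : Net where
  n := n
  m := E.length
  tl i := (E.map fun e => (e.1 : ℕ)).getD i 0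
  hd i := (E.map fun e => (e.2 : ℕ)).getD i 0
  s := s
  t := t
  cmp := cmp

variable {cmp : ℕ → ℕ → ℕ → ℕ → Prop}

theorem netOf_tl {e : ℕ} (he : e < E.length) : (netOf E s t cmp).tl e = (E[e].1 : ℕ) := by
  simp [netOf, he]

theorem netOf_hd {e : ℕ} (he : e < E.length) : (netOf E s t cmp).hd e = (E[e].2 : ℕ) := by
  simp [netOf, he]

/-- Well-founded induction along the ancestors: every vertex other than `s` has a predecessor. -/
theorem reach_source (hG : IsPlanarSTGraph G s t) (v : Fin n) : Relation.ReflTransGen G.Adj s v := by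
  have : Std.Irrefl (Relation.TransGen G.Adj) := ⟨hG.acyclic⟩
  have hwf : WellFounded (Relation.TransGen G.Adj) := Finite.wellFounded_of_trans_of_irrefl _
  induction v using hwf.induction with
  | _ v ih =>
    by_cases hv : v = s
    · subst hv; exact .refl
    · have h1 := mt (hG.source v).1 hv
      push Not at h1
      obtain ⟨u, hu⟩ := h1
      exact (ih u (.single hu)).tail hu

theorem reach_sink (hG : IsPlanarSTGraph G s t) (v : Fin n) : Relation.ReflTransGen G.Adj v t := by
  have : Std.Irrefl (Function.swap (Relation.TransGen G.Adj)) := ⟨hG.acyclic⟩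
  have : IsTrans _ (Function.swap (Relation.TransGen G.Adj)) := ⟨fun a b c h1 h2 => h2.trans h1⟩
  have hwf : WellFounded (Function.swap (Relation.TransGen G.Adj)) :=
    Finite.wellFounded_of_trans_of_irrefl _
  induction v using hwf.induction with
  | _ v ih =>
    by_cases hv : v = t
    · subst hv; exact .refl
    · have h1 := mt (hG.sink v).1 hv
      push Not at h1
      obtain ⟨u, hu⟩ := h1
      exact .head hu (ih u (.single hu))

theorem mem_of_reflTransGen {C : Fin n → Prop} (hC : ∀ u v, G.Adj u v → C v → C u) {u v : Fin n}
    (h : Relation.ReflTransGen G.Adj u v) (hv : C v) : C u := by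
  induction h using Relation.ReflTransGen.head_induction_on with
  | refl => exact hv
  | head h _ ih => exact hC _ _ h ih

open Classical in
/-- The edges leaving a set of vertices. -/
noncomputable def leaving (G : Digraph (Fin n)) (C : Fin n → Prop) : Finset (Fin n × Fin n) :=
  Finset.univ.filter fun e => G.Adj e.1 e.2 ∧ C e.1 ∧ ¬ C e.2

theorem mem_leaving {C : Fin n → Prop} {e : Fin n × Fin n} :
    e ∈ leaving G C ↔ G.Adj e.1 e.2 ∧ C e.1 ∧ ¬ C e.2 := by
  simp [leaving]

theorem adj_ne (hG : IsPlanarSTGraph G s t) {u v : Fin n} (h : G.Adj u v) : u ≠ v := by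
  rintro rfl
  exact hG.acyclic u (.single h)

/-- A directed path from `s` to a vertex of `C` stays in `C`, and a directed path from outside `C`
to `t` stays outside. So both sides are connected after the removal, and no remaining edge joins
them. -/
theorem isSTCutset_leaving (hG : IsPlanarSTGraph G s t) {C : Fin n → Prop}
    (hC : ∀ u v, G.Adj u v → C v → C u) (hs : C s) (ht : ¬ C t) : IsSTCutset G s t (leaving G C) := by
  have hR : ∀ {u v}, (remainingGraph G (leaving G C)).Reachable u v → (C u ↔ C v) := by
    rintro u v ⟨p⟩
    induction p with
    | nil => rfl
    | @cons a b c hab _ ih =>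
      rw [← ih]
      rw [remainingGraph, SimpleGraph.fromRel_adj] at hab
      rcases hab.2 with ⟨h1, h2⟩ | ⟨h1, h2⟩
      · rw [mem_leaving] at h2
        exact ⟨fun ha => by by_contra hb; exact h2 ⟨h1, ha, hb⟩, hC _ _ h1⟩
      · rw [mem_leaving] at h2
        exact ⟨hC _ _ h1, fun hb => by by_contra ha; exact h2 ⟨h1, hb, ha⟩⟩
  have hadj : ∀ {u v}, G.Adj u v → (C u ↔ C v) → (remainingGraph G (leaving G C)).Adj u v := by
    intro u v h huv
    rw [remainingGraph, SimpleGraph.fromRel_adj]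
    exact ⟨adj_ne hG h, Or.inl ⟨h, fun hl => (mem_leaving.1 hl).2.2 (huv.1 (mem_leaving.1 hl).2.1)⟩⟩
  have h1 : ∀ v, C v → (remainingGraph G (leaving G C)).Reachable s v := by
    intro v hv
    have := reach_source hG v
    induction this with
    | refl => rfl
    | tail _ h ih => exact (ih (hC _ _ h hv)).trans (hadj h ⟨fun _ => hv, hC _ _ h⟩).reachable
  have h2 : ∀ v, ¬ C v → (remainingGraph G (leaving G C)).Reachable t v := by
    intro v hv
    have := reach_sink hG v
    induction this using Relation.ReflTransGen.head_induction_on with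
    | refl => rfl
    | head h _ ih =>
      have hn := fun hc => hv (hC _ _ h hc)
      exact (ih hn).trans (hadj h ⟨fun hc => absurd hc hv, fun hc => absurd hc hn⟩).symm.reachable
  refine ⟨fun e he => (mem_leaving.1 he).1, fun h => ht ((hR h).1 hs), fun v => ?_, fun e he => ?_⟩
  · by_cases hv : C v
    · exact Or.inl (h1 v hv)
    · exact Or.inr (h2 v hv)
  · exact ⟨h1 _ (mem_leaving.1 he).2.1, h2 _ (mem_leaving.1 he).2.2⟩

/-- A closed set that contains `t` contains everything, and one without `s` is empty; in both cases
no edge leaves it. -/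
theorem card_leaving_le (hG : IsPlanarSTGraph G s t)
    (hk : ∀ W : Finset (Fin n × Fin n), IsSTCutset G s t W → W.card ≤ k) {C : Fin n → Prop}
    (hC : ∀ u v, G.Adj u v → C v → C u) : (leaving G C).card ≤ k := by
  by_cases hs : C s
  · by_cases ht : C t
    · have : leaving G C = ∅ := by
        refine Finset.eq_empty_of_forall_notMem fun e he => (mem_leaving.1 he).2.2 ?_
        exact mem_of_reflTransGen hC (reach_sink hG _) ht
      simp [this]
    · exact hk _ (isSTCutset_leaving hG hC hs ht)
  · have : leaving G C = ∅ := by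
      refine Finset.eq_empty_of_forall_notMem fun e he => hs ?_
      exact mem_of_reflTransGen hC (reach_source hG _) (mem_leaving.1 he).2.1
    simp [this]

open Classical in
theorem netOf_valid (hG : IsPlanarSTGraph G s t)
    (hk : IsGreatest {c : ℕ | ∃ W : Finset (Fin n × Fin n), IsSTCutset G s t W ∧ W.card = c} k)
    (hE : E.Nodup) (hEG : ∀ e, e ∈ E ↔ G.Adj e.1 e.2)
    (hcmp : ∀ a b a' b', cmp a b a' b' → cmp a' b' a b) : (netOf E s t cmp).Valid k := by
  obtain ⟨⟨W₀, hW₀, -⟩, hmax⟩ := hk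
  have hst : s ≠ t := by
    rintro rfl
    exact hW₀.separates (SimpleGraph.Reachable.refl _)
  have hadj : ∀ {e} (he : e < E.length), G.Adj E[e].1 E[e].2 := fun he =>
    (hEG _).1 (List.getElem_mem he)
  have hex : ∀ {u v}, G.Adj u v → ∃ (e : ℕ) (he : e < E.length), E[e] = (u, v) := by
    intro u v h
    exact List.mem_iff_getElem.1 ((hEG (u, v)).2 h)
  have hle := fun W hW => hmax ⟨W, hW, rfl⟩
  refine ⟨?_, fun e he => ?_, fun e he => ?_, ?_, s.2, ?_, ?_, ?_, ?_, ?_, ?_, hcmp⟩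
  · change 2 ≤ n
    by_contra hn
    have := s.2
    have := t.2
    exact hst (Fin.ext (by omega))
  · rw [netOf_tl he]; exact E[e].1.2
  · rw [netOf_hd he]; exact E[e].2.2
  -- The number of proper ancestors strictly increases along edges.
  · let R : Fin n → Finset (Fin n) := fun v => Finset.univ.filter fun u => Relation.TransGen G.Adj u v
    refine ⟨fun i => if h : i < n then (R ⟨i, h⟩).card else 0, fun e he => ?_⟩
    simp only [netOf_tl he, netOf_hd he, Fin.is_lt, dif_pos, Fin.eta]
    refine Finset.card_lt_card (Finset.ssubset_iff_subset_ne.2 ⟨fun u hu => ?_, fun heq => ?_⟩)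
    · simp only [R, Finset.mem_filter, Finset.mem_univ, true_and] at hu ⊢
      exact hu.tail (hadj he)
    · have : E[e].1 ∈ R E[e].2 := by
        simp only [R, Finset.mem_filter, Finset.mem_univ, true_and]
        exact .single (hadj he)
      rw [← heq] at this
      simp only [R, Finset.mem_filter, Finset.mem_univ, true_and] at this
      exact hG.acyclic _ this
  · exact fun h => hst (Fin.ext h)
  · intro v hv hne
    have h1 := mt (hG.source ⟨v, hv⟩).1 fun h => hne (congrArg Fin.val h)
    push Not at h1
    obtain ⟨u, hu⟩ := h1
    obtain ⟨e, he, heq⟩ := hex hu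
    exact ⟨e, he, by rw [netOf_hd he, heq]⟩
  · intro e he h
    rw [netOf_hd he] at h
    have h' : E[e].2 = s := Fin.ext h
    exact (hG.source s).2 rfl E[e].1 (h' ▸ hadj he)
  · intro v hv hne
    have h1 := mt (hG.sink ⟨v, hv⟩).1 fun h => hne (congrArg Fin.val h)
    push Not at h1
    obtain ⟨u, hu⟩ := h1
    obtain ⟨e, he, heq⟩ := hex hu
    exact ⟨e, he, by rw [netOf_tl he, heq]⟩
  · intro C hC
    have hC' : ∀ u v : Fin n, G.Adj u v → (v : ℕ) ∈ C → (u : ℕ) ∈ C := by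
      intro u v huv hv
      obtain ⟨e, he, heq⟩ := hex huv
      have := hC e he
      rw [netOf_tl he, netOf_hd he, heq] at this
      exact this hv
    refine le_trans ?_ (card_leaving_le hG hle (C := fun v => (v : ℕ) ∈ C) hC')
    refine Finset.card_le_card_of_injOn (fun e => E.getD e (s, s)) ?_ ?_
    · intro e he
      simp only [Finset.coe_filter, Finset.mem_range, Set.mem_ofPred_eq] at he
      have hlt : e < E.length := he.1
      rw [netOf_tl hlt, netOf_hd hlt] at he
      simp only [Finset.mem_coe, mem_leaving, List.getD_eq_getElem _ _ hlt]
      exact ⟨hadj hlt, he.2⟩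
    · intro e he e' he' h
      simp only [Finset.coe_filter, Finset.mem_range, Set.mem_ofPred_eq] at he he'
      have hlt : e < E.length := he.1
      have hlt' : e' < E.length := he'.1
      simp only [List.getD_eq_getElem _ _ hlt, List.getD_eq_getElem _ _ hlt'] at h
      exact (hE.getElem_inj_iff).1 h
  · change 2 * E.length + n ≤ n * n
    have h1 : E.toFinset.card = E.length := List.toFinset_card_of_nodup hE
    -- By acyclicity the edges and their reversals are disjoint sets of off-diagonal pairs, whence
    -- `2 m ≤ n² - n`.
    have h2 : (E.toFinset.map (Equiv.prodComm _ _).toEmbedding).card = E.length := by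
      rw [Finset.card_map, h1]
    have hdisj : Disjoint E.toFinset (E.toFinset.map (Equiv.prodComm _ _).toEmbedding) := by
      rw [Finset.disjoint_left]
      intro e he he'
      obtain ⟨e', h3, rfl⟩ := Finset.mem_map.1 he'
      rw [List.mem_toFinset, hEG] at he h3
      exact hG.acyclic _ (.trans (.single he) (.single h3))
    have hsub : E.toFinset ∪ E.toFinset.map (Equiv.prodComm _ _).toEmbedding ⊆
        (Finset.univ : Finset (Fin n)).offDiag := by
      intro e he
      rw [Finset.mem_offDiag]
      refine ⟨Finset.mem_univ _, Finset.mem_univ _, ?_⟩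
      rcases Finset.mem_union.1 he with he | he
      · exact adj_ne hG ((hEG _).1 (List.mem_toFinset.1 he))
      · obtain ⟨e', he', rfl⟩ := Finset.mem_map.1 he
        exact (adj_ne hG ((hEG _).1 (List.mem_toFinset.1 he'))).symm
    have := Finset.card_le_card hsub
    rw [Finset.card_union_of_disjoint hdisj, h1, h2, Finset.offDiag_card, Finset.card_univ,
      Fintype.card_fin] at this
    have hn : n ≤ n * n := Nat.le_mul_self n
    omega

/-- Edges without a common range of positive height cannot cross, and for the others `Compatible` is
equivalent to disjointness. That no vertex lies inside an edge need not be tested: every vertex is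
an end of some edge. -/
theorem isUPSE_iff (hG : IsPlanarSTGraph G s t) (hst : s ≠ t) (hEG : ∀ e, e ∈ E ↔ G.Adj e.1 e.2)
    (hE : E.Nodup) {X Y : ℕ → ℝ} (hY : ∀ i j, i < j → j < n → Y i < Y j) {S : Set (ℝ × ℝ)}
    {Γ : Fin n → ℝ × ℝ} (hS : ∀ v, Γ v ∈ S) {π : ℕ → ℕ} (hπ : ∀ v : Fin n, Γ v = (X (π v), Y (π v)))
    (hlt : ∀ v < n, π v < n) :
    IsUPSE G S Γ ↔ (netOf E s t (Compatible X Y)).Drawing π := by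
  have hY' : ∀ i < n, ∀ j < n, (Y i < Y j ↔ i < j) := by
    intro i hi j hj
    refine ⟨fun h => ?_, fun h => hY i j h hj⟩
    by_contra hle
    rcases (not_lt.1 hle).eq_or_lt with h' | h'
    · subst h'; exact lt_irrefl _ h
    · exact lt_asymm h (hY j i h' hi)
  have hadj : ∀ {e} (he : e < E.length), G.Adj E[e].1 E[e].2 := fun he =>
    (hEG _).1 (List.getElem_mem he)
  have hp : ∀ v : Fin n, π v < n := fun v => hlt v v.2
  constructor
  · intro h
    have hup : ∀ u v : Fin n, G.Adj u v → π u < π v := by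
      intro u v huv
      have := h.upward u v huv
      rw [hπ, hπ] at this
      exact (hY' _ (hp u) _ (hp v)).1 this
    refine ⟨hlt, fun u hu v hv huv => ?_, fun e he => ?_, fun e he e' he' hne hov => ?_⟩
    · have : Γ ⟨u, hu⟩ = Γ ⟨v, hv⟩ := by rw [hπ, hπ]; simp [huv]
      exact congrArg Fin.val (h.injective this)
    · rw [netOf_tl he, netOf_hd he]
      exact hup _ _ (hadj he)
    · rw [netOf_tl he, netOf_hd he, netOf_tl he', netOf_hd he'] at hov ⊢
      have hne' : (E[e].1, E[e].2) ≠ (E[e'].1, E[e'].2) := fun heq =>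
        hne ((hE.getElem_inj_iff).1 heq)
      have d1 := h.noncrossing _ _ _ _ (hadj he) (hadj he') hne'
      have d2 := h.noncrossing _ _ _ _ (hadj he') (hadj he) hne'.symm
      simp only [hπ] at d1 d2
      exact compatible_of_disjoint hY (hup _ _ (hadj he)) (hp _) (hup _ _ (hadj he')) (hp _) hov d1 d2
  · intro h
    have hex : ∀ {u v}, G.Adj u v → ∃ (e : ℕ) (he : e < E.length), E[e] = (u, v) := by
      intro u v h
      exact List.mem_iff_getElem.1 ((hEG (u, v)).2 h)
    have hup : ∀ u v : Fin n, G.Adj u v → π u < π v := by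
      intro u v huv
      obtain ⟨e, he, heq⟩ := hex huv
      have := h.up e he
      rwa [netOf_tl he, netOf_hd he, heq] at this
    have hupY : ∀ u v : Fin n, G.Adj u v → Y (π u) < Y (π v) := fun u v huv =>
      hY _ _ (hup u v huv) (hp v)
    have hcross : ∀ u v u' v', G.Adj u v → G.Adj u' v' → (u, v) ≠ (u', v') →
        Disjoint (openSegment ℝ (Γ u) (Γ v)) (segment ℝ (Γ u') (Γ v')) := by
      intro u v u' v' huv huv' hne
      simp only [hπ]
      by_cases hov : max (π u) (π u') < min (π v) (π v')
      · obtain ⟨e, he, heq⟩ := hex huv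
        obtain ⟨e', he', heq'⟩ := hex huv'
        have := h.cmp e he e' he' fun hee => hne (by subst hee; rw [← heq, ← heq'])
        rw [netOf_tl he, netOf_hd he, netOf_tl he', netOf_hd he', heq, heq'] at this
        exact (this hov).disjoint hY (hup _ _ huv) (hp _) (hup _ _ huv') (hp _) hov
      · have h1 := hup _ _ huv
        have h2 := hup _ _ huv'
        have hmono : ∀ i < n, ∀ j < n, i ≤ j → Y i ≤ Y j := fun i hi j hj hij => by
          by_contra hlt'
          exact absurd ((hY' j hj i hi).1 (not_le.1 hlt')) (by omega)
        refine disjoint_of_le (hupY _ _ huv) (hupY _ _ huv') ?_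
        rcases le_or_gt (π v) (π u') with h3 | h3
        · exact Or.inl (hmono _ (hp _) _ (hp _) h3)
        · exact Or.inr (hmono _ (hp _) _ (hp _) (by omega))
    refine ⟨fun u v huv => ?_, hS, fun u v huv => ?_, fun u v huv w hw => ?_, hcross⟩
    · rw [hπ, hπ] at huv
      have hyy : Y (π u) = Y (π v) := congrArg Prod.snd huv
      have : π u = π v := by
        rcases lt_trichotomy (π u) (π v) with h' | h' | h'
        · exact absurd hyy (hY _ _ h' (hp v)).ne
        · exact h'
        · exact absurd hyy (hY _ _ h' (hp u)).ne'
      exact Fin.ext (h.inj u u.2 v v.2 this)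
    · rw [hπ, hπ]
      exact hupY u v huv
    · have hw' := hw
      simp only [hπ] at hw'
      rw [mem_openSegment_iff (hupY u v huv)] at hw'
      have hwu : w ≠ u := fun h => by subst h; exact lt_irrefl _ hw'.1
      have hwv : w ≠ v := fun h => by subst h; exact lt_irrefl _ hw'.2.1
      -- A vertex `w` inside the edge `uv` would be an end of a second edge, outgoing if `w = s` and
      -- incoming otherwise, and that edge would meet `uv`.
      by_cases hws : w = s
      · have h1 := mt (hG.sink w).1 fun h => hst (hws ▸ h)
        push Not at h1
        obtain ⟨z, hz⟩ := h1
        refine Set.disjoint_left.1 (hcross u v w z huv hz ?_) hw (left_mem_segment ℝ _ _)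
        exact fun h => hwu (Prod.ext_iff.1 h).1.symm
      · have h1 := mt (hG.source w).1 hws
        push Not at h1
        obtain ⟨z, hz⟩ := h1
        refine Set.disjoint_left.1 (hcross u v z w huv hz ?_) hw (right_mem_segment ℝ _ _)
        exact fun h => hwv (Prod.ext_iff.1 h).2.symm

end
end Upward

namespace Upward
open RealRAM

/-! ### Bounds -/

section
variable {N : Net} {k : ℕ}

/-- Each factor `2 B` is at most `n⁴`, and the factor `n⁴` in front replaces the missing one. -/
theorem Net.Valid.trials_mul_le (hN : N.Valid k) :
    N.n * (N.n ^ 3 * N.base ^ (k - 1)) * 2 ^ (k - 1) ≤ N.n ^ (4 * k) := by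
  obtain ⟨j, rfl⟩ : ∃ j, k = j + 1 := ⟨k - 1, by have := hN.k_pos; omega⟩
  rw [Nat.add_sub_cancel]
  calc N.n * (N.n ^ 3 * N.base ^ j) * 2 ^ j = N.n ^ 4 * (2 * N.base) ^ j := by rw [mul_pow]; ring
    _ ≤ N.n ^ 4 * (N.n ^ 4) ^ j := Nat.mul_le_mul_left _ (Nat.pow_le_pow_left hN.two_mul_base_le j)
    _ = N.n ^ (4 * (j + 1)) := by rw [← pow_mul, ← pow_add]; ring_nf

theorem Net.Valid.sq_le (hN : N.Valid k) : N.n * N.n ≤ N.n ^ (4 * k) := by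
  rw [← pow_two]
  refine Nat.pow_le_pow_right ?_ ?_
  · have := hN.two_le; omega
  · have := hN.k_pos; omega

theorem lim_of_valid (hN : N.Valid k) {U : ℕ} (hU : N.n ^ (4 * k) + 3 ≤ U) :
    Lim N k (N.n ^ (4 * k) + 3) U := by
  refine ⟨hN, ?_, ?_, hU⟩
  · have : N.base ^ k ≤ (N.n ^ 4) ^ k :=
      Nat.pow_le_pow_left (by have := hN.two_mul_base_le; omega) k
    rw [← pow_mul] at this
    omega
  · have h1 := Net.sum_trials_le hN
    have h2 := hN.trials_mul_le
    have h3 : N.n ^ 3 * N.base ^ (k - 1) ≤ N.n * (N.n ^ 3 * N.base ^ (k - 1)) * 2 ^ (k - 1) := by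
      have h2 := hN.two_le
      rw [mul_assoc, mul_comm (N.n ^ 3 * _), ← mul_assoc]
      exact Nat.le_mul_of_pos_left _ (by positivity)
    omega

theorem setupTime_le {M U : ℕ} (hL : Lim N k M U) :
    setupTime hL + 1 ≤ 2500 * (k * N.n ^ (4 * k)) := by
  have hN := hL.valid
  have h2 := hN.two_le
  have hk := hN.k_pos
  have hsq := hN.sq_le
  have hsize := hN.size
  set D := N.n ^ (4 * k) with hD
  set T := N.n ^ 3 * N.base ^ (k - 1) with hT
  have hT1 : 1 ≤ T := by
    have : 0 < N.base := by rw [Net.base]; omega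
    rw [hT]
    exact Nat.succ_le_of_lt (by positivity)
  have hsum : ∑ val ∈ Net.states hN, (1 + N.trials val) ≤ 3 * T := by
    rw [Finset.sum_add_distrib, Finset.sum_const, smul_eq_mul, mul_one]
    have h1 := Net.card_states_le hN
    have h2 := Net.sum_trials_le hN
    omega
  -- One trial costs `O(n k²)`; the gained power of `2` absorbs one of the two factors `k`.
  have hkp : k ≤ 2 ^ (k - 1) := by
    have := Nat.lt_two_pow_self (n := k - 1)
    omega
  have hkk : k * (N.n * T) ≤ D := by
    calc k * (N.n * T) ≤ 2 ^ (k - 1) * (N.n * T) := Nat.mul_le_mul_right _ hkp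
      _ = N.n * T * 2 ^ (k - 1) := mul_comm _ _
      _ ≤ D := hN.trials_mul_le
  have hm : N.m + 1 ≤ 2 * (N.n * k) := by
    have h1 := hN.m_le
    have : 1 ≤ N.n * k := Nat.mul_pos (by omega) hk
    omega
  have hmain : unitCost N k * ∑ val ∈ Net.states hN, (1 + N.trials val) ≤ 2400 * (k * D) := by
    calc unitCost N k * ∑ val ∈ Net.states hN, (1 + N.trials val)
        ≤ (200 * (2 * (N.n * k)) * (2 * k)) * (3 * T) := by
          refine Nat.mul_le_mul ?_ hsum
          exact Nat.mul_le_mul (Nat.mul_le_mul_left _ hm) (by omega)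
      _ = 2400 * (k * (k * (N.n * T))) := by ring
      _ ≤ 2400 * (k * D) := Nat.mul_le_mul_left _ (Nat.mul_le_mul_left _ hkk)
  have hrest : N.n * (5 * N.n + 20) + 4 * N.m + 8 * N.n + 51 ≤ 100 * D := by nlinarith
  have hkD : D ≤ k * D := Nat.le_mul_of_pos_left _ hk
  rw [setupTime]
  omega

/-- The two extra bits multiply by `4`, which covers the `+ 3`; the constant `20` comes from `10`
bits per unit of `k log₂ n` and `log 2 ≥ 1/2`. -/
theorem wordLength_le {n k : ℕ} (hn : 2 ≤ n) (hk : 0 < k) :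
    n ^ (4 * k) + 3 ≤ 2 ^ (4 * k * (Nat.log 2 n + 1) + 2) ∧
      ((4 * k * (Nat.log 2 n + 1) + 2 : ℕ) : ℝ) ≤ 20 * (k * Real.log n) := by
  constructor
  · have h1 : n ^ (4 * k) ≤ (2 ^ (Nat.log 2 n + 1)) ^ (4 * k) :=
      Nat.pow_le_pow_left (Nat.lt_pow_succ_log_self (by norm_num) n).le _
    rw [← pow_mul, mul_comm (Nat.log 2 n + 1)] at h1
    have h2 : 0 < n ^ (4 * k) := by positivity
    rw [pow_add]
    omega
  · have h1 : 1 ≤ Nat.log 2 n := Nat.log_pos (by norm_num) hn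
    have h2 : (4 * k * (Nat.log 2 n + 1) + 2 : ℕ) ≤ 10 * (k * Nat.log 2 n) := by nlinarith
    have h3 : (Nat.log 2 n : ℝ) * Real.log 2 ≤ Real.log n := by
      rw [← Real.log_pow]
      refine Real.log_le_log (by positivity) ?_
      exact_mod_cast Nat.pow_log_le_self 2 (by omega)
    have h4 : (0.5 : ℝ) ≤ Real.log 2 := by have := Real.log_two_gt_d9; norm_num at this ⊢; linarith
    have h5 : (Nat.log 2 n : ℝ) ≤ 2 * Real.log n := by
      have : (0 : ℝ) ≤ Nat.log 2 n := by positivity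
      nlinarith
    have h6 : ((4 * k * (Nat.log 2 n + 1) + 2 : ℕ) : ℝ) ≤ 10 * (k * Nat.log 2 n) := by exact_mod_cast h2
    have h7 : (k : ℝ) * Nat.log 2 n ≤ k * (2 * Real.log n) :=
      mul_le_mul_of_nonneg_left h5 (by positivity)
    linarith

end

/-! ### The main result -/

theorem inputState_fit {n M w : ℕ} {E : List (Fin n × Fin n)} {p : Fin n → ℝ × ℝ}
    (hn : n < M) (hm : E.length < M) (h2 : 2 ≤ M) (hU : M ≤ 2 ^ w) :
    (inputState E p).Fit M (2 ^ w) := by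
  refine ⟨fun a i hai => ⟨?_, ?_⟩, fun a i => ?_⟩
  · rcases hai with ha | hi
    · match a, ha with
      | a + 3, _ => rfl
    · match a with
      | 0 => exact List.getD_eq_default _ _ (by simp; omega)
      | 1 => exact List.getD_eq_default _ _ (by simp; omega)
      | 2 => exact List.getD_eq_default _ _ (by simp; omega)
      | a + 3 => rfl
  · rcases hai with ha | hi
    · match a, ha with
      | a + 2, _ => simp [inputState]
    · simp [inputState, show ¬ i < n by omega]
  · have hlist : ∀ l : List ℕ, (∀ x ∈ l, x < M) → l.getD i 0 < 2 ^ w := by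
      intro l hl
      rcases lt_or_ge i l.length with h | h
      · rw [List.getD_eq_getElem _ _ h]
        exact (hl _ (List.getElem_mem h)).trans_le hU
      · rw [List.getD_eq_default _ _ h]
        omega
    match a with
    | 0 => exact hlist _ (by simp [hn, hm])
    | 1 =>
      refine hlist _ fun x hx => ?_
      obtain ⟨e, -, rfl⟩ := List.mem_map.1 hx
      exact e.1.2.trans hn
    | 2 =>
      refine hlist _ fun x hx => ?_
      obtain ⟨e, -, rfl⟩ := List.mem_map.1 hx
      exact e.2.2.trans hn
    | a + 3 => exact Nat.two_pow_pos w

/-- The output for the vertex list `vs`, where `id` lists the points by height. -/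
def outputOf (n : ℕ) (id : ℕ → ℕ) (vs : List ℕ) : List ℕ :=
  (List.range n).map fun v => id (vs.idxOf v)

theorem outputOf_eq_encode {n : ℕ} {id : ℕ → ℕ} {vs : List ℕ} {f : Fin n → Fin n}
    (h : ∀ v : Fin n, id (vs.idxOf (v : ℕ)) = f v) : outputOf n id vs = encode f := by
  refine List.ext_getElem (by simp [outputOf, encode]) fun i h1 h2 => ?_
  have hi : i < n := by simpa [outputOf] using h1
  simpa [outputOf, encode] using h ⟨i, hi⟩

/-- The sorting permutation is injective on positions, so an output determines the position of every
vertex and hence the order of placement. -/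
theorem outputOf_injOn {N : Net} {k : ℕ} (hN : N.Valid k) {id ρ : ℕ → ℕ} {Y : ℕ → ℝ}
    (hs : Sorts Y N.n ρ) (hid : ∀ r < N.n, id r = ρ r) {vs vs' : List ℕ} (h : N.Reach vs 0)
    (hl : vs.length = N.n) (h' : N.Reach vs' 0) (hl' : vs'.length = N.n)
    (heq : outputOf N.n id vs = outputOf N.n id vs') : vs = vs' := by
  have hi := h.inv hN
  have hi' := h'.inv hN
  refine List.ext_getElem (by omega) fun i h1 h2 => ?_
  have hv : vs[i] < N.n := hi.lt _ (List.getElem_mem h1)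
  have hv' : vs[i] ∈ vs' := hi'.mem_of_full hl'.ge hv
  have hidx' : vs'.idxOf vs[i] < N.n := by rw [← hl']; exact List.idxOf_lt_length_iff.2 hv'
  have e1 : id (vs.idxOf vs[i]) = id (vs'.idxOf vs[i]) :=
    (List.map_inj_left.1 heq) _ (List.mem_range.2 hv)
  rw [hi.nodup.idxOf_getElem i h1, hid i (by omega), hid _ hidx'] at e1
  have e2 : i = vs'.idxOf vs[i] :=
    (hs.rank_eq i (by omega)).symm.trans ((congrArg (rank Y N.n) e1).trans (hs.rank_eq _ hidx'))
  have e3 : vs'[vs'.idxOf vs[i]]'(by omega) = vs[i] := List.getElem_idxOf (by omega)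
  rw [← e3]
  congr 1
  exact e2.symm

theorem enumerates {n k : ℕ} {G : Digraph (Fin n)} {s t : Fin n} {E : List (Fin n × Fin n)}
    {p : Fin n → ℝ × ℝ} (hG : IsPlanarSTGraph G s t)
    (hk : IsGreatest {c : ℕ | ∃ W : Finset (Fin n × Fin n), IsSTCutset G s t W ∧ W.card = c} k)
    (hE : E.Nodup) (hEG : ∀ e, e ∈ E ↔ G.Adj e.1 e.2) (hp : Function.Injective fun i => (p i).2) :
    Enumerates Prog.main (inputState E p)
      {x | ∃ f : Fin n → Fin n, IsUPSE G (Set.range p) (fun v => p (f v)) ∧ x = encode f}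
      (10000 * ((k : ℝ) * (n : ℝ) ^ (4 * k) * Real.log n)) (10000 * (n : ℝ))
      (10000 * ((k : ℝ) * (n : ℝ) ^ (4 * k) * Real.log n)) (10000 * ((k : ℝ) * Real.log n)) := by
  have hreal₀ : ∀ i (h : i < n), (inputState E p).real 0 i = (p ⟨i, h⟩).1 := fun i h => dif_pos h
  have hreal₁ : ∀ i (h : i < n), (inputState E p).real 1 i = (p ⟨i, h⟩).2 := fun i h => dif_pos h
  obtain ⟨ρ, hs⟩ : ∃ ρ, Sorts ((inputState E p).real 1) n ρ := exists_sorts fun i hi j hj h => by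
    rw [hreal₁ i hi, hreal₁ j hj] at h
    exact congrArg Fin.val (hp h)
  set X := sorted ((inputState E p).real 0) n ρ with hX
  set Y := sorted ((inputState E p).real 1) n ρ with hY
  have hpt : ∀ r (hr : r < n), (X r, Y r) = p ⟨ρ r, hs.lt r hr⟩ := by
    intro r hr
    rw [hX, hY, sorted, sorted, if_pos hr, if_pos hr, hreal₀ _ (hs.lt r hr), hreal₁ _ (hs.lt r hr)]
  have hmono : ∀ i j, i < j → j < n → Y i < Y j := by
    intro i j hij hj
    rw [hY, sorted, sorted, if_pos (hij.trans hj), if_pos hj]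
    exact hs.strictMono hij hj
  set N := netOf E s t (Compatible X Y) with hNdef
  have hN : N.Valid k := netOf_valid hG hk hE hEG fun _ _ _ _ h => h.symm
  have h2 : 2 ≤ n := hN.two_le
  have hk0 := hN.k_pos
  have hst : s ≠ t := fun h => hN.s_ne_t (congrArg Fin.val h)
  obtain ⟨hU, hw⟩ := wordLength_le h2 hk0
  set w := 4 * k * (Nat.log 2 n + 1) + 2 with hwdef
  have hL : Lim N k (n ^ (4 * k) + 3) (2 ^ w) := lim_of_valid hN hU
  have hfit : (inputState E p).Fit (n ^ (4 * k) + 3) (2 ^ w) :=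
    inputState_fit hL.n_lt hL.m_lt (by omega) hU
  have hr0 : ∀ a, 2 ≤ a → (inputState E p).real a = 0 := by
    intro a ha
    match a, ha with
    | a + 2, _ => funext i; simp [inputState]
  obtain ⟨⟨preds, Q, id⟩, hx⟩ := (wp_setup (σ := inputState E p) hL rfl rfl rfl rfl
    (fun a ha => match a, ha with | a + 3, _ => rfl) hs (hr0 2 le_rfl) (hr0 3 (by norm_num))
    rfl).exists_post hfit
  -- The facts about `id` and `preds` do not mention the memory, so they may be read off at the end
  -- of the set-up phase and used throughout.
  obtain ⟨σ', -, -, -, ⟨hid, hXp, -⟩, -⟩ := hx hfit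
  have hid : ∀ r < n, id r = ρ r := hid
  have hmem : ∀ vs, vs ∈ outs preds n 0 [] ↔ N.Reach vs 0 ∧ vs.length = n := by
    intro vs
    refine (mem_outs hN hXp (atLevel_zero hN)).trans ⟨?_, fun h => ⟨vs, h.2, h.1, by simp⟩⟩
    rintro ⟨ws, h1, h2, rfl⟩
    rw [List.append_nil]
    exact ⟨h2, h1⟩
  have hiff : ∀ (π : ℕ → ℕ) (f : Fin n → Fin n), (∀ v : Fin n, π v < n) →
      (∀ v : Fin n, ρ (π v) = f v) →
      (IsUPSE G (Set.range p) (fun v => p (f v)) ↔ N.Drawing π) := by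
    intro π f h1 h2
    refine isUPSE_iff (S := Set.range p) (Γ := fun v => p (f v)) hG hst hEG hE hmono
      (fun v => ⟨f v, rfl⟩) (fun v => ?_) fun v hv => h1 ⟨v, hv⟩
    rw [hpt _ (h1 v)]
    congr 1
    exact Fin.ext (h2 v).symm
  have hD : (0 : ℝ) < (n : ℝ) ^ (4 * k) := by positivity
  have hlog : (0.5 : ℝ) ≤ Real.log n := by
    have h1 := Real.log_two_gt_d9
    have h2 : Real.log 2 ≤ Real.log n := Real.log_le_log (by norm_num) (by exact_mod_cast h2)
    norm_num at h1 ⊢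
    linarith
  have hkR : (1 : ℝ) ≤ k := by exact_mod_cast hk0
  have hnR : (2 : ℝ) ≤ n := by exact_mod_cast h2
  have hD1 : (1 : ℝ) ≤ (n : ℝ) ^ (4 * k) := one_le_pow₀ (by linarith)
  refine enumerates_of_loop (A' := arrays) (w := w) (tb := 23 * n + 30)
    (fun l σ => ∃ rem, l = rem.map (outputOf n id) ∧ Enumerating N preds Q id rem σ)
    (L := (outs preds n 0 []).map (outputOf n id)) ?_ ?_ hfit rfl rfl
    (hx.mono le_rfl fun σ'' _ h => ?_) ?_ ?_ ?_ ?_ rfl ?_ ?_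
  · refine List.Nodup.map_on ?_ (nodup_outs hN hXp (atLevel_zero hN))
    intro vs hvs vs' hvs' heq
    obtain ⟨a1, a2⟩ := (hmem vs).1 hvs
    obtain ⟨b1, b2⟩ := (hmem vs').1 hvs'
    exact outputOf_injOn hN hs hid a1 a2 b1 b2 heq
  · intro x
    rw [List.mem_map]
    constructor
    · rintro ⟨vs, hvs, rfl⟩
      obtain ⟨a1, a2⟩ := (hmem vs).1 hvs
      have hdr := a1.drawing hN a2
      have hlt : ∀ v : Fin n, vs.idxOf (v : ℕ) < n := fun v => hdr.lt v v.2
      refine ⟨fun v => ⟨ρ (vs.idxOf (v : ℕ)), hs.lt _ (hlt v)⟩, (hiff _ _ hlt fun v => rfl).2 hdr, ?_⟩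
      exact outputOf_eq_encode fun v => hid _ (hlt v)
    · rintro ⟨f, hf, rfl⟩
      let π : ℕ → ℕ := fun v => if h : v < n then rank ((inputState E p).real 1) n (f ⟨v, h⟩) else 0
      have hπ : ∀ v : Fin n, π v = rank ((inputState E p).real 1) n (f v) := fun v => by simp [π]
      have hdr := (hiff π f (fun v => by rw [hπ]; exact rank_lt (f v).2)
        fun v => by rw [hπ]; exact hs.eq_rank _ (f v).2).1 hf
      obtain ⟨ws, w1, w2, w3⟩ := hdr.reach hN
      refine ⟨ws, (hmem ws).2 ⟨w1, w2⟩, outputOf_eq_encode fun v => ?_⟩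
      rw [w3 v v.2, hπ, hid _ (rank_lt (f v).2), hs.eq_rank _ (f v).2]
  · exact ⟨_, rfl, h.2.2⟩
  · rintro σ₁ ⟨rem, hrem, hen⟩
    obtain rfl : rem = [] := by simpa using hrem.symm
    have := hen.le_of_nil hN hXp
    simp only [Cond.Holds, WExpr.eval, hen.n]
    omega
  · rintro x l σ₁ ⟨rem, hrem, hen⟩
    obtain ⟨vs, rem, rfl⟩ : ∃ vs rem', rem = vs :: rem' := List.exists_cons_of_ne_nil (by
      rintro rfl; simp at hrem)
    rw [List.map_cons, List.cons.injEq] at hrem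
    obtain ⟨rfl, rfl⟩ := hrem
    have hsq := hL.sq_lt
    have hnM : n + 1 < n ^ (4 * k) + 3 := by
      have : n * n < n ^ (4 * k) + 3 := hsq
      nlinarith
    obtain ⟨b1, b2⟩ := wp_body hN hL.n_lt (hnM.trans_le hU) hXp hen
    refine ⟨by simpa only [Cond.Holds, WExpr.eval, hen.n] using b1, b2.mono le_rfl ?_⟩
    rintro σ₂ - ⟨c1, c2⟩
    exact ⟨c1, rem, rfl, c2⟩
  · have h1 : ((setupTime hL + 1 : ℕ) : ℝ) ≤ 2500 * (k * (n : ℝ) ^ (4 * k)) := by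
      exact_mod_cast setupTime_le hL
    rw [Nat.cast_add, Nat.cast_one] at h1
    refine h1.trans ?_
    have : (0 : ℝ) < k * (n : ℝ) ^ (4 * k) := by positivity
    nlinarith
  · push_cast
    linarith
  · have h1 : ((2 * arrays * (n ^ (4 * k) + 3) * w : ℕ) : ℝ) = 80 * ((n : ℝ) ^ (4 * k) + 3) * (w : ℝ) := by
      push_cast
      ring
    rw [h1]
    have hw0 : (0 : ℝ) ≤ w := Nat.cast_nonneg _
    calc 80 * ((n : ℝ) ^ (4 * k) + 3) * (w : ℝ) ≤ 80 * (4 * (n : ℝ) ^ (4 * k)) * (20 * (k * Real.log n)) := by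
          refine mul_le_mul (by linarith) hw hw0 (by positivity)
      _ = 6400 * (k * (n : ℝ) ^ (4 * k) * Real.log n) := by ring
      _ ≤ _ := by
          refine mul_le_mul_of_nonneg_right (by norm_num) ?_
          have : (0 : ℝ) ≤ Real.log n := by linarith
          positivity
  · refine hw.trans (mul_le_mul_of_nonneg_right (by norm_num) ?_)
    have : (0 : ℝ) ≤ Real.log n := by linarith
    positivity

end Upward

theorem theorem4 :
    ∃ (P : RealRAM.Stmt) (C : ℝ),
      ∀ (n k : ℕ) (G : Digraph (Fin n)) (s t : Fin n)
        (E : List (Fin n × Fin n)) (p : Fin n → ℝ × ℝ),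
        IsPlanarSTGraph G s t →
        IsGreatest {c : ℕ | ∃ W : Finset (Fin n × Fin n), IsSTCutset G s t W ∧ W.card = c} k →
        E.Nodup → (∀ e, e ∈ E ↔ G.Adj e.1 e.2) →
        Function.Injective (fun i => (p i).2) →
        RealRAM.Enumerates P (RealRAM.inputState E p)
          {x | ∃ f : Fin n → Fin n,
            IsUPSE G (Set.range p) (fun v => p (f v)) ∧ x = RealRAM.encode f}
          (C * ((k : ℝ) * (n : ℝ) ^ (4 * k) * Real.log n))
          (C * (n : ℝ))
          (C * ((k : ℝ) * (n : ℝ) ^ (4 * k) * Real.log n))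
          (C * ((k : ℝ) * Real.log n)) :=
  ⟨Upward.Prog.main, 10000, fun _ _ _ _ _ _ _ hG hk hE hEG hp => Upward.enumerates hG hk hE hEG hp⟩
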